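/- Let $0<p<1$, $q=1-p$, $N\ge 1$, and let $\boldsymbol x^0,\boldsymbol x^1,\boldsymbol x^2,\dots$ be the discrete-time TASEP of $N$ particles $x_1>x_2>\dots>x_N$ on $\mathbb Z$ with backward sequential update, i.e. the Markov chain on $\{x_1>\dots>x_N\}\subset\mathbb Z^N$ with one-step transition probability $$P_1(\boldsymbol x|\boldsymbol y)=\prod_{i=1}^N\Big[(q+p\,\delta_{x_{i-1}-y_i,1})\,\delta_{x_i-y_i,0}+p\,\delta_{x_i-y_i,1}\Big],\qquad x_0=\infty,$$ started at time $0$ from the step configuration $x_i^0=1-i$. Fix an integer $x\ge 1-N$ and labels $1\le n_1<\dots<n_m\le N$, and let $t_{n_i}$ be the time at which particle $n_i$ jumps off the site $x+N-n_i$, i.e. the $t\ge 0$ such that the particle is at this site at time $t$ and at the next site at time $t+1$. Let $$K(n_1,\tau_1;n_2,\tau_2)=p\oint_{\Gamma_1}\frac{dv}{2\pi i\,v}\oint_{\Gamma_{0,v}}\frac{dw}{2\pi i\,w}\,\frac{\big(1-p\frac{w-1}{w}\big)^{\tau_1}\big(\frac{w-1}{w}\big)^{n_1}(w/v)^{x+N}}{\big(1-p\frac{v-1}{v}\big)^{\tau_2+1}\big(\frac{v-1}{v}\big)^{n_2}(w-v)}-\mathbf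 1(n_2>n_1)\oint_{\Gamma_{0,1}}\frac{p\,dz}{2\pi i\,z^2}\Big(\frac{z-1}{z}\Big)^{n_1-n_2}\Big(1-p\frac{z-1}{z}\Big)^{\tau_1-\tau_2-1},$$ where $\Gamma_1$ is the circle $|v-1|=r$ and $\Gamma_{0,v}$, $\Gamma_{0,1}$ are the circle $|w-1|=R$ (all anticlockwise), with any $0<r<1<R<1/(1-p)$; thus $\Gamma_1$ encircles $1$ but not $0$ or $-p/q$, and the other contour encircles $0$, $1$ and $\Gamma_1$ but not $-p/q$. Then almost surely the times $t_{n_i}$ are finite and $t_{n_1}\le\dots\le t_{n_m}$, and for all real $a_1,\dots,a_m$ $$\mathbf P(t_{n_1}\le a_1,\dots,t_{n_m}\le a_m)=\det(\mathbf 1-\chi_aK\chi_a)_{\ell^2(\{n_1,\dots,n_m\}\times\mathbb Z_{\ge x})},\qquad \chi_a(n_i)(t)=\mathbf 1(t>a_i).$$ Here the Fredholm determinant is the absolutely convergent series $$\sum_{k\ge0}\frac{(-1)^k}{k!}\sum_{i_1,\dots,i_k=1}^m\ \sum_{\substack{\tau_1>a_{i_1},\dots,\tau_k>a_{i_k}\\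 \tau_1,\dots,\tau_k\ge x}}\det\{K(n_{i_l},\tau_l;n_{i_j},\tau_j)\}_{l,j=1}^k ,$$ and, after conjugation by a suitable positive diagonal matrix (which changes no term of this series), $\chi_aK\chi_a$ is the matrix of a trace class operator on $\ell^2(\{n_1,\dots,n_m\}\times\mathbb Z_{\ge x})$. -/

import Mathlib

open MeasureTheory
open scoped ENNReal Real

noncomputable section

/-! ### TASEP with backward sequential update -/

/-- Configurations `x₁ > x₂ > ⋯ > x_N` of `N` particles on `ℤ`. The index `i : Fin N` stands for the
particle with label `i + 1`, so that `i = 0` is the rightmost particle. -/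
abbrev Config (N : ℕ) : Type := {c : Fin N → ℤ // StrictAnti c}

/-- The step initial configuration: particle `k = i + 1` sits at `1 - k = -i`. -/
def stepConfig (N : ℕ) : Config N :=
  ⟨fun i => -(i : ℤ), fun i j h => by simpa using h⟩

/-- The one-step transition probability from `y` to `x`: the product over the particles `i` of
`(q + p δ_{l,1}) δ_{k,0} + p δ_{k,1}` with `k = x_i - y_i`, `l = x_{i-1} - y_i`, `q = 1 - p`.
The rightmost particle is never blocked (`x_0 = ∞`). -/
def stepProb {N : ℕ} (p : ℝ) (x y : Config N) : ℝ :=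
  ∏ i : Fin N,
    (((1 - p) + if ∃ j : Fin N, (j : ℕ) + 1 = i ∧ x.1 j - y.1 i = 1 then p else 0) *
        (if x.1 i - y.1 i = 0 then 1 else 0) +
      p * (if x.1 i - y.1 i = 1 then 1 else 0))

/-- `X` is a TASEP of `N` particles with hopping probability `p`, started at time `0` from the step
configuration: every finite trajectory has the product of the one-step transition probabilities as
its probability. -/
structure IsStepTASEP {Ω : Type*} [MeasurableSpace Ω] (μ : Measure Ω) (N : ℕ) (p : ℝ)
    (X : ℕ → Ω → Config N) : Prop where
  measurable : ∀ t, Measurable (X t)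
  trajectory : ∀ (t : ℕ) (c : ℕ → Config N),
    μ.real {ω | ∀ s ≤ t, X s ω = c s} =
      (if c 0 = stepConfig N then 1 else 0) * ∏ s ∈ Finset.range t, stepProb p (c (s + 1)) (c s)

/-- The site `x + N - k` that the particle `k = i + 1` has to leave. -/
def exitSite (N : ℕ) (x : ℤ) (i : Fin N) : ℤ := x + N - ((i : ℤ) + 1)

/-- The time at which particle `i` jumps off the site `y`: the `t` with `x_i(t) = y` and
`x_i(t+1) = y + 1` (and `⊤` if there is none). -/
def jumpOffTime {Ω : Type*} {N : ℕ} (X : ℕ → Ω → Config N) (i : Fin N) (y : ℤ) (ω : Ω) : ℕ∞ :=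
  sInf {τ : ℕ∞ | ∃ t : ℕ, τ = t ∧ (X t ω).1 i = y ∧ (X (t + 1) ω).1 i = y + 1}

/-! ### The correlation kernel -/

/-- The kernel `K(n₁,τ₁;n₂,τ₂)`. The contour of `v` is the circle `|v - 1| = r` and the
contour of `w` and of `z` is the circle `|w - 1| = R`. For `0 < r < 1 < R < 1 / (1 - p)` the first one
encircles `1` but neither `0` nor `-p/(1-p)`, and the second one encircles `0`, `1` and the first
contour but not `-p/(1-p)`. -/
def corrKernel (p : ℝ) (N : ℕ) (x : ℤ) (r R : ℝ) (n₁ : ℕ) (τ₁ : ℤ) (n₂ : ℕ) (τ₂ : ℤ) : ℂ :=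
  (p : ℂ) * ((2 * π * Complex.I)⁻¹ * ∮ v in C(1, r), v⁻¹ *
      ((2 * π * Complex.I)⁻¹ * ∮ w in C(1, R), w⁻¹ *
        (((1 - p * ((w - 1) / w)) ^ τ₁ * ((w - 1) / w) ^ n₁ * (w / v) ^ (x + N)) /
          ((1 - p * ((v - 1) / v)) ^ (τ₂ + 1) * ((v - 1) / v) ^ n₂ * (w - v))))) -
  if n₁ < n₂ then
    (2 * π * Complex.I)⁻¹ * ∮ z in C(1, R), (p / z ^ 2) *
      (((z - 1) / z) ^ ((n₁ : ℤ) - n₂) * (1 - p * ((z - 1) / z)) ^ (τ₁ - τ₂ - 1))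
  else 0

/-- The set `{n₁, …, n_m} × ℤ_{≥ x}`, with `n_i` recorded by its position `i`. -/
abbrev LevelTime (m : ℕ) (x : ℤ) : Type := Fin m × {t : ℤ // x ≤ t}

/-- The indicator `χ_a(n_i)(t) = 1(t > a_i)`. -/
def cutoff {m : ℕ} {x : ℤ} (a : Fin m → ℝ) (s : LevelTime m x) : ℂ :=
  open Classical in if a s.1 < (s.2.1 : ℝ) then 1 else 0

/-- The matrix of `χ_a K χ_a` on `{n₁, …, n_m} × ℤ_{≥ x}`. -/
def cutKernel (p : ℝ) (N : ℕ) (x : ℤ) (r R : ℝ) {m : ℕ} (n : Fin m → Fin N) (a : Fin m → ℝ)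
    (s s' : LevelTime m x) : ℂ :=
  cutoff a s * corrKernel p N x r R ((n s.1 : ℕ) + 1) s.2.1 ((n s'.1 : ℕ) + 1) s'.2.1 * cutoff a s'

/-! ### Fredholm determinants on `ℓ²(S)` -/

/-- Absolute convergence of the Fredholm expansion of `det(1 - A)`. -/
def FredholmSummable {S : Type*} (A : S → S → ℂ) : Prop :=
  Summable fun q : Σ k : ℕ, (Fin k → S) =>
    ‖((-1 : ℂ) ^ q.1 / (q.1.factorial : ℂ)) *
      (Matrix.of fun i j : Fin q.1 => A (q.2 i) (q.2 j)).det‖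

/-- The Fredholm determinant `det(1 - A)` of a matrix indexed by a set `S`, through its Fredholm
expansion. -/
def fredholmDet {S : Type*} (A : S → S → ℂ) : ℂ :=
  ∑' k : ℕ, ((-1 : ℂ) ^ k / (k.factorial : ℂ)) *
    ∑' s : Fin k → S, (Matrix.of fun i j : Fin k => A (s i) (s j)).det

/-- Trace class operators on a Hilbert space: those which are a sum of rank one operators whose
trace norms are summable. -/
def IsTraceClass {H : Type*} [NormedAddCommGroup H] [InnerProductSpace ℂ H] (T : H →L[ℂ] H) : Prop :=
  ∃ (ι : Type) (u v : ι → H), (Summable fun i => ‖u i‖ * ‖v i‖) ∧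
    ∀ f : H, HasSum (fun i => inner ℂ (v i) f • u i) (T f)

/-- The matrix `A`, conjugated by some positive diagonal matrix (which changes no term of the
Fredholm expansion), is the matrix of a trace class operator on `ℓ²(S)`. -/
def TraceClassUpToConjugation {S : Type} (A : S → S → ℂ) : Prop :=
  ∃ ρ : S → ℝ, (∀ s, 0 < ρ s) ∧
    ∃ T : lp (fun _ : S => ℂ) 2 →L[ℂ] lp (fun _ : S => ℂ) 2, IsTraceClass T ∧
      ∀ s s', open Classical in
        T (lp.single 2 s' (1 : ℂ)) s = (ρ s : ℂ) * A s s' * (ρ s' : ℂ)⁻¹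

end

/-!
All contour integrals involved are integrals of `(1 - p u) ^ τ * u ^ k * w ^ (L - 2)` with
`u = (w - 1) / w`, and a difference in `τ` is `p` times a shift in `k`. Extracting the pole of the
`v`-integrand of `K` at `v = 1` one order at a time writes the kernel as a finite sum of products
`ψ(τ₁) φ(τ₂)` minus transition functions between the levels, where `φ` and `ψ` are biorthogonal by
summation by parts. As `φ` grows subexponentially and `ψ` decays exponentially, a diagonal
conjugation with growth rates that separate the levels makes the entries of the kernel summable.

The Fredholm determinant is the limit of the determinants of finite sections. In a finite section
the transition part `Ω` is strictly triangular in the levels, and `1 - A = (1 - ψ η) (1 + Ω)` with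
functions `η` defined by recursion over the levels, so that `det (1 - A) = det (1 - η ψ)`, whose
size is the number of particles up to the last label. Summation by parts along the levels turns the
entries in the limit into contour integrals around `0`.

The same determinant is the joint distribution of the exit times. It satisfies the backward
equation of independent free particles, and, by subtracting from the row of a blocked particle the
row of the particle ahead of it, it does not change under a move of the blocked particle. The
exclusion rule may therefore be traded for free jumps, one particle at a time. Finiteness of the
exit times follows by letting the time bounds tend to infinity, where only the empty term of the
Fredholm expansion survives.
-/

noncomputable section

section ContourIntegrals

open Metric Set

/-- The normalised contour integral `(2πi)⁻¹ ∮ f` over the circle `|w - c| = ρ`, that is, the sum of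
the residues of `f` inside this circle. -/
def residueIntegral (c : ℂ) (ρ : ℝ) (f : ℂ → ℂ) : ℂ :=
  (2 * π * Complex.I)⁻¹ * ∮ w in C(c, ρ), f w

variable {c z : ℂ} {ρ : ℝ} {f g : ℂ → ℂ}

lemma residueIntegral_congr (hρ : 0 ≤ ρ) (h : EqOn f g (sphere c ρ)) :
    residueIntegral c ρ f = residueIntegral c ρ g := by
  rw [residueIntegral, circleIntegral.integral_congr hρ h, residueIntegral]

lemma residueIntegral_add (hρ : 0 ≤ ρ) (hf : ContinuousOn f (sphere c ρ))
    (hg : ContinuousOn g (sphere c ρ)) :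
    residueIntegral c ρ (fun w => f w + g w) = residueIntegral c ρ f + residueIntegral c ρ g := by
  simp only [residueIntegral, ← mul_add,
    circleIntegral.integral_add (hf.circleIntegrable hρ) (hg.circleIntegrable hρ)]

lemma residueIntegral_sub (hρ : 0 ≤ ρ) (hf : ContinuousOn f (sphere c ρ))
    (hg : ContinuousOn g (sphere c ρ)) :
    residueIntegral c ρ (fun w => f w - g w) = residueIntegral c ρ f - residueIntegral c ρ g := by
  simp only [residueIntegral, ← mul_sub,
    circleIntegral.integral_sub (hf.circleIntegrable hρ) (hg.circleIntegrable hρ)]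

lemma residueIntegral_const_mul (c : ℂ) (ρ : ℝ) (a : ℂ) (f : ℂ → ℂ) :
    residueIntegral c ρ (fun w => a * f w) = a * residueIntegral c ρ f := by
  rw [residueIntegral, circleIntegral.integral_const_mul, mul_left_comm, residueIntegral]

lemma residueIntegral_mul_const (c : ℂ) (ρ : ℝ) (a : ℂ) (f : ℂ → ℂ) :
    residueIntegral c ρ (fun w => f w * a) = residueIntegral c ρ f * a := by
  simp_rw [mul_comm _ a]
  exact residueIntegral_const_mul c ρ a f

lemma residueIntegral_eq_zero_of_differentiableAt (hρ : 0 ≤ ρ)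
    (h : ∀ w ∈ closedBall c ρ, DifferentiableAt ℂ f w) : residueIntegral c ρ f = 0 := by
  rw [residueIntegral, Complex.circleIntegral_eq_zero_of_differentiable_on_off_countable hρ
    countable_empty (fun w hw => (h w hw).continuousAt.continuousWithinAt)
    (fun w hw => h w (ball_subset_closedBall hw.1)), mul_zero]

lemma residueIntegral_eq_zero_of_hasDerivAt (hρ : 0 ≤ ρ)
    (h : ∀ w ∈ sphere c ρ, HasDerivAt f (g w) w) : residueIntegral c ρ g = 0 := by
  rw [residueIntegral, circleIntegral.integral_eq_zero_of_hasDerivWithinAt hρ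
    (fun w hw => (h w hw).hasDerivWithinAt), mul_zero]

lemma residueIntegral_div_sub (hz : z ∈ ball c ρ)
    (h : ∀ w ∈ closedBall c ρ, DifferentiableAt ℂ f w) :
    residueIntegral c ρ (fun w => f w / (w - z)) = f z := by
  rw [← Complex.two_pi_I_inv_smul_circleIntegral_sub_inv_smul_of_differentiable_on_off_countable
    countable_empty hz (fun w hw => (h w hw).continuousAt.continuousWithinAt)
    (fun w hw => h w (ball_subset_closedBall hw.1))]
  simp only [residueIntegral, smul_eq_mul, div_eq_inv_mul]

lemma residueIntegral_inv_sub (hz : z ∈ ball c ρ) :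
    residueIntegral c ρ (fun w => (w - z)⁻¹) = 1 := by
  simpa using residueIntegral_div_sub (f := fun _ => 1) hz fun w _ => by fun_prop

lemma ne_of_mem_ball_of_mem_sphere {w : ℂ} (hz : z ∈ ball c ρ) (hw : w ∈ sphere c ρ) : w ≠ z := by
  rintro rfl
  exact (mem_ball.1 hz).ne (mem_sphere.1 hw)

/-- Each division by `w - z` replaces `f` by its difference quotient `dslope f z`, so the value does
not depend on the circle. -/
lemma residueIntegral_div_sub_pow {U : Set ℂ} (hU : IsOpen U) (hz : z ∈ ball c ρ)
    (hsub : closedBall c ρ ⊆ U) (hf : DifferentiableOn ℂ f U) (n : ℕ) :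
    residueIntegral c ρ (fun w => f w / (w - z) ^ (n + 1)) =
      (Function.swap dslope z)^[n] f z := by
  have hρ : 0 ≤ ρ := (pos_of_mem_ball hz).le
  have hzU : U ∈ nhds z := hU.mem_nhds (hsub (ball_subset_closedBall hz))
  induction n generalizing f with
  | zero =>
    simpa using residueIntegral_div_sub hz fun w hw => hf.differentiableAt (hU.mem_nhds (hsub hw))
  | succ n ih =>
    have hne : ∀ w ∈ sphere c ρ, w - z ≠ 0 := fun w hw =>
      sub_ne_zero.2 (ne_of_mem_ball_of_mem_sphere hz hw)
    have hslope : DifferentiableOn ℂ (dslope f z) U := (Complex.differentiableOn_dslope hzU).2 hf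
    have hsplit : EqOn (fun w => f w / (w - z) ^ (n + 1 + 1))
        (fun w => (w - z) ^ (-(n + 2 : ℕ) : ℤ) * f z + dslope f z w / (w - z) ^ (n + 1))
        (sphere c ρ) := fun w hw => by
      have hw0 := hne w hw
      simp only [dslope_of_ne f (sub_ne_zero.1 hw0), slope_def_field, zpow_neg, zpow_natCast]
      field_simp
      ring
    have hpole : residueIntegral c ρ (fun w => (w - z) ^ (-(n + 2 : ℕ) : ℤ)) = 0 := by
      rw [residueIntegral, circleIntegral.integral_sub_zpow_of_ne (by lia), mul_zero]
    rw [residueIntegral_congr hρ hsplit, residueIntegral_add hρ, residueIntegral_mul_const, hpole,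
      zero_mul, zero_add, ih hslope, Function.iterate_succ_apply]
    · exact ((continuousOn_id.sub continuousOn_const).zpow₀ _ fun w hw => Or.inl (hne w hw)).mul
        continuousOn_const
    · exact (hslope.continuousOn.mono (sphere_subset_closedBall.trans hsub)).div (by fun_prop)
        fun w hw => pow_ne_zero _ (hne w hw)

lemma residueIntegral_zpow_mul_eq_of_two_circles {U : Set ℂ} (hU : IsOpen U) {c' : ℂ} {ρ' : ℝ}
    (h0 : 0 ∈ ball c ρ) (h0' : 0 ∈ ball c' ρ') (hsub : closedBall c ρ ⊆ U)
    (hsub' : closedBall c' ρ' ⊆ U) (hf : DifferentiableOn ℂ f U) (e : ℤ) :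
    residueIntegral c ρ (fun w => w ^ e * f w) = residueIntegral c' ρ' (fun w => w ^ e * f w) := by
  obtain he | he := le_or_gt 0 e
  · have hd : ∀ w ∈ U, DifferentiableAt ℂ (fun w => w ^ e * f w) w := fun w hw =>
      (differentiableAt_id.zpow (Or.inr he)).mul (hf.differentiableAt (hU.mem_nhds hw))
    rw [residueIntegral_eq_zero_of_differentiableAt (pos_of_mem_ball h0).le fun w hw =>
        hd w (hsub hw), residueIntegral_eq_zero_of_differentiableAt (pos_of_mem_ball h0').le
        fun w hw => hd w (hsub' hw)]
  · obtain ⟨k, rfl⟩ : ∃ k : ℕ, e = -(k + 1 : ℕ) := ⟨(-e - 1).toNat, by lia⟩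
    have h := residueIntegral_div_sub_pow hU h0 hsub hf k
    have h' := residueIntegral_div_sub_pow hU h0' hsub' hf k
    simp only [sub_zero] at h h'
    simpa only [zpow_neg, zpow_natCast, ← div_eq_inv_mul] using h.trans h'.symm

end ContourIntegrals

section TasepIntegral

open Metric Set

/-- The integrand `(1 - p u) ^ τ * u ^ k * w ^ (L - 2)` with `u = (w - 1) / w`, from which all
contour integrals of the problem are built. The exponent is normalised so that `u` has derivative
`w ^ (L - 2)` for `L = 0`. -/
def tasepIntegrand (p : ℂ) (L k τ : ℤ) (w : ℂ) : ℂ :=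
  (1 - p * ((w - 1) / w)) ^ τ * ((w - 1) / w) ^ k * w ^ (L - 2)

/-- The contour integral of `tasepIntegrand` over the circle `|w - c| = ρ`. -/
def tasepIntegral (p c : ℂ) (ρ : ℝ) (L k τ : ℤ) : ℂ := residueIntegral c ρ (tasepIntegrand p L k τ)

/-- The points at which no factor of `tasepIntegrand` has a zero or a pole. -/
structure IsRegularPoint (p w : ℂ) : Prop where
  ne_zero : w ≠ 0
  ne_one : w ≠ 1
  factor_ne_zero : 1 - p * ((w - 1) / w) ≠ 0

/-- The circles that avoid all zeros and poles of `tasepIntegrand`. -/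
structure IsRegularCircle (p c : ℂ) (ρ : ℝ) : Prop where
  radius_nonneg : 0 ≤ ρ
  isRegularPoint : ∀ w ∈ sphere c ρ, IsRegularPoint p w

section Recurrences

variable {p c w : ℂ} {ρ : ℝ}

lemma IsRegularPoint.ratio_ne_zero (h : IsRegularPoint p w) : (w - 1) / w ≠ 0 :=
  div_ne_zero (sub_ne_zero.2 h.ne_one) h.ne_zero

lemma differentiableAt_tasepIntegrand (h0 : w ≠ 0) {k τ : ℤ} (h1 : w ≠ 1 ∨ 0 ≤ k)
    (h : 1 - p * ((w - 1) / w) ≠ 0 ∨ 0 ≤ τ) (L : ℤ) :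
    DifferentiableAt ℂ (tasepIntegrand p L k τ) w := by
  have hu : DifferentiableAt ℂ (fun w : ℂ => (w - 1) / w) w :=
    (differentiableAt_id.sub_const 1).div differentiableAt_id h0
  have hu0 : (w - 1) / w ≠ 0 ∨ 0 ≤ k := h1.imp_left fun h1 => div_ne_zero (sub_ne_zero.2 h1) h0
  exact ((((hu.const_mul p).const_sub 1).zpow h).mul (hu.zpow hu0)).mul
    (differentiableAt_id.zpow (Or.inl h0))

lemma IsRegularCircle.continuousOn (h : IsRegularCircle p c ρ) (L k τ : ℤ) :
    ContinuousOn (tasepIntegrand p L k τ) (sphere c ρ) := fun w hw =>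
  have hw := h.isRegularPoint w hw
  (differentiableAt_tasepIntegrand hw.ne_zero (Or.inl hw.ne_one) (Or.inl hw.factor_ne_zero)
    L).continuousAt.continuousWithinAt

lemma one_sub_mul_ratio (hw : w ≠ 0) : 1 - p * ((w - 1) / w) = ((1 - p) * w + p) / w := by
  field_simp
  ring

lemma IsRegularPoint.of_linear_ne_zero (h0 : w ≠ 0) (h1 : w ≠ 1) (h : (1 - p) * w + p ≠ 0) :
    IsRegularPoint p w :=
  ⟨h0, h1, one_sub_mul_ratio (p := p) h0 ▸ div_ne_zero h h0⟩

lemma IsRegularPoint.tasepIntegrand_eq (h : IsRegularPoint p w) (L k τ : ℤ) :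
    tasepIntegrand p L k τ w =
      w ^ (L - 2 - k - τ) * (((1 - p) * w + p) ^ τ * (w - 1) ^ k) := by
  rw [tasepIntegrand, one_sub_mul_ratio h.ne_zero, div_zpow, div_zpow,
    zpow_sub₀ h.ne_zero (L - 2 - k) τ, zpow_sub₀ h.ne_zero (L - 2) k]
  ring

lemma IsRegularPoint.tasepIntegrand_mul (h : IsRegularPoint p w) (L k τ L' k' τ' : ℤ) :
    tasepIntegrand p L k τ w * tasepIntegrand p L' k' τ' w * w ^ 2 =
      tasepIntegrand p (L + L') (k + k') (τ + τ') w := by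
  simp only [tasepIntegrand]
  rw [zpow_add₀ h.factor_ne_zero, zpow_add₀ h.ratio_ne_zero,
    show L + L' - 2 = L - 2 + (L' - 2) + (2 : ℕ) by push_cast; ring, zpow_add₀ h.ne_zero,
    zpow_add₀ h.ne_zero, zpow_natCast]
  ring

lemma IsRegularCircle.tasepIntegral_eq (h : IsRegularCircle p c ρ) (L k τ : ℤ) :
    tasepIntegral p c ρ L k τ = residueIntegral c ρ fun w =>
      w ^ (L - 2 - k - τ) * (((1 - p) * w + p) ^ τ * (w - 1) ^ k) :=
  residueIntegral_congr h.radius_nonneg fun w hw =>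
    (h.isRegularPoint w hw).tasepIntegrand_eq L k τ

lemma IsRegularCircle.tasepIntegral_sub_succ (h : IsRegularCircle p c ρ) (L k τ : ℤ) :
    tasepIntegral p c ρ L k τ - tasepIntegral p c ρ L k (τ + 1) =
      p * tasepIntegral p c ρ L (k + 1) τ := by
  simp only [tasepIntegral]
  rw [← residueIntegral_const_mul, ← residueIntegral_sub h.radius_nonneg (h.continuousOn _ _ _)
    (h.continuousOn _ _ _)]
  refine residueIntegral_congr h.radius_nonneg fun w hw => ?_
  have hw := h.isRegularPoint w hw
  simp only [tasepIntegrand, zpow_add_one₀ hw.factor_ne_zero, zpow_add_one₀ hw.ratio_ne_zero]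
  ring

lemma IsRegularCircle.tasepIntegral_pred (h : IsRegularCircle p c ρ) (L k τ : ℤ) :
    tasepIntegral p c ρ (L - 1) k τ =
      tasepIntegral p c ρ L k τ - tasepIntegral p c ρ L (k + 1) τ := by
  simp only [tasepIntegral]
  rw [← residueIntegral_sub h.radius_nonneg (h.continuousOn _ _ _) (h.continuousOn _ _ _)]
  refine residueIntegral_congr h.radius_nonneg fun w hw => ?_
  have hw := h.isRegularPoint w hw
  have hw0 := hw.ne_zero
  simp only [tasepIntegrand, zpow_add_one₀ hw.ratio_ne_zero, sub_right_comm L 1 2,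
    zpow_sub_one₀ hw0]
  field_simp
  ring

lemma IsRegularCircle.tasepIntegral_succ (h : IsRegularCircle p c ρ) (L k τ : ℤ) :
    tasepIntegral p c ρ L k (τ + 1) =
      (1 - p) * tasepIntegral p c ρ L k τ + p * tasepIntegral p c ρ (L - 1) k τ := by
  linear_combination -h.tasepIntegral_sub_succ L k τ - p * h.tasepIntegral_pred L k τ

/-- For `L = k = 0` the integrand is the derivative of a multiple of `(1 - p u) ^ (τ + 1)`. -/
lemma IsRegularCircle.tasepIntegral_zero_zero (h : IsRegularCircle p c ρ) (hp : p ≠ 0) {τ : ℤ}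
    (hτ : τ ≠ -1) : tasepIntegral p c ρ 0 0 τ = 0 := by
  have hτ' : (τ : ℂ) + 1 ≠ 0 := mod_cast fun h : τ + 1 = 0 => hτ (by lia)
  refine residueIntegral_eq_zero_of_hasDerivAt h.radius_nonneg
    (f := fun w => -(1 / (p * (τ + 1))) * (1 - p * ((w - 1) / w)) ^ (τ + 1)) fun w hw => ?_
  have hw := h.isRegularPoint w hw
  have hw0 := hw.ne_zero
  have hu : HasDerivAt (fun w : ℂ => (w - 1) / w) ((1 * w - (w - 1) * 1) / w ^ 2) w :=
    ((hasDerivAt_id w).sub_const 1).div (hasDerivAt_id w) hw0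
  refine (((hasDerivAt_zpow (τ + 1) _ (Or.inl hw.factor_ne_zero)).comp w
    ((hu.const_mul p).const_sub 1)).const_mul (-(1 / (p * (τ + 1))))).congr_deriv ?_
  simp only [tasepIntegrand, add_sub_cancel_right, zpow_zero, mul_one]
  rw [show (0 : ℤ) - 2 = -((2 : ℕ) : ℤ) by norm_num, zpow_neg, zpow_natCast]
  push_cast
  field_simp
  ring

/-- For `L = τ = 0` the integrand is the derivative of a multiple of `u ^ (k + 1)`. -/
lemma IsRegularCircle.tasepIntegral_zero_of_ne (h : IsRegularCircle p c ρ) {k : ℤ} (hk : k ≠ -1) :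
    tasepIntegral p c ρ 0 k 0 = 0 := by
  have hk' : (k : ℂ) + 1 ≠ 0 := mod_cast fun h : k + 1 = 0 => hk (by lia)
  refine residueIntegral_eq_zero_of_hasDerivAt h.radius_nonneg
    (f := fun w => 1 / (k + 1) * ((w - 1) / w) ^ (k + 1)) fun w hw => ?_
  have hw := h.isRegularPoint w hw
  have hw0 := hw.ne_zero
  have hu : HasDerivAt (fun w : ℂ => (w - 1) / w) ((1 * w - (w - 1) * 1) / w ^ 2) w :=
    ((hasDerivAt_id w).sub_const 1).div (hasDerivAt_id w) hw0
  have hpow := (hasDerivAt_zpow (k + 1) ((w - 1) / w) (Or.inl hw.ratio_ne_zero)).comp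
    (h := fun w : ℂ => (w - 1) / w) w hu
  refine (hpow.const_mul (1 / ((k : ℂ) + 1))).congr_deriv ?_
  simp only [tasepIntegrand, add_sub_cancel_right, zpow_zero, one_mul]
  rw [show (0 : ℤ) - 2 = -((2 : ℕ) : ℤ) by norm_num, zpow_neg, zpow_natCast]
  push_cast
  field_simp
  ring

end Recurrences

section Circles

variable {p r R : ℝ}

lemma linear_ne_zero_of_mem_closedBall_one (hp1 : p < 1) (hR : R < 1 / (1 - p)) {w : ℂ}
    (hw : w ∈ closedBall 1 R) : (1 - p) * w + p ≠ (0 : ℂ) := by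
  intro h
  have hq : 0 < 1 - p := by linarith
  have hqc : ((1 - p : ℝ) : ℂ) ≠ 0 := mod_cast hq.ne'
  have hw' : w - 1 = -((1 / (1 - p) : ℝ) : ℂ) := by
    push_cast at hqc ⊢
    field_simp
    linear_combination h
  rw [mem_closedBall, dist_eq_norm, hw', norm_neg, Complex.norm_real,
    Real.norm_of_nonneg (by positivity)] at hw
  linarith

lemma linear_ne_zero_of_mem_closedBall_zero (hp0 : 0 < p) (hp1 : p < 1) {w : ℂ}
    (hw : w ∈ closedBall 0 (p / 2)) : (1 - p) * w + p ≠ (0 : ℂ) := by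
  intro h
  have hnorm : (1 - p) * ‖w‖ = p := by
    have := congrArg norm (show ((1 - p : ℝ) : ℂ) * w = -(p : ℂ) by
      push_cast; linear_combination h)
    rwa [norm_mul, norm_neg, Complex.norm_real, Complex.norm_real,
      Real.norm_of_nonneg (by linarith), Real.norm_of_nonneg hp0.le] at this
  have hw : ‖w‖ ≤ p / 2 := mem_closedBall_zero_iff.1 hw
  nlinarith [norm_nonneg w]

lemma ne_zero_of_mem_closedBall_one (hr1 : r < 1) {w : ℂ} (hw : w ∈ closedBall 1 r) : w ≠ 0 := by
  rintro rfl
  simp only [mem_closedBall, dist_zero_left, norm_one] at hw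
  linarith

lemma ne_one_of_mem_closedBall_zero (hp0 : 0 < p) (hp1 : p < 1) {w : ℂ}
    (hw : w ∈ closedBall 0 (p / 2)) : w ≠ 1 := by
  rintro rfl
  simp only [mem_closedBall, dist_zero_right, norm_one] at hw
  linarith

lemma ne_zero_and_ne_one_of_lt_norm {w : ℂ} (hw : 1 < ‖w - 1‖) : w ≠ 0 ∧ w ≠ 1 := by
  constructor <;> rintro rfl <;> norm_num at hw

lemma isRegularCircle_outer (hp1 : p < 1) (hR1 : 1 < R) (hR : R < 1 / (1 - p)) :
    IsRegularCircle p 1 R where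
  radius_nonneg := by linarith
  isRegularPoint w hw :=
    have hne := ne_zero_and_ne_one_of_lt_norm (by rwa [mem_sphere_iff_norm.1 hw])
    .of_linear_ne_zero hne.1 hne.2
      (linear_ne_zero_of_mem_closedBall_one hp1 hR (sphere_subset_closedBall hw))

lemma isRegularCircle_inner (hp0 : 0 < p) (hp1 : p < 1) (hr0 : 0 < r) (hr1 : r < 1) :
    IsRegularCircle p 1 r where
  radius_nonneg := hr0.le
  isRegularPoint w hw :=
    .of_linear_ne_zero (ne_zero_of_mem_closedBall_one hr1 (sphere_subset_closedBall hw))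
      (ne_of_mem_ball_of_mem_sphere (mem_ball_self hr0) hw)
      (linear_ne_zero_of_mem_closedBall_one hp1 (by rw [lt_div_iff₀ (by linarith)]; nlinarith)
        (sphere_subset_closedBall hw))

lemma isRegularCircle_origin (hp0 : 0 < p) (hp1 : p < 1) : IsRegularCircle p 0 (p / 2) where
  radius_nonneg := by linarith
  isRegularPoint w hw :=
    .of_linear_ne_zero (ne_of_mem_ball_of_mem_sphere (mem_ball_self (half_pos hp0)) hw)
      (ne_one_of_mem_closedBall_zero hp0 hp1 (sphere_subset_closedBall hw))
      (linear_ne_zero_of_mem_closedBall_zero hp0 hp1 (sphere_subset_closedBall hw))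

lemma differentiableAt_tasepIntegrand_of_mem_closedBall (hp0 : 0 < p) (hp1 : p < 1) (hr0 : 0 < r)
    (hr1 : r < 1) {k : ℤ} (hk : 0 ≤ k) (L τ : ℤ) {w : ℂ} (hw : w ∈ closedBall 1 r) :
    DifferentiableAt ℂ (tasepIntegrand p L k τ) w := by
  have h0 := ne_zero_of_mem_closedBall_one hr1 hw
  have hr : r < 1 / (1 - p) := by rw [lt_div_iff₀ (by linarith)]; nlinarith
  refine differentiableAt_tasepIntegrand h0 (Or.inr hk) (Or.inl ?_) L
  rw [one_sub_mul_ratio h0]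
  exact div_ne_zero (linear_ne_zero_of_mem_closedBall_one hp1 hr hw) h0

lemma tasepIntegral_inner_eq_zero (hp0 : 0 < p) (hp1 : p < 1) (hr0 : 0 < r) (hr1 : r < 1)
    {k : ℤ} (hk : 0 ≤ k) (L τ : ℤ) : tasepIntegral p 1 r L k τ = 0 :=
  residueIntegral_eq_zero_of_differentiableAt hr0.le fun _ =>
    differentiableAt_tasepIntegrand_of_mem_closedBall hp0 hp1 hr0 hr1 hk L τ

lemma tasepIntegral_inner_neg_one (hp0 : 0 < p) (hp1 : p < 1) (hr0 : 0 < r) (hr1 : r < 1)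
    (L τ : ℤ) : tasepIntegral p 1 r L (-1) τ = 1 := by
  have hresidue := residueIntegral_div_sub (f := tasepIntegrand p (L + 1) 0 τ)
    (mem_ball_self hr0) fun w =>
      differentiableAt_tasepIntegrand_of_mem_closedBall hp0 hp1 hr0 hr1 le_rfl (L + 1) τ
  have hvalue : tasepIntegrand p (L + 1) 0 τ 1 = 1 := by simp [tasepIntegrand]
  refine (residueIntegral_congr hr0.le fun w hw => ?_).trans (hresidue.trans hvalue)
  have hw := isRegularCircle_inner hp0 hp1 hr0 hr1 |>.isRegularPoint w hw
  simp only [tasepIntegrand, zpow_neg_one, inv_div, zpow_zero, mul_one,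
    show L + 1 - 2 = L - 2 + 1 by ring, zpow_add_one₀ hw.ne_zero]
  ring

lemma tasepIntegral_outer_zero_neg_one_zero (hp1 : p < 1) (hR1 : 1 < R) (hR : R < 1 / (1 - p)) :
    tasepIntegral p 1 R 0 (-1) 0 = 0 := by
  have hreg := isRegularCircle_outer hp1 hR1 hR
  have hsplit : tasepIntegral p 1 R 0 (-1) 0 =
      residueIntegral 1 R fun w => (w - 1)⁻¹ - (w - 0)⁻¹ :=
    residueIntegral_congr hreg.radius_nonneg fun w hw => by
      have hw := hreg.isRegularPoint w hw
      have hw0 := hw.ne_zero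
      have hw1 := sub_ne_zero.2 hw.ne_one
      simp only [tasepIntegrand, zpow_zero, zpow_neg_one, inv_div, sub_zero, one_mul]
      rw [show (0 : ℤ) - 2 = -((2 : ℕ) : ℤ) by norm_num, zpow_neg, zpow_natCast]
      field_simp
      ring
  have hcont : ∀ z ∈ ball (1 : ℂ) R, ContinuousOn (fun w => (w - z)⁻¹) (sphere 1 R) :=
    fun z hz => (continuousOn_id.sub continuousOn_const).inv₀ fun w hw =>
      sub_ne_zero.2 (ne_of_mem_ball_of_mem_sphere hz hw)
  have h0 : (0 : ℂ) ∈ ball 1 R := by simpa using hR1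
  have h1 : (1 : ℂ) ∈ ball 1 R := mem_ball_self (by linarith)
  rw [hsplit, residueIntegral_sub hreg.radius_nonneg (hcont 1 h1) (hcont 0 h0),
    residueIntegral_inv_sub h1, residueIntegral_inv_sub h0, sub_self]

lemma tasepIntegral_outer_eq_origin (hp0 : 0 < p) (hp1 : p < 1) (hR1 : 1 < R)
    (hR : R < 1 / (1 - p)) (L : ℤ) {k : ℤ} (hk : 0 ≤ k) (τ : ℤ) :
    tasepIntegral p 1 R L k τ = tasepIntegral p 0 (p / 2) L k τ := by
  rw [(isRegularCircle_outer hp1 hR1 hR).tasepIntegral_eq,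
    (isRegularCircle_origin hp0 hp1).tasepIntegral_eq]
  have hU : IsOpen {w : ℂ | (1 - p) * w + p ≠ (0 : ℂ)} :=
    isOpen_ne_fun (by fun_prop) continuous_const
  refine residueIntegral_zpow_mul_eq_of_two_circles hU (by simpa using hR1) (by simpa using hp0)
    (fun w hw => linear_ne_zero_of_mem_closedBall_one hp1 hR hw)
    (fun w hw => linear_ne_zero_of_mem_closedBall_zero hp0 hp1 hw)
    (fun w hw => DifferentiableAt.differentiableWithinAt ?_) _
  exact .mul (.zpow (by fun_prop) (Or.inl hw)) (.zpow (by fun_prop) (Or.inr hk))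

lemma tasepIntegral_origin_eq_zero (hp0 : 0 < p) (hp1 : p < 1) {L k τ : ℤ}
    (h : 0 ≤ L - 2 - k - τ) : tasepIntegral p 0 (p / 2) L k τ = 0 := by
  rw [(isRegularCircle_origin hp0 hp1).tasepIntegral_eq]
  refine residueIntegral_eq_zero_of_differentiableAt (by linarith) fun w hw => ?_
  have hlin := linear_ne_zero_of_mem_closedBall_zero hp0 hp1 hw
  have hw1 := sub_ne_zero.2 (ne_one_of_mem_closedBall_zero hp0 hp1 hw)
  exact .mul (.zpow (by fun_prop) (Or.inr h))
    (.mul (.zpow (by fun_prop) (Or.inl hlin)) (.zpow (by fun_prop) (Or.inl hw1)))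

lemma tasepIntegral_origin_zero_natCast (hp0 : 0 < p) (hp1 : p < 1) (k τ : ℕ) :
    tasepIntegral p 0 (p / 2) 0 k τ = 0 := by
  have hp : (p : ℂ) ≠ 0 := mod_cast hp0.ne'
  have hreg := isRegularCircle_origin hp0 hp1
  induction k generalizing τ with
  | zero => exact hreg.tasepIntegral_zero_zero hp (by lia)
  | succ k ih =>
    have hdiff := hreg.tasepIntegral_sub_succ 0 k τ
    have hsucc := ih (τ + 1)
    push_cast at hsucc ⊢
    rw [ih, hsucc, sub_zero] at hdiff
    exact (mul_eq_zero.1 hdiff.symm).resolve_left hp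

lemma mul_tasepIntegral_origin_zero_zero_neg_one (hp0 : 0 < p) (hp1 : p < 1) :
    p * tasepIntegral p 0 (p / 2) 0 0 (-1) = 1 := by
  have hresidue : residueIntegral 0 (p / 2) (fun w => ((1 - p) * w + p)⁻¹ / (w - 0)) =
      ((1 - p) * 0 + p : ℂ)⁻¹ :=
    residueIntegral_div_sub (f := fun w => ((1 - p) * w + p)⁻¹) (by simpa using hp0) fun w hw =>
      DifferentiableAt.inv (by fun_prop) (linear_ne_zero_of_mem_closedBall_zero hp0 hp1 hw)
  have hint : tasepIntegral p 0 (p / 2) 0 0 (-1) = (p : ℂ)⁻¹ := by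
    rw [(isRegularCircle_origin hp0 hp1).tasepIntegral_eq]
    convert hresidue using 2
    · ext w
      norm_num [div_eq_mul_inv, mul_comm]
    · ring
  rw [hint, mul_inv_cancel₀ (mod_cast hp0.ne')]

lemma tasepIntegral_origin_zero_neg_one_zero (hp0 : 0 < p) (hp1 : p < 1) :
    tasepIntegral p 0 (p / 2) 0 (-1) 0 = -1 := by
  have hresidue : residueIntegral 0 (p / 2) (fun w => (w - 1)⁻¹ / (w - 0)) = (0 - 1)⁻¹ :=
    residueIntegral_div_sub (f := fun w => (w - 1)⁻¹) (by simpa using hp0) fun w hw =>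
      DifferentiableAt.inv (by fun_prop)
        (sub_ne_zero.2 (ne_one_of_mem_closedBall_zero hp0 hp1 hw))
  rw [(isRegularCircle_origin hp0 hp1).tasepIntegral_eq]
  convert hresidue using 2
  · ext w
    norm_num [div_eq_mul_inv, mul_comm]
  · norm_num

lemma tasepIntegral_origin_zero_neg_one (hp0 : 0 < p) (hp1 : p < 1) (τ : ℕ) :
    tasepIntegral p 0 (p / 2) 0 (-1) τ = -1 := by
  induction τ with
  | zero => exact tasepIntegral_origin_zero_neg_one_zero hp0 hp1
  | succ τ ih =>
    have hdiff := (isRegularCircle_origin hp0 hp1).tasepIntegral_sub_succ 0 (-1) τ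
    have hzero := tasepIntegral_origin_zero_natCast hp0 hp1 0 τ
    push_cast at hzero ⊢
    rw [ih, neg_add_cancel, hzero] at hdiff
    linear_combination -hdiff

end Circles

section Decay

variable {p R R' : ℝ}

lemma tasepIntegral_eq_of_radius_le (p : ℂ) (hR1 : 1 < R) (hRR' : R ≤ R') (L k : ℤ) {τ : ℤ}
    (hτ : 0 ≤ τ) : tasepIntegral p 1 R L k τ = tasepIntegral p 1 R' L k τ := by
  have hd : ∀ z ∉ ball (1 : ℂ) R, DifferentiableAt ℂ (tasepIntegrand p L k τ) z := fun z hz =>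
    have hne := ne_zero_and_ne_one_of_lt_norm (hR1.trans_le (by simpa [dist_eq_norm] using hz))
    differentiableAt_tasepIntegrand hne.1 (Or.inl hne.2) (Or.inr hτ) L
  rw [tasepIntegral, tasepIntegral, residueIntegral, residueIntegral,
    Complex.circleIntegral_eq_of_differentiable_on_annulus_off_countable (by linarith) hRR'
      countable_empty (fun z hz => (hd z hz.2).continuousAt.continuousWithinAt)
      (fun z hz => hd z fun h => hz.1.2 (ball_subset_closedBall h))]

lemma norm_one_sub_mul_ratio_le (hp0 : 0 < p) (hp1 : p < 1) {w : ℂ} (hw : 2 ≤ ‖w‖) :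
    ‖1 - (p : ℂ) * ((w - 1) / w)‖ ≤ 1 - p / 2 := by
  have hw0 : w ≠ 0 := norm_pos_iff.1 (by linarith)
  have hq : ‖(1 - p : ℂ)‖ = 1 - p := by
    rw [← Complex.ofReal_one, ← Complex.ofReal_sub, Complex.norm_real,
      Real.norm_of_nonneg (by linarith)]
  rw [one_sub_mul_ratio hw0, norm_div, div_le_iff₀ (by linarith)]
  refine (norm_add_le _ _).trans ?_
  rw [norm_mul, hq, Complex.norm_real, Real.norm_of_nonneg hp0.le]
  nlinarith

/-- On the circle of radius `R + 2` around `1` the factor `1 - p u` has modulus at most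
`1 - p / 2`. -/
lemma exists_norm_tasepIntegral_outer_le (hp0 : 0 < p) (hp1 : p < 1) (hR1 : 1 < R) (L k : ℤ) :
    ∃ C : ℝ, ∀ τ : ℕ, ‖tasepIntegral p 1 R L k τ‖ ≤ C * (1 - p / 2) ^ τ := by
  have hfar : ∀ w ∈ sphere (1 : ℂ) (R + 2), w ≠ 0 ∧ w ≠ 1 := fun w hw =>
    ne_zero_and_ne_one_of_lt_norm (by rw [mem_sphere_iff_norm.1 hw]; linarith)
  obtain ⟨C, hC⟩ := (isCompact_sphere (1 : ℂ) (R + 2)).exists_bound_of_continuousOn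
    (f := tasepIntegrand p L k 0) fun w hw => (differentiableAt_tasepIntegrand (hfar w hw).1
      (Or.inl (hfar w hw).2) (Or.inr le_rfl) L).continuousAt.continuousWithinAt
  refine ⟨(R + 2) * C, fun τ => ?_⟩
  rw [tasepIntegral_eq_of_radius_le p hR1 (show R ≤ R + 2 by linarith) L k (by positivity)]
  have hbound : ∀ w ∈ sphere (1 : ℂ) (R + 2),
      ‖tasepIntegrand p L k τ w‖ ≤ C * (1 - p / 2) ^ τ := fun w hw => by
    have hw2 : 2 ≤ ‖w‖ := by
      have h := norm_sub_norm_le (w - 1) (-1)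
      rw [norm_neg, norm_one, sub_neg_eq_add, sub_add_cancel, mem_sphere_iff_norm.1 hw] at h
      linarith
    have hfactor : tasepIntegrand p L k τ w =
        (1 - p * ((w - 1) / w)) ^ τ * tasepIntegrand p L k 0 w := by
      simp only [tasepIntegrand, zpow_natCast, zpow_zero, one_mul, mul_assoc]
    rw [hfactor, norm_mul, norm_pow, mul_comm]
    exact mul_le_mul (hC w hw) (pow_le_pow_left₀ (norm_nonneg _)
      (norm_one_sub_mul_ratio_le hp0 hp1 hw2) _) (by positivity) ((norm_nonneg _).trans (hC w hw))
  have h := circleIntegral.norm_two_pi_i_inv_smul_integral_le_of_norm_le_const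
    (show 0 ≤ R + 2 by linarith) hbound
  rwa [smul_eq_mul, ← mul_assoc] at h

end Decay

end TasepIntegral

section KernelDecomposition

open Finset Metric Set

/-- The Cauchy transform of `β` over the circle `|w - 1| = R` in the coordinate `(w - 1) / w`. -/
def ratioCauchyTransform (R : ℝ) (β : ℂ → ℂ) (v : ℂ) : ℂ :=
  residueIntegral 1 R fun w => β w * ((w - 1) / w - (v - 1) / v)⁻¹

section CauchyTransform

variable {r R : ℝ} {v w : ℂ} {β : ℂ → ℂ}

lemma inv_ratio_sub_ratio (hw : w ≠ 0) (hv : v ≠ 0) :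
    ((w - 1) / w - (v - 1) / v)⁻¹ = w * v / (w - v) := by
  have h : (w - 1) / w - (v - 1) / v = (w - v) / (w * v) := by
    field_simp
    ring
  rw [h, inv_div]

lemma ne_zero_and_ne_one_of_mem_sphere (hR1 : 1 < R) (hw : w ∈ sphere (1 : ℂ) R) :
    w ≠ 0 ∧ w ≠ 1 :=
  ne_zero_and_ne_one_of_lt_norm (by rwa [mem_sphere_iff_norm.1 hw])

lemma ratioCauchyTransform_eq (hR1 : 1 < R) (β : ℂ → ℂ) (hv : v ≠ 0) :
    ratioCauchyTransform R β v = v * residueIntegral 1 R fun w => (w - v)⁻¹ * (β w * w) := by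
  rw [ratioCauchyTransform, ← residueIntegral_const_mul]
  refine residueIntegral_congr (by linarith) fun w hw => ?_
  simp only [inv_ratio_sub_ratio (ne_zero_and_ne_one_of_mem_sphere hR1 hw).1 hv]
  ring

lemma differentiableAt_ratioCauchyTransform (hR1 : 1 < R) (hβ : ContinuousOn β (sphere 1 R))
    (hv : v ∈ ball (1 : ℂ) 1) : DifferentiableAt ℂ (ratioCauchyTransform R β) v := by
  lift R to NNReal using by linarith
  have hint : CircleIntegrable (fun w => β w * w) 1 R :=
    (hβ.mul continuousOn_id).circleIntegrable R.2
  have hvR : v ∈ eball (1 : ℂ) R := by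
    rw [mem_eball, edist_dist, ENNReal.ofReal_lt_coe_iff dist_nonneg]
    exact (mem_ball.1 hv).trans hR1
  have hcauchy : DifferentiableAt ℂ
      (fun v => residueIntegral 1 R fun w => (w - v)⁻¹ * (β w * w)) v :=
    ((hasFPowerSeriesOn_cauchy_integral hint (by linarith)).analyticAt_of_mem
      hvR).differentiableAt
  refine (differentiableAt_id.mul hcauchy).congr_of_eventuallyEq ?_
  filter_upwards [isOpen_ball.mem_nhds hv] with v' hv'
  exact ratioCauchyTransform_eq hR1 β fun h => by simp [h] at hv'

lemma ratio_sub_ratio_ne_zero (hr1 : r < 1) (hR1 : 1 < R) (hv : v ∈ sphere (1 : ℂ) r)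
    (hw : w ∈ sphere (1 : ℂ) R) : (w - 1) / w - (v - 1) / v ≠ 0 := by
  have hw0 := (ne_zero_and_ne_one_of_mem_sphere hR1 hw).1
  have hv0 := ne_zero_of_mem_closedBall_one hr1 (sphere_subset_closedBall hv)
  refine inv_eq_zero.not.1 ?_
  rw [inv_ratio_sub_ratio hw0 hv0]
  refine div_ne_zero (mul_ne_zero hw0 hv0) (sub_ne_zero.2 ?_)
  rintro rfl
  linarith [mem_sphere.1 hv, mem_sphere.1 hw]

lemma continuousOn_ratio_sphere (hR1 : 1 < R) :
    ContinuousOn (fun w : ℂ => (w - 1) / w) (sphere 1 R) :=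
  (continuousOn_id.sub continuousOn_const).div continuousOn_id fun _ hw =>
    (ne_zero_and_ne_one_of_mem_sphere hR1 hw).1

lemma ratio_ne_zero_of_mem_sphere (hR1 : 1 < R) (hw : w ∈ sphere (1 : ℂ) R) : (w - 1) / w ≠ 0 :=
  have h := ne_zero_and_ne_one_of_mem_sphere hR1 hw
  div_ne_zero (sub_ne_zero.2 h.2) h.1

/-- This integrates `1 / (a - b) = 1 / a + b / (a (a - b))` for `a = (w - 1) / w` and
`b = (v - 1) / v`. -/
lemma ratioCauchyTransform_eq_add (hr1 : r < 1) (hR1 : 1 < R) (hβ : ContinuousOn β (sphere 1 R))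
    (hv : v ∈ sphere (1 : ℂ) r) :
    ratioCauchyTransform R β v =
      residueIntegral 1 R (fun w => β w * ((w - 1) / w)⁻¹) +
        (v - 1) / v * ratioCauchyTransform R (fun w => β w * ((w - 1) / w)⁻¹) v := by
  have hu := continuousOn_ratio_sphere hR1
  have hu0 : ∀ w ∈ sphere (1 : ℂ) R, (w - 1) / w ≠ 0 := fun w => ratio_ne_zero_of_mem_sphere hR1
  have hne : ∀ w ∈ sphere (1 : ℂ) R, (w - 1) / w - (v - 1) / v ≠ 0 := fun w =>
    ratio_sub_ratio_ne_zero hr1 hR1 hv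
  have hβu : ContinuousOn (fun w => β w * ((w - 1) / w)⁻¹) (sphere 1 R) := hβ.mul (hu.inv₀ hu0)
  have hpole : ContinuousOn (fun w => (v - 1) / v *
      (β w * ((w - 1) / w)⁻¹ * ((w - 1) / w - (v - 1) / v)⁻¹)) (sphere 1 R) :=
    continuousOn_const.mul (hβu.mul ((hu.sub continuousOn_const).inv₀ hne))
  rw [ratioCauchyTransform, ratioCauchyTransform, ← residueIntegral_const_mul,
    ← residueIntegral_add (by linarith) hβu hpole]
  refine residueIntegral_congr (by linarith) fun w hw => ?_
  have ha := hu0 w hw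
  have hab := hne w hw
  generalize (w - 1) / w = a at *
  generalize (v - 1) / v = b at *
  field_simp
  ring

end CauchyTransform

section TasepCauchyTransform

variable {p r R : ℝ}

lemma residueIntegral_tasepIntegrand_mul_ratioCauchyTransform_eq_add (hp0 : 0 < p) (hp1 : p < 1)
    (hr0 : 0 < r) (hr1 : r < 1) (hR1 : 1 < R) (L k τ : ℤ) {β : ℂ → ℂ}
    (hβ : ContinuousOn β (sphere 1 R)) :
    residueIntegral 1 r (fun v => tasepIntegrand p L k τ v * ratioCauchyTransform R β v) =
      residueIntegral 1 r (fun v => tasepIntegrand p L (k + 1) τ v *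
          ratioCauchyTransform R (fun w => β w * ((w - 1) / w)⁻¹) v) +
        tasepIntegral p 1 r L k τ * residueIntegral 1 R (fun w => β w * ((w - 1) / w)⁻¹) := by
  have hreg := isRegularCircle_inner hp0 hp1 hr0 hr1
  have hβu : ContinuousOn (fun w => β w * ((w - 1) / w)⁻¹) (sphere 1 R) :=
    hβ.mul ((continuousOn_ratio_sphere hR1).inv₀ fun _ => ratio_ne_zero_of_mem_sphere hR1)
  have hsplit : EqOn
      (fun v => tasepIntegrand p L k τ v * ratioCauchyTransform R β v)
      (fun v => tasepIntegrand p L (k + 1) τ v *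
          ratioCauchyTransform R (fun w => β w * ((w - 1) / w)⁻¹) v +
        tasepIntegrand p L k τ v * residueIntegral 1 R (fun w => β w * ((w - 1) / w)⁻¹))
      (sphere 1 r) := fun v hv => by
    simp only [ratioCauchyTransform_eq_add hr1 hR1 hβ hv, tasepIntegrand,
      zpow_add_one₀ (hreg.isRegularPoint v hv).ratio_ne_zero]
    ring
  rw [residueIntegral_congr hr0.le hsplit, residueIntegral_add hr0.le, residueIntegral_mul_const,
    tasepIntegral]
  · exact (hreg.continuousOn L _ τ).mul fun v hv =>
      (differentiableAt_ratioCauchyTransform hR1 hβu (sphere_subset_ball hr1 hv)).continuousAt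
        |>.continuousWithinAt
  · exact (hreg.continuousOn L _ τ).mul continuousOn_const

/-- Extracting the pole of order `K` of the `v`-integrand at `v = 1` one factor at a time: what is
left after `K` steps is holomorphic inside the inner circle. -/
lemma residueIntegral_tasepIntegrand_mul_ratioCauchyTransform (hp0 : 0 < p) (hp1 : p < 1)
    (hr0 : 0 < r) (hr1 : r < 1) (hR1 : 1 < R) (L τ : ℤ) (K : ℕ) {β : ℂ → ℂ}
    (hβ : ContinuousOn β (sphere 1 R)) :
    residueIntegral 1 r (fun v => tasepIntegrand p L (-K) τ v * ratioCauchyTransform R β v) =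
      ∑ j ∈ range K, tasepIntegral p 1 r L (j - K) τ *
        residueIntegral 1 R (fun w => β w * ((w - 1) / w) ^ (-(j : ℤ) - 1)) := by
  induction K generalizing β with
  | zero =>
    rw [range_zero, sum_empty]
    exact residueIntegral_eq_zero_of_differentiableAt hr0.le fun v hv =>
      (differentiableAt_tasepIntegrand_of_mem_closedBall hp0 hp1 hr0 hr1 (by simp) L τ hv).mul
        (differentiableAt_ratioCauchyTransform hR1 hβ (closedBall_subset_ball hr1 hv))
  | succ K ih =>
    have hβu : ContinuousOn (fun w => β w * ((w - 1) / w)⁻¹) (sphere 1 R) :=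
      hβ.mul ((continuousOn_ratio_sphere hR1).inv₀ fun _ => ratio_ne_zero_of_mem_sphere hR1)
    rw [residueIntegral_tasepIntegrand_mul_ratioCauchyTransform_eq_add hp0 hp1 hr0 hr1 hR1 L _ τ hβ,
      show -((K + 1 : ℕ) : ℤ) + 1 = -K by push_cast; ring, ih hβu, sum_range_succ']
    congr 1
    · refine sum_congr rfl fun j _ => congrArg₂ (· * ·) (congrArg (tasepIntegral p 1 r L · τ) ?_)
        (residueIntegral_congr (by linarith) fun w hw => ?_)
      · push_cast
        ring
      · simp only [mul_assoc, ← zpow_neg_one, ← zpow_add₀ (ratio_ne_zero_of_mem_sphere hR1 hw)]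
        congr 2
        push_cast
        ring
    · simp

lemma residueIntegral_tasepIntegrand_mul_ratioCauchyTransform_tasepIntegrand (hp0 : 0 < p)
    (hp1 : p < 1) (hr0 : 0 < r) (hr1 : r < 1) (hR1 : 1 < R) (hR : R < 1 / (1 - p))
    (L τ : ℤ) (K : ℕ) (L' k' τ' : ℤ) :
    residueIntegral 1 r (fun v => tasepIntegrand p L (-K) τ v *
        ratioCauchyTransform R (tasepIntegrand p L' k' τ') v) =
      ∑ j ∈ range K,
        tasepIntegral p 1 r L (j - K) τ * tasepIntegral p 1 R L' (k' - j - 1) τ' := by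
  have hreg := isRegularCircle_outer hp1 hR1 hR
  rw [residueIntegral_tasepIntegrand_mul_ratioCauchyTransform hp0 hp1 hr0 hr1 hR1 L τ K
    (hreg.continuousOn L' k' τ')]
  refine sum_congr rfl fun j _ => congrArg _ (residueIntegral_congr hreg.radius_nonneg ?_)
  intro w hw
  simp only [tasepIntegrand, show k' - (j : ℤ) - 1 = k' + (-(j : ℤ) - 1) by ring,
    zpow_add₀ (hreg.isRegularPoint w hw).ratio_ne_zero k']
  ring

end TasepCauchyTransform

section KernelParts

/-- The functions `φ_k(τ)` dual to the family `tasepIntegral p 1 R L l τ`, indexed by `l`. -/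
def dualFunction (p r : ℝ) (L k τ : ℤ) : ℂ := p * tasepIntegral p 1 r (-L) (-k - 1) (-τ - 1)

/-- The transition function between levels at distance `d`. -/
def levelTransition (p R : ℝ) (d s t : ℤ) : ℂ := p * tasepIntegral p 1 R 0 (-d) (s - t - 1)

variable {p r R : ℝ}

lemma dualFunction_succ_sub (hp0 : 0 < p) (hp1 : p < 1) (hr0 : 0 < r) (hr1 : r < 1) (L k τ : ℤ) :
    dualFunction p r L k (τ + 1) - dualFunction p r L k τ =
      p * dualFunction p r L (k - 1) (τ + 1) := by
  have h := (isRegularCircle_inner hp0 hp1 hr0 hr1).tasepIntegral_sub_succ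
    (-L) (-k - 1) (-(τ + 1) - 1)
  rw [show -(τ + 1) - 1 + 1 = -τ - 1 by ring] at h
  rw [dualFunction, dualFunction, dualFunction, ← mul_sub, h,
    show -(k - 1) - 1 = -k - 1 + 1 by ring]

lemma dualFunction_of_neg (hp0 : 0 < p) (hp1 : p < 1) (hr0 : 0 < r) (hr1 : r < 1)
    {k : ℤ} (hk : k < 0) (L τ : ℤ) : dualFunction p r L k τ = 0 := by
  rw [dualFunction, tasepIntegral_inner_eq_zero hp0 hp1 hr0 hr1 (by lia), mul_zero]

lemma dualFunction_zero (hp0 : 0 < p) (hp1 : p < 1) (hr0 : 0 < r) (hr1 : r < 1)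
    (L τ : ℤ) : dualFunction p r L 0 τ = p := by
  rw [dualFunction, show -(0 : ℤ) - 1 = -1 by norm_num,
    tasepIntegral_inner_neg_one hp0 hp1 hr0 hr1, mul_one]

lemma levelTransition_succ_sub (hp1 : p < 1) (hR1 : 1 < R) (hR : R < 1 / (1 - p)) (d s t : ℤ) :
    levelTransition p R d s (t + 1) - levelTransition p R d s t =
      p * levelTransition p R (d - 1) s (t + 1) := by
  have h := (isRegularCircle_outer hp1 hR1 hR).tasepIntegral_sub_succ 0 (-d) (s - (t + 1) - 1)
  rw [show s - (t + 1) - 1 + 1 = s - t - 1 by ring] at h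
  rw [levelTransition, levelTransition, levelTransition, ← mul_sub, h,
    show -(d - 1) = -d + 1 by ring]

lemma levelTransition_zero_self (hp0 : 0 < p) (hp1 : p < 1) (hR1 : 1 < R) (hR : R < 1 / (1 - p))
    (s : ℤ) : levelTransition p R 0 s s = 1 := by
  rw [levelTransition, neg_zero, sub_self, zero_sub,
    tasepIntegral_outer_eq_origin hp0 hp1 hR1 hR _ le_rfl,
    mul_tasepIntegral_origin_zero_zero_neg_one hp0 hp1]

lemma levelTransition_zero_of_ne (hp0 : 0 < p) (hp1 : p < 1) (hR1 : 1 < R)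
    (hR : R < 1 / (1 - p)) {s t : ℤ} (h : s ≠ t) : levelTransition p R 0 s t = 0 := by
  rw [levelTransition, neg_zero, (isRegularCircle_outer hp1 hR1 hR).tasepIntegral_zero_zero
    (mod_cast hp0.ne') (by lia), mul_zero]

lemma levelTransition_self_sub_one (hp1 : p < 1) (hR1 : 1 < R) (hR : R < 1 / (1 - p)) (d s : ℤ) :
    levelTransition p R d s (s - 1) = 0 := by
  rw [levelTransition, show s - (s - 1) - 1 = 0 by ring]
  obtain rfl | hd := eq_or_ne d 1
  · rw [tasepIntegral_outer_zero_neg_one_zero hp1 hR1 hR, mul_zero]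
  · rw [(isRegularCircle_outer hp1 hR1 hR).tasepIntegral_zero_of_ne (by lia), mul_zero]

lemma levelTransition_of_lt (hp0 : 0 < p) (hp1 : p < 1) (hR1 : 1 < R) (hR : R < 1 / (1 - p))
    (d : ℕ) {s t : ℤ} (h : t < s) : levelTransition p R d s t = 0 := by
  obtain ⟨e, rfl⟩ : ∃ e : ℕ, t = s - 1 - e := ⟨(s - 1 - t).toNat, by lia⟩
  clear h
  induction d generalizing e with
  | zero => exact levelTransition_zero_of_ne hp0 hp1 hR1 hR (by lia)
  | succ d ihd =>
    induction e with
    | zero =>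
      rw [Nat.cast_zero, sub_zero]
      exact levelTransition_self_sub_one hp1 hR1 hR _ s
    | succ e ihe =>
      have hstep := levelTransition_succ_sub hp1 hR1 hR (d + 1 : ℕ) s (s - 1 - (e + 1 : ℕ))
      rw [show s - 1 - ((e + 1 : ℕ) : ℤ) + 1 = s - 1 - e by push_cast; ring, ihe,
        show ((d + 1 : ℕ) : ℤ) - 1 = d by push_cast; ring, ihd, mul_zero, zero_sub,
        neg_eq_zero] at hstep
      exact hstep

lemma corrKernel_integrand_eq {v w : ℂ} (hv : IsRegularPoint p v) (hw : IsRegularPoint p w)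
    (L : ℤ) (n₁ n₂ : ℕ) (τ₁ τ₂ : ℤ) :
    v⁻¹ * (w⁻¹ * (((1 - p * ((w - 1) / w)) ^ τ₁ * ((w - 1) / w) ^ n₁ * (w / v) ^ L) /
        ((1 - p * ((v - 1) / v)) ^ (τ₂ + 1) * ((v - 1) / v) ^ n₂ * (w - v)))) =
      tasepIntegrand p (-L) (-n₂) (-τ₂ - 1) v *
        (tasepIntegrand p L n₁ τ₁ w * ((w - 1) / w - (v - 1) / v)⁻¹) := by
  have hv0 := hv.ne_zero
  have hw0 := hw.ne_zero
  rw [inv_ratio_sub_ratio hw0 hv0, tasepIntegrand, tasepIntegrand,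
    show -τ₂ - 1 = -(τ₂ + 1) by ring, zpow_neg, zpow_neg, zpow_sub₀ hv0, zpow_sub₀ hw0, zpow_neg,
    div_zpow, zpow_natCast, zpow_natCast]
  simp only [div_eq_mul_inv, mul_inv]
  field_simp

lemma corrKernel_succ_succ (hp0 : 0 < p) (hp1 : p < 1) (hr0 : 0 < r) (hr1 : r < 1)
    (hR1 : 1 < R) (hR : R < 1 / (1 - p)) (N : ℕ) (x : ℤ) (n₁ n₂ : ℕ) (τ₁ τ₂ : ℤ) :
    corrKernel p N x r R (n₁ + 1) τ₁ (n₂ + 1) τ₂ =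
      (∑ j ∈ range (n₂ + 1), tasepIntegral p 1 R (x + N) (n₁ - j) τ₁ *
        dualFunction p r (x + N) (n₂ - j) τ₂) -
      if n₁ < n₂ then levelTransition p R (n₂ - n₁) τ₁ τ₂ else 0 := by
  have hreg := isRegularCircle_outer hp1 hR1 hR
  unfold corrKernel
  congr 1
  · have hdouble := residueIntegral_tasepIntegrand_mul_ratioCauchyTransform_tasepIntegrand hp0 hp1
      hr0 hr1 hR1 hR (-(x + N)) (-τ₂ - 1) (n₂ + 1) (x + N) (n₁ + 1 : ℕ) τ₁
    trans (p : ℂ) * residueIntegral 1 r fun v =>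
      tasepIntegrand p (-(x + N)) (-(n₂ + 1 : ℕ)) (-τ₂ - 1) v *
        ratioCauchyTransform R (tasepIntegrand p (x + N) (n₁ + 1 : ℕ) τ₁) v
    · refine congrArg _ (residueIntegral_congr hr0.le fun v hv => ?_)
      have hv := (isRegularCircle_inner hp0 hp1 hr0 hr1).isRegularPoint v hv
      simp only [ratioCauchyTransform, ← residueIntegral_const_mul]
      exact (residueIntegral_const_mul _ _ _ _).symm.trans (residueIntegral_congr
        hreg.radius_nonneg fun w hw =>
          corrKernel_integrand_eq hv (hreg.isRegularPoint w hw) _ _ _ _ _)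
    · rw [hdouble, mul_sum]
      refine sum_congr rfl fun j _ => ?_
      rw [dualFunction, show -((n₂ : ℤ) - j) - 1 = j - (n₂ + 1 : ℕ) by push_cast; ring,
        show (n₁ : ℤ) - j = (n₁ + 1 : ℕ) - j - 1 by push_cast; ring]
      ring
  · refine if_congr (by simp) ?_ rfl
    rw [levelTransition, tasepIntegral, ← residueIntegral_const_mul]
    refine residueIntegral_congr hreg.radius_nonneg fun z _ => ?_
    simp only [tasepIntegrand]
    rw [show (0 : ℤ) - 2 = -((2 : ℕ) : ℤ) by norm_num, zpow_neg z, zpow_natCast,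
      show ((n₁ + 1 : ℕ) : ℤ) - ((n₂ + 1 : ℕ) : ℤ) = -(n₂ - n₁) by push_cast; ring, div_eq_mul_inv]
    ring

/-- The boundary term in the summation by parts of `∑ τ, φ_k(τ) * tasepIntegral p 1 R L l τ`. -/
def pairingBoundary (p r R : ℝ) (L : ℤ) (k : ℕ) (l τ : ℤ) : ℂ :=
  ∑ j ∈ range (k + 1),
    tasepIntegral p 1 r (-L) (j - k - 1) (-τ) * tasepIntegral p 1 R L (l - j - 1) τ

/-- The difference telescopes in `j`, because a unit step in time is a unit step in the level. -/
lemma pairingBoundary_sub_succ (hp0 : 0 < p) (hp1 : p < 1) (hr0 : 0 < r) (hr1 : r < 1)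
    (hR1 : 1 < R) (hR : R < 1 / (1 - p)) (L : ℤ) (k : ℕ) (l τ : ℤ) :
    pairingBoundary p r R L k l τ - pairingBoundary p r R L k l (τ + 1) =
      dualFunction p r L k τ * tasepIntegral p 1 R L l τ := by
  set T : ℕ → ℂ := fun j =>
    p * tasepIntegral p 1 r (-L) (j - k - 1) (-τ - 1) * tasepIntegral p 1 R L (l - j) τ with hT
  have hterm : ∀ j : ℕ,
      tasepIntegral p 1 r (-L) (j - k - 1) (-τ) * tasepIntegral p 1 R L (l - j - 1) τ -
      tasepIntegral p 1 r (-L) (j - k - 1) (-(τ + 1)) * tasepIntegral p 1 R L (l - j - 1) (τ + 1) =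
      T j - T (j + 1) := fun j => by
    have h1 := (isRegularCircle_inner hp0 hp1 hr0 hr1).tasepIntegral_sub_succ
      (-L) (j - k - 1) (-τ - 1)
    have h2 := (isRegularCircle_outer hp1 hR1 hR).tasepIntegral_sub_succ L (l - j - 1) τ
    rw [sub_add_cancel] at h1 h2
    simp only [hT]
    rw [show -(τ + 1) = -τ - 1 by ring,
      show ((j + 1 : ℕ) : ℤ) - k - 1 = j - k - 1 + 1 by push_cast; ring,
      show l - ((j + 1 : ℕ) : ℤ) = l - j - 1 by push_cast; ring]
    linear_combination -(tasepIntegral p 1 R L (l - j - 1) τ) * h1 +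
      tasepIntegral p 1 r (-L) (j - k - 1) (-τ - 1) * h2
  have hlast : T (k + 1) = 0 := by
    simp only [hT]
    rw [tasepIntegral_inner_eq_zero hp0 hp1 hr0 hr1 (by push_cast; lia), mul_zero, zero_mul]
  rw [pairingBoundary, pairingBoundary, ← sum_sub_distrib, sum_congr rfl fun j _ => hterm j,
    sum_range_sub', hlast, sub_zero, hT, dualFunction]
  simp

lemma ratioCauchyTransform_tasepIntegrand (hp0 : 0 < p) (hp1 : p < 1) (hr0 : 0 < r) (hr1 : r < 1)
    (hR1 : 1 < R) (hR : R < 1 / (1 - p)) {L x : ℤ} {l : ℕ} (hl : x + l + 1 ≤ L) {v : ℂ}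
    (hv : v ∈ sphere (1 : ℂ) r) :
    ratioCauchyTransform R (tasepIntegrand p L l x) v = tasepIntegrand p L l x v * v ^ 2 := by
  have hreg := isRegularCircle_outer hp1 hR1 hR
  have hvR : v ∈ ball (1 : ℂ) R := by
    rw [mem_ball, mem_sphere.1 hv]
    linarith
  have hv := (isRegularCircle_inner hp0 hp1 hr0 hr1).isRegularPoint v hv
  have hpow : ∀ w : ℂ, w ≠ 0 → w ^ (L - 1 - l - x) = w ^ (L - 2 - l - x) * w := fun w hw => by
    rw [← zpow_add_one₀ hw]
    congr 1
    ring
  set f : ℂ → ℂ := fun w => w ^ (L - 1 - l - x) * (((1 - p) * w + p) ^ x * (w - 1) ^ (l : ℤ))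
  have hf : ∀ w, IsRegularPoint p w → tasepIntegrand p L l x w * w = f w := fun w hw => by
    simp only [f, hw.tasepIntegrand_eq, hpow w hw.ne_zero]
    ring
  have hcauchy : residueIntegral 1 R (fun w => f w / (w - v)) = f v :=
    residueIntegral_div_sub hvR fun w hw =>
      .mul (.zpow (by fun_prop) (Or.inr (by lia)))
        (.mul (.zpow (by fun_prop) (Or.inl (linear_ne_zero_of_mem_closedBall_one hp1 hR hw)))
          (.zpow (by fun_prop) (Or.inr (by positivity))))
  rw [ratioCauchyTransform_eq hR1 _ hv.ne_zero, pow_two, ← mul_assoc, hf v hv, ← hcauchy, mul_comm]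
  congr 1
  refine residueIntegral_congr hreg.radius_nonneg fun w hw => ?_
  simp only [hf w (hreg.isRegularPoint w hw), div_eq_inv_mul]

lemma pairingBoundary_start (hp0 : 0 < p) (hp1 : p < 1) (hr0 : 0 < r) (hr1 : r < 1)
    (hR1 : 1 < R) (hR : R < 1 / (1 - p)) {L x : ℤ} (k l : ℕ) (hl : x + l + 1 ≤ L) :
    pairingBoundary p r R L k l x = if k = l then 1 else 0 := by
  have hreg := isRegularCircle_inner hp0 hp1 hr0 hr1
  have hpairing : pairingBoundary p r R L k l x = tasepIntegral p 1 r 0 (l - k - 1) 0 := by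
    have hdouble := residueIntegral_tasepIntegrand_mul_ratioCauchyTransform_tasepIntegrand hp0 hp1
      hr0 hr1 hR1 hR (-L) (-x) (k + 1) L l x
    push_cast [← sub_sub] at hdouble
    rw [pairingBoundary, ← hdouble]
    refine residueIntegral_congr hr0.le fun v hv => ?_
    have hmul := (hreg.isRegularPoint v hv).tasepIntegrand_mul (-L) (-(k + 1)) (-x) L l x
    rw [mul_assoc] at hmul
    simp only [ratioCauchyTransform_tasepIntegrand hp0 hp1 hr0 hr1 hR1 hR hl hv, hmul]
    congr 1 <;> ring
  rw [hpairing]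
  split_ifs with hkl
  · rw [hkl, sub_self, zero_sub, tasepIntegral_inner_neg_one hp0 hp1 hr0 hr1]
  · exact hreg.tasepIntegral_zero_of_ne (by lia)

end KernelParts

end KernelDecomposition

section Fredholm

open Finset Filter Topology

section Minors

variable {n : Type*} [Fintype n] [DecidableEq n]

lemma norm_det_le_prod_sum (B : Matrix n n ℂ) : ‖B.det‖ ≤ ∏ i, ∑ j, ‖B i j‖ := by
  rw [← Matrix.det_transpose, Matrix.det_apply]
  calc ‖∑ σ : Equiv.Perm n, Equiv.Perm.sign σ • ∏ i, B.transpose (σ i) i‖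
      ≤ ∑ σ : Equiv.Perm n, ‖Equiv.Perm.sign σ • ∏ i, B.transpose (σ i) i‖ := norm_sum_le _ _
    _ = ∑ σ : Equiv.Perm n, ∏ i, ‖B i (σ i)‖ := by
        refine sum_congr rfl fun σ _ => ?_
        rcases Int.units_eq_one_or (Equiv.Perm.sign σ) with h | h <;>
          simp [h, Matrix.transpose_apply, Units.neg_smul, norm_prod]
    _ = ∑ f ∈ univ.image fun σ : Equiv.Perm n => (σ : n → n), ∏ i, ‖B i (f i)‖ :=
        (sum_image (f := fun f : n → n => ∏ i, ‖B i (f i)‖)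
          (DFunLike.coe_injective (F := Equiv.Perm n)).injOn).symm
    _ ≤ ∑ f : n → n, ∏ i, ‖B i (f i)‖ :=
        sum_le_sum_of_subset_of_nonneg (subset_univ _)
          fun f _ _ => prod_nonneg fun i _ => norm_nonneg _
    _ = ∏ i, ∑ j, ‖B i j‖ := by rw [prod_univ_sum, Fintype.piFinset_univ]

lemma det_submatrix_eq_zero_of_not_injective {S : Type*} (M : Matrix S S ℂ) {s : n → S}
    (hs : ¬ Function.Injective s) : (M.submatrix s s).det = 0 := by
  obtain ⟨i, j, hij, hne⟩ := Function.not_injective_iff.1 hs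
  exact Matrix.det_zero_of_row_eq hne (by ext l; simp only [Matrix.submatrix_apply, hij])

lemma sum_det_submatrix_of_image_eq (M : Matrix n n ℂ) (T : Finset n) :
    ∑ s : Fin #T → n with univ.image s = T, (M.submatrix s s).det =
      (#T).factorial * (M.submatrix ((↑) : T → n) ((↑) : T → n)).det := by
  have hcard : Fintype.card (Fin #T ≃ T) = (#T).factorial := by
    rw [Fintype.card_equiv T.equivFin.symm, Fintype.card_fin]
  rw [← nsmul_eq_mul, ← hcard, ← card_univ, ← sum_const]
  refine (sum_bij (fun e _ i => (e i : n)) (fun e _ => ?_) (fun e _ e' _ h => ?_)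
    (fun s hs => ?_) fun e _ => ?_).symm
  · rw [mem_filter_univ]
    ext a
    simp only [mem_image, mem_univ, true_and]
    exact ⟨fun ⟨i, hi⟩ => hi ▸ (e i).2, fun ha => ⟨e.symm ⟨a, ha⟩, by simp⟩⟩
  · ext i
    exact congrFun h i
  · have himage : univ.image s = T := (mem_filter_univ s).1 hs
    have hinj : Function.Injective s := fun i j hij =>
      card_image_iff.1 (by rw [himage, card_univ, Fintype.card_fin]) (mem_univ i) (mem_univ j) hij
    have hmem : ∀ i, s i ∈ T := fun i => himage ▸ mem_image_of_mem s (mem_univ i)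
    refine ⟨Equiv.ofBijective (fun i => ⟨s i, hmem i⟩)
      ⟨fun i j h => hinj (congrArg Subtype.val h), fun ⟨a, ha⟩ => ?_⟩, mem_univ _, rfl⟩
    obtain ⟨i, _, rfl⟩ := mem_image.1 (himage ▸ ha)
    exact ⟨i, rfl⟩
  · rw [← Matrix.det_submatrix_equiv_self e, Matrix.submatrix_submatrix]
    rfl

lemma sum_det_submatrix_eq_factorial_mul (M : Matrix n n ℂ) (k : ℕ) :
    ∑ s : Fin k → n, (M.submatrix s s).det =
      k.factorial * ∑ T ∈ powersetCard k (univ : Finset n),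
        (M.submatrix ((↑) : T → n) ((↑) : T → n)).det := by
  have hmaps : ∀ s ∈ univ.filter fun s : Fin k → n => Function.Injective s,
      univ.image s ∈ powersetCard k (univ : Finset n) := fun s hs =>
    mem_powersetCard.2 ⟨subset_univ _, by
      rw [card_image_of_injective _ ((mem_filter_univ s).1 hs), card_univ, Fintype.card_fin]⟩
  rw [← sum_subset (filter_subset Function.Injective univ) fun s _ hs =>
      det_submatrix_eq_zero_of_not_injective M fun h => hs ((mem_filter_univ s).2 h),
    ← sum_fiberwise_of_maps_to hmaps, mul_sum]
  refine sum_congr rfl fun T hT => ?_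
  obtain rfl := (mem_powersetCard.1 hT).2
  rw [← sum_det_submatrix_of_image_eq]
  refine sum_congr (filter_filter .. |>.trans (filter_congr fun s _ => and_iff_right_of_imp ?_))
    fun _ _ => rfl
  exact fun himage i j hij =>
    card_image_iff.1 (by rw [himage, card_univ, Fintype.card_fin]) (mem_univ i) (mem_univ j) hij

lemma det_one_sub_eq_sum (M : Matrix n n ℂ) :
    (1 - M).det = ∑ k ∈ range (Fintype.card n + 1), ((-1 : ℂ) ^ k / k.factorial) *
      ∑ s : Fin k → n, (M.submatrix s s).det := by
  have hminors : (1 - M).det =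
      ∑ T : Finset n, ((-M).submatrix ((↑) : T → n) ((↑) : T → n)).det := by
    rw [sub_eq_neg_add]
    exact ((Matrix.detRowAlternating (n := n) (R := ℂ)).map_add_univ (-M).row
      (1 : Matrix n n ℂ).row).trans
      (sum_congr rfl fun (T : Finset n) _ => Matrix.det_piecewise_one_eq_submatrix_det (-M) T)
  rw [hminors, ← powerset_univ, sum_powerset, card_univ]
  refine sum_congr rfl fun k _ => ?_
  rw [sum_det_submatrix_eq_factorial_mul, ← mul_assoc,
    div_mul_cancel₀ _ (Nat.cast_ne_zero.2 k.factorial_ne_zero), mul_sum]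
  refine sum_congr rfl fun T hT => ?_
  rw [Matrix.submatrix_neg, Pi.neg_apply, Pi.neg_apply, Matrix.det_neg, Fintype.card_coe,
    (mem_powersetCard.1 hT).2]

end Minors

section Expansion

variable {S : Type*} {A : S → S → ℂ} {b : S → ℝ}

/-- The term of the Fredholm expansion of `det(1 - A)` at a tuple of points of `S`. -/
def fredholmTerm (A : S → S → ℂ) (q : Σ k : ℕ, (Fin k → S)) : ℂ :=
  ((-1 : ℂ) ^ q.1 / (q.1.factorial : ℂ)) * (Matrix.of fun i j : Fin q.1 => A (q.2 i) (q.2 j)).det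

lemma sum_prod_le_tsum_pow (hb0 : ∀ s, 0 ≤ b s) (hb : Summable b) {k : ℕ}
    (u : Finset (Fin k → S)) : ∑ s ∈ u, ∏ i, b (s i) ≤ (∑' s, b s) ^ k := by
  classical
  calc ∑ s ∈ u, ∏ i, b (s i)
      ≤ ∑ s ∈ Fintype.piFinset fun i => u.image fun s => s i, ∏ i, b (s i) :=
        sum_le_sum_of_subset_of_nonneg
          (fun s hs => Fintype.mem_piFinset.2 fun i => mem_image_of_mem _ hs)
          fun s _ _ => prod_nonneg fun i _ => hb0 _
    _ = ∏ i : Fin k, ∑ s ∈ u.image fun s => s i, b s := by rw [prod_univ_sum]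
    _ ≤ ∏ _i : Fin k, ∑' s, b s :=
        prod_le_prod (fun i _ => sum_nonneg fun s _ => hb0 s)
          fun i _ => hb.sum_le_tsum _ fun s _ => hb0 s
    _ = (∑' s, b s) ^ k := by rw [prod_const, card_univ, Fintype.card_fin]

lemma summable_inv_factorial_mul_prod (hb0 : ∀ s, 0 ≤ b s) (hb : Summable b) :
    Summable fun q : Σ k : ℕ, (Fin k → S) => (q.1.factorial : ℝ)⁻¹ * ∏ i, b (q.2 i) := by
  have hsummable (k : ℕ) : Summable fun s : Fin k → S => ∏ i, b (s i) :=
    summable_of_sum_le (fun s => prod_nonneg fun i _ => hb0 _) (sum_prod_le_tsum_pow hb0 hb)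
  have hnonneg (q : Σ k : ℕ, (Fin k → S)) : 0 ≤ (q.1.factorial : ℝ)⁻¹ * ∏ i, b (q.2 i) :=
    mul_nonneg (by positivity) (prod_nonneg fun i _ => hb0 _)
  have hle (k : ℕ) : ∑' s : Fin k → S, (k.factorial : ℝ)⁻¹ * ∏ i, b (s i) ≤
      (∑' s, b s) ^ k / (k.factorial : ℝ) := by
    rw [tsum_mul_left, div_eq_inv_mul]
    exact mul_le_mul_of_nonneg_left
      ((hsummable k).tsum_le_of_sum_le (sum_prod_le_tsum_pow hb0 hb)) (by positivity)
  refine (summable_sigma_of_nonneg hnonneg).2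
    ⟨fun k => (hsummable k).mul_left (k.factorial : ℝ)⁻¹, ?_⟩
  exact (Real.summable_pow_div_factorial (∑' s, b s)).of_nonneg_of_le
    (fun k => tsum_nonneg fun s => hnonneg ⟨k, s⟩) hle

lemma norm_fredholmTerm_le (hA : Summable fun q : S × S => ‖A q.1 q.2‖)
    (q : Σ k : ℕ, (Fin k → S)) :
    ‖fredholmTerm A q‖ ≤ (q.1.factorial : ℝ)⁻¹ * ∏ i, ∑' s', ‖A (q.2 i) s'‖ := by
  obtain ⟨k, s⟩ := q
  rw [fredholmTerm, norm_mul, norm_div, norm_pow, norm_neg, norm_one, one_pow, one_div,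
    Complex.norm_natCast]
  refine mul_le_mul_of_nonneg_left ?_ (by positivity)
  by_cases hs : Function.Injective s
  · refine (norm_det_le_prod_sum _).trans (prod_le_prod
      (fun i _ => sum_nonneg fun j _ => norm_nonneg _) fun i _ => ?_)
    calc ∑ j, ‖A (s i) (s j)‖ = ∑ s' ∈ univ.map ⟨s, hs⟩, ‖A (s i) s'‖ := by
          rw [sum_map, Function.Embedding.coeFn_mk]
      _ ≤ ∑' s', ‖A (s i) s'‖ := (hA.prod_factor (s i)).sum_le_tsum _ fun _ _ => norm_nonneg _
  · have hdet : (Matrix.of fun i j : Fin k => A (s i) (s j)).det = 0 :=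
      det_submatrix_eq_zero_of_not_injective (Matrix.of A) hs
    rw [hdet, norm_zero]
    exact prod_nonneg fun _ _ => tsum_nonneg fun _ => norm_nonneg _

lemma fredholmSummable_of_summable (hA : Summable fun q : S × S => ‖A q.1 q.2‖) :
    FredholmSummable A :=
  (summable_inv_factorial_mul_prod (fun _ => tsum_nonneg fun _ => norm_nonneg _)
    hA.prod).of_nonneg_of_le (fun _ => norm_nonneg _) (norm_fredholmTerm_le hA)

lemma fredholmTerm_conj (A : S → S → ℂ) {ρ : S → ℂ} (hρ : ∀ s, ρ s ≠ 0) :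
    fredholmTerm (fun s s' => ρ s * A s s' * (ρ s')⁻¹) = fredholmTerm A := by
  ext ⟨k, s⟩
  have hrow := Matrix.det_mul_row (fun j => (ρ (s j))⁻¹)
    (Matrix.of fun i j : Fin k => ρ (s i) * A (s i) (s j))
  have hcolumn := Matrix.det_mul_column (fun i => ρ (s i))
    (Matrix.of fun i j : Fin k => A (s i) (s j))
  simp only [Matrix.of_apply] at hrow hcolumn
  simp only [fredholmTerm, mul_comm _ (ρ _)⁻¹]
  rw [hrow, hcolumn, ← mul_assoc (∏ i, (ρ (s i))⁻¹), ← prod_mul_distrib]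
  simp [hρ]

lemma fredholmSummable_of_conj {ρ : S → ℂ} (hρ : ∀ s, ρ s ≠ 0)
    (h : FredholmSummable fun s s' => ρ s * A s s' * (ρ s')⁻¹) : FredholmSummable A := by
  have hconj : Summable fun q => ‖fredholmTerm (fun s s' => ρ s * A s s' * (ρ s')⁻¹) q‖ := h
  rw [fredholmTerm_conj A hρ] at hconj
  exact hconj

lemma fredholmDet_eq_tsum (h : FredholmSummable A) : fredholmDet A = ∑' q, fredholmTerm A q := by
  have hsummable : Summable (fredholmTerm A) := Summable.of_norm h
  rw [hsummable.tsum_sigma]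
  simp only [fredholmDet, fredholmTerm, tsum_mul_left]

variable [DecidableEq S]

lemma tsum_fredholmTerm_of_forall_mem (A : S → S → ℂ) (F : Finset S) (k : ℕ) :
    (∑' s : Fin k → S, if ∀ i, s i ∈ F then fredholmTerm A ⟨k, s⟩ else 0) =
      ((-1 : ℂ) ^ k / k.factorial) * ∑ s : Fin k → F,
        ((Matrix.of fun s s' : F => A s s').submatrix s s).det := by
  rw [tsum_eq_sum (s := Fintype.piFinset fun _ => F) fun s hs =>
    if_neg fun h => hs (Fintype.mem_piFinset.2 h), mul_sum]
  refine (sum_bij (fun s _ i => (s i : S)) (fun s _ => Fintype.mem_piFinset.2 fun i => (s i).2)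
    (fun s _ s' _ h => ?_) (fun s hs => ?_) fun s _ => ?_).symm
  · ext i
    exact congrFun h i
  · exact ⟨fun i => ⟨s i, Fintype.mem_piFinset.1 hs i⟩, mem_univ _, rfl⟩
  · rw [if_pos fun i => (s i).2]
    rfl

lemma tsum_fredholmTerm_restrict (h : FredholmSummable A) (F : Finset S) :
    ∑' q, (if ∀ i, q.2 i ∈ F then fredholmTerm A q else 0) =
      (1 - Matrix.of fun s s' : F => A s s').det := by
  have hsummable : Summable fun q : Σ k : ℕ, (Fin k → S) =>
      if ∀ i, q.2 i ∈ F then fredholmTerm A q else 0 :=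
    .of_norm_bounded (g := fun q => ‖fredholmTerm A q‖) h fun q => by
      split_ifs
      · exact le_rfl
      · rw [norm_zero]
        exact norm_nonneg _
  rw [hsummable.tsum_sigma, det_one_sub_eq_sum]
  simp only [tsum_fredholmTerm_of_forall_mem]
  refine tsum_eq_sum fun k hk => ?_
  rw [sum_eq_zero, mul_zero]
  refine fun s _ => det_submatrix_eq_zero_of_not_injective _ fun hs => hk ?_
  simpa [Nat.lt_succ_iff] using Fintype.card_le_of_injective s hs

lemma tendsto_det_one_sub (h : FredholmSummable A) {F : ℕ → Finset S}
    (hmono : Monotone F) (hcover : ∀ s, ∃ M, s ∈ F M) :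
    Tendsto (fun M => (1 - Matrix.of fun s s' : F M => A s s').det) atTop
      (𝓝 (fredholmDet A)) := by
  rw [fredholmDet_eq_tsum h]
  simp_rw [← tsum_fredholmTerm_restrict h]
  refine tendsto_tsum_of_dominated_convergence (bound := fun q => ‖fredholmTerm A q‖) h
    (fun q => ?_) (Eventually.of_forall fun M q => ?_)
  · have hmem : ∀ᶠ M in atTop, ∀ i, q.2 i ∈ F M := by
      refine eventually_all.2 fun i => ?_
      obtain ⟨M, hM⟩ := hcover (q.2 i)
      filter_upwards [eventually_ge_atTop M] with M' hM'
      exact hmono hM' hM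
    exact tendsto_const_nhds.congr' (hmem.mono fun M hM => (if_pos hM).symm)
  · split_ifs
    · exact le_rfl
    · rw [norm_zero]
      exact norm_nonneg _

end Expansion

section TraceClass

open scoped Classical in
lemma lp_inner_single_single {S : Type*} (s s' : S) :
    inner ℂ (lp.single 2 s 1 : lp (fun _ : S => ℂ) 2) (lp.single 2 s' 1) =
      if s = s' then 1 else 0 := by
  rw [lp.inner_single_left]
  simp [lp.single_apply, Pi.single_apply]

open scoped Classical in
lemma exists_isTraceClass_of_summable {S : Type} {A : S → S → ℂ}
    (hA : Summable fun q : S × S => ‖A q.1 q.2‖) :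
    ∃ T : lp (fun _ : S => ℂ) 2 →L[ℂ] lp (fun _ : S => ℂ) 2, IsTraceClass T ∧
      ∀ s s', T (lp.single 2 s' (1 : ℂ)) s = A s s' := by
  let e (s : S) : lp (fun _ : S => ℂ) 2 := lp.single 2 s 1
  have norm_e (s : S) : ‖e s‖ = 1 := by
    rw [lp.norm_single (by norm_num), norm_one]
  let rankOne (q : S × S) : lp (fun _ : S => ℂ) 2 →L[ℂ] lp (fun _ : S => ℂ) 2 :=
    (innerSL ℂ (e q.2)).smulRight (A q.1 q.2 • e q.1)
  have hsummable : Summable rankOne := .of_norm_bounded hA fun q => by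
    rw [ContinuousLinearMap.norm_smulRight_apply, innerSL_apply_norm, norm_smul, norm_e, norm_e,
      one_mul, mul_one]
  have happly (f : lp (fun _ : S => ℂ) 2) :
      HasSum (fun q : S × S => inner ℂ (e q.2) f • (A q.1 q.2 • e q.1)) ((∑' q, rankOne q) f) := by
    simpa [rankOne] using
      (ContinuousLinearMap.apply ℂ (lp (fun _ : S => ℂ) 2) f).hasSum hsummable.hasSum
  refine ⟨∑' q, rankOne q, ⟨S × S, fun q => A q.1 q.2 • e q.1, fun q => e q.2, ?_, happly⟩,
    fun s s' => ?_⟩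
  · simpa only [norm_smul, norm_e, mul_one] using hA
  have hentry : HasSum (fun q : S × S => if q = (s, s') then A s s' else 0)
      (inner ℂ (e s) ((∑' q, rankOne q) (e s'))) := by
    refine ((innerSL ℂ (e s)).hasSum (happly (e s'))).congr_fun ?_
    rintro ⟨t, t'⟩
    simp only [innerSL_apply_apply, inner_smul_right, e, lp_inner_single_single, Prod.mk.injEq]
    by_cases ht : s = t <;> by_cases ht' : t' = s' <;> simp [ht, ht', eq_comm]
  rw [← hentry.unique (hasSum_ite_eq _ _), lp.inner_single_left]
  simp [e]

end TraceClass

end Fredholm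

section LevelSystems

open Asymptotics Finset Filter Topology

/-- The difference relations of a biorthogonal system and of the transition functions between its
levels, with time counted from the left end of the half line: `φ` and `ψ` are indexed by the degree
and the time, and `ω d s t` is the transition function from time `s` to time `t`, `d` levels up. -/
structure IsLevelSystem (p : ℂ) (φ ψ : ℤ → ℕ → ℂ) (ω : ℕ → ℕ → ℕ → ℂ) : Prop where
  ne_zero : p ≠ 0
  phi_succ_sub : ∀ k t, φ k (t + 1) - φ k t = p * φ (k - 1) (t + 1)
  phi_of_neg : ∀ k t, k < 0 → φ k t = 0
  phi_zero : ∀ t, φ 0 t = p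
  psi_sub_succ : ∀ k t, ψ k t - ψ k (t + 1) = p * ψ (k + 1) t
  omega_zero : ∀ s t, ω 0 s t = if s = t then 1 else 0
  omega_succ : ∀ d s t, ω (d + 1) s t = p * ∑ σ ∈ range (t + 1), ω d s σ

/-- The one-level transition `ω 1` applied to `g`, that is, the running sum of `p * g`. -/
def runningSum (p : ℂ) (g : ℕ → ℂ) (t : ℕ) : ℂ := p * ∑ σ ∈ range (t + 1), g σ

/-- The part of the level function `φ (l - j)` that is accounted for by the cut-offs `χ` of the
levels below `l`. -/
def cutPart (p : ℂ) (φ : ℤ → ℕ → ℂ) (χ : ℕ → ℕ → ℂ) (j : ℕ) : ℕ → ℕ → ℂ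
  | 0 => fun _ => 0
  | l + 1 =>
    runningSum p fun t => cutPart p φ χ j l t + χ l t * (φ (l - j) t - cutPart p φ χ j l t)

/-- What remains of the level function `φ (l - j)` after the cut-offs `χ` of the lower levels. -/
def restPart (p : ℂ) (φ : ℤ → ℕ → ℂ) (χ : ℕ → ℕ → ℂ) (j l t : ℕ) : ℂ :=
  φ (l - j) t - cutPart p φ χ j l t

variable {p : ℂ} {φ ψ : ℤ → ℕ → ℂ} {ω : ℕ → ℕ → ℕ → ℂ} {χ : ℕ → ℕ → ℂ}

lemma cutPart_succ (j l t : ℕ) : cutPart p φ χ j (l + 1) t =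
    runningSum p (fun t => cutPart p φ χ j l t + χ l t * restPart p φ χ j l t) t := rfl

namespace IsLevelSystem

lemma cutPart_eq_sum (hD : IsLevelSystem p φ ψ ω) (j M l : ℕ) : ∀ t < M, cutPart p φ χ j l t =
    ∑ k ∈ range l, ∑ σ ∈ range M, χ k σ * restPart p φ χ j k σ * ω (l - k) σ t := by
  induction l with
  | zero => exact fun t _ => by rw [cutPart, range_zero, sum_empty]
  | succ l ih =>
    intro t ht
    have hsummand : ∀ τ ∈ range (t + 1), cutPart p φ χ j l τ + χ l τ * restPart p φ χ j l τ =
        ∑ k ∈ range (l + 1), ∑ σ ∈ range M, χ k σ * restPart p φ χ j k σ * ω (l - k) σ τ := by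
      intro τ hτ
      have hτM : τ < M := by
        rw [mem_range] at hτ
        lia
      rw [sum_range_succ, ih τ hτM]
      simp [hD.omega_zero, hτM]
    rw [cutPart_succ, runningSum, sum_congr rfl hsummand, sum_comm, mul_sum]
    refine sum_congr rfl fun k hk => ?_
    rw [sum_comm, mul_sum]
    refine sum_congr rfl fun σ _ => ?_
    rw [Nat.succ_sub (mem_range_succ_iff.1 hk), hD.omega_succ, ← mul_sum]
    ring

lemma cutPart_eq_zero (hD : IsLevelSystem p φ ψ ω) {j l : ℕ} (h : l ≤ j) (t : ℕ) :
    cutPart p φ χ j l t = 0 := by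
  induction l generalizing t with
  | zero => rfl
  | succ l ih =>
    simp [cutPart_succ, runningSum, restPart, ih (by lia), hD.phi_of_neg ((l : ℤ) - j) _ (by lia)]

lemma restPart_eq_zero (hD : IsLevelSystem p φ ψ ω) {j l : ℕ} (h : l < j) (t : ℕ) :
    restPart p φ χ j l t = 0 := by
  rw [restPart, hD.cutPart_eq_zero h.le, hD.phi_of_neg _ _ (by lia), sub_zero]

lemma restPart_self (hD : IsLevelSystem p φ ψ ω) (l t : ℕ) : restPart p φ χ l l t = p := by
  rw [restPart, hD.cutPart_eq_zero le_rfl, sub_self, hD.phi_zero, sub_zero]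

lemma restPart_zero_succ (hD : IsLevelSystem p φ ψ ω) (j t : ℕ) :
    restPart p φ χ j 0 (t + 1) = restPart p φ χ j 0 t := by
  have hφ := hD.phi_succ_sub (0 - j) t
  rw [hD.phi_of_neg (0 - j - 1) _ (by lia), mul_zero, sub_eq_zero] at hφ
  simp only [restPart, cutPart, Nat.cast_zero, hφ]

lemma restPart_succ_sub (hD : IsLevelSystem p φ ψ ω) (j l t : ℕ) :
    restPart p φ χ j (l + 1) (t + 1) - restPart p φ χ j (l + 1) t =
      p * ((1 - χ l (t + 1)) * restPart p φ χ j l (t + 1)) := by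
  have hφ := hD.phi_succ_sub ((l + 1 : ℕ) - j) t
  rw [show ((l + 1 : ℕ) : ℤ) - j - 1 = l - j by push_cast; ring] at hφ
  have hcut : cutPart p φ χ j (l + 1) (t + 1) - cutPart p φ χ j (l + 1) t =
      p * (cutPart p φ χ j l (t + 1) + χ l (t + 1) * restPart p φ χ j l (t + 1)) := by
    rw [cutPart_succ, cutPart_succ, runningSum, runningSum, sum_range_succ _ (t + 1)]
    ring
  simp only [restPart] at hcut ⊢
  linear_combination hφ - hcut

end IsLevelSystem

section SummationByParts

lemma sum_range_mul_sub_succ (G s : ℕ → ℂ) (hs : s 0 = 0) (B : ℕ) :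
    ∑ t ∈ range B, G t * (s t - s (t + 1)) =
      -(G (B - 1) * s B) + ∑ t ∈ range B, (G t - G (t - 1)) * s t := by
  induction B with
  | zero => simp [hs]
  | succ B ih =>
    rw [sum_range_succ, sum_range_succ, ih, Nat.add_sub_cancel]
    ring

variable {s : ℤ → ℕ → ℂ}

lemma mul_sum_range_mul_eq (hs : ∀ k t, s k t - s k (t + 1) = p * s (k + 1) t) {k : ℤ}
    (hs0 : s k 0 = 0) (G : ℕ → ℂ) (B : ℕ) :
    p * ∑ t ∈ range B, G t * s (k + 1) t =
      -(G (B - 1) * s k B) + ∑ t ∈ range B, (G t - G (t - 1)) * s k t := by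
  rw [← sum_range_mul_sub_succ G _ hs0, mul_sum]
  refine sum_congr rfl fun t _ => ?_
  rw [hs]
  ring

lemma IsLevelSystem.sum_restPart_diff_mul (hD : IsLevelSystem p φ ψ ω) {l B B' : ℕ}
    (hB : B ≤ B') (hχ : ∀ t < B', 1 - χ l t = if t < B then 1 else 0) {g : ℕ → ℂ} (hg : g 0 = 0)
    (j : ℕ) :
    ∑ t ∈ range B', (restPart p φ χ j (l + 1) t - restPart p φ χ j (l + 1) (t - 1)) * g t =
      p * ∑ t ∈ range B, restPart p φ χ j l t * g t := by
  have hsummand : ∀ t ∈ range B',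
      (restPart p φ χ j (l + 1) t - restPart p φ χ j (l + 1) (t - 1)) * g t =
        if t < B then p * (restPart p φ χ j l t * g t) else 0 := by
    intro t ht
    rcases t with _ | t
    · simp [hg]
    · rw [Nat.add_sub_cancel, hD.restPart_succ_sub, hχ _ (mem_range.1 ht)]
      split_ifs <;> ring
  rw [sum_congr rfl hsummand, ← sum_filter, mul_sum]
  refine sum_congr ?_ fun _ _ => rfl
  ext t
  simp only [mem_filter, mem_range]
  lia

lemma IsLevelSystem.mul_sum_restPart_mul (hD : IsLevelSystem p φ ψ ω)
    (hs : ∀ k t, s k t - s k (t + 1) = p * s (k + 1) t) {h : ℕ}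
    (hs0 : ∀ k : ℤ, k < h → s k 0 = 0) {B : ℕ → ℕ} (hB : ∀ l < h, B l ≤ B (l + 1))
    (hχ : ∀ l < h, ∀ t < B (l + 1), 1 - χ l t = if t < B l then 1 else 0) (j i : ℕ) :
    ∀ l ≤ h, p * ∑ t ∈ range (B l), restPart p φ χ j l t * s (l - i) t =
      -∑ k ∈ range (l + 1), restPart p φ χ j k (B k - 1) * s (k - 1 - i) (B k) := by
  have hparts (l : ℕ) (hl : l ≤ h) (G : ℕ → ℂ) :=
    mul_sum_range_mul_eq hs (hs0 (l - 1 - i) (by lia)) G (B l)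
  simp only [sub_right_comm _ (1 : ℤ), sub_add_cancel] at hparts
  intro l
  induction l with
  | zero =>
    intro h0
    rw [hparts 0 h0, sum_range_one, sum_eq_zero fun t _ => ?_, add_zero, sub_right_comm]
    rcases t with _ | t
    · rw [sub_self, zero_mul]
    · rw [Nat.add_sub_cancel, hD.restPart_zero_succ, sub_self, zero_mul]
  | succ l ih =>
    intro hl
    have hl' : ((l + 1 : ℕ) : ℤ) - i - 1 = l - i := by
      push_cast
      ring
    rw [hparts _ hl, hl', hD.sum_restPart_diff_mul (hB l (by lia)) (hχ l (by lia))
      (hs0 _ (by lia)), ih (by lia), sum_range_succ _ (l + 1), neg_add, add_comm,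
      sub_right_comm _ 1, hl']

end SummationByParts

section GeometricBounds

variable {κ lam C : ℝ} {f g : ℕ → ℂ}

lemma norm_sum_range_le (hκ : 1 < κ) (h : ∀ t, ‖g t‖ ≤ C * κ ^ t) (M : ℕ) :
    ‖∑ t ∈ range M, g t‖ ≤ C / (κ - 1) * κ ^ M := by
  have hC : 0 ≤ C := by simpa using (norm_nonneg _).trans (h 0)
  have : 0 < κ - 1 := by linarith
  refine (norm_sum_le_of_le _ fun t _ => h t).trans ?_
  rw [← mul_sum, geom_sum_eq hκ.ne', div_mul_eq_mul_div, mul_div_assoc]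
  gcongr
  linarith

lemma isBigO_top_pow_iff (hκ : 0 < κ) :
    (g =O[⊤] fun t => κ ^ t) ↔ ∃ C, ∀ t, ‖g t‖ ≤ C * κ ^ t := by
  simp only [isBigO_top, norm_pow, Real.norm_of_nonneg hκ.le]

lemma isBigO_top_runningSum (hκ : 1 < κ) (h : g =O[⊤] fun t => κ ^ t) (p : ℂ) :
    runningSum p g =O[⊤] fun t => κ ^ t := by
  have hκ0 : 0 < κ := by linarith
  obtain ⟨C, hC⟩ := (isBigO_top_pow_iff hκ0).1 h
  refine IsBigO.const_mul_left ((isBigO_top_pow_iff hκ0).2 ⟨C / (κ - 1) * κ, fun t => ?_⟩) p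
  exact (norm_sum_range_le hκ hC (t + 1)).trans_eq (by ring)

lemma isBigO_top_cut_mul (hχ : ∀ t, ‖f t‖ ≤ 1) (h : g =O[⊤] fun t => κ ^ t) :
    (fun t => f t * g t) =O[⊤] fun t => κ ^ t := by
  refine (IsBigO.of_bound' (Eventually.of_forall fun t => ?_) : _ =O[⊤] g).trans h
  rw [norm_mul]
  exact mul_le_of_le_one_left (norm_nonneg _) (hχ t)

lemma isBigO_top_const (hκ : 1 < κ) (c : ℂ) : (fun _ => c) =O[⊤] fun t : ℕ => κ ^ t :=
  (isBigO_top_pow_iff (by linarith)).2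
    ⟨‖c‖, fun _ => le_mul_of_one_le_right (norm_nonneg _) (one_le_pow₀ hκ.le)⟩

lemma tendsto_mul_zero_of_isBigO_top (hκ : 0 < κ) (hlam : 0 < lam) (hlt : κ * lam < 1)
    (hf : f =O[⊤] fun t => κ ^ t) (hg : g =O[⊤] fun t => lam ^ t) :
    Tendsto (fun M => f M * g M) atTop (𝓝 0) := by
  refine ((hf.mul hg).mono le_top).trans_tendsto ?_
  simp only [← mul_pow]
  exact tendsto_pow_atTop_nhds_zero_of_lt_one (mul_pos hκ hlam).le hlt

end GeometricBounds

namespace IsLevelSystem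

variable {κ lam : ℝ}

lemma phi_eq_add_runningSum (hD : IsLevelSystem p φ ψ ω) (k : ℤ) (t : ℕ) :
    φ (k + 1) t = φ (k + 1) 0 - p * φ k 0 + runningSum p (φ k) t := by
  induction t with
  | zero => simp [runningSum]
  | succ t ih =>
    have hφ := hD.phi_succ_sub (k + 1) t
    rw [add_sub_cancel_right] at hφ
    rw [runningSum] at ih ⊢
    rw [sum_range_succ]
    linear_combination hφ + ih

lemma isBigO_phi (hD : IsLevelSystem p φ ψ ω) (hκ : 1 < κ) (k : ℤ) :
    φ k =O[⊤] fun t => κ ^ t := by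
  rcases lt_or_ge k 0 with hk | hk
  · rw [funext fun t => hD.phi_of_neg k t hk]
    exact isBigO_zero _ _
  lift k to ℕ using hk
  induction k with
  | zero =>
    rw [Nat.cast_zero, funext hD.phi_zero]
    exact isBigO_top_const hκ p
  | succ k ih =>
    rw [Nat.cast_succ, funext (hD.phi_eq_add_runningSum k)]
    exact (isBigO_top_const hκ _).add (isBigO_top_runningSum hκ ih p)

lemma isBigO_cutPart (hD : IsLevelSystem p φ ψ ω) (hκ : 1 < κ) (hχ : ∀ l t, ‖χ l t‖ ≤ 1)
    (j l : ℕ) : cutPart p φ χ j l =O[⊤] fun t => κ ^ t := by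
  induction l with
  | zero => exact isBigO_zero _ _
  | succ l ih =>
    exact isBigO_top_runningSum hκ
      (ih.add (isBigO_top_cut_mul (hχ l) ((hD.isBigO_phi hκ _).sub ih))) p

lemma isBigO_restPart (hD : IsLevelSystem p φ ψ ω) (hκ : 1 < κ) (hχ : ∀ l t, ‖χ l t‖ ≤ 1)
    (j l : ℕ) : restPart p φ χ j l =O[⊤] fun t => κ ^ t :=
  (hD.isBigO_phi hκ _).sub (hD.isBigO_cutPart hκ hχ j l)

lemma exists_norm_omega_le (hD : IsLevelSystem p φ ψ ω) (hκ : 1 < κ) (d : ℕ) :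
    ∃ C : ℝ, ∀ s t, ‖ω d s t‖ ≤ C * (κ⁻¹ ^ s * κ ^ t) := by
  have hκ0 : 0 < κ := by linarith
  induction d with
  | zero =>
    refine ⟨1, fun s t => ?_⟩
    rw [hD.omega_zero]
    split_ifs with h
    · rw [h, ← mul_pow, inv_mul_cancel₀ hκ0.ne', one_pow, mul_one, norm_one]
    · rw [norm_zero]
      positivity
  | succ d ih =>
    obtain ⟨C, hC⟩ := ih
    refine ⟨‖p‖ * (C / (κ - 1) * κ), fun s t => ?_⟩
    have hsum := norm_sum_range_le hκ (g := fun σ => ω d s σ) (C := C * κ⁻¹ ^ s)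
      (fun t => (hC s t).trans_eq (by ring)) (t + 1)
    rw [hD.omega_succ, norm_mul]
    calc ‖p‖ * ‖∑ σ ∈ range (t + 1), ω d s σ‖
        ≤ ‖p‖ * (C * κ⁻¹ ^ s / (κ - 1) * κ ^ (t + 1)) := by gcongr
      _ = ‖p‖ * (C / (κ - 1) * κ) * (κ⁻¹ ^ s * κ ^ t) := by ring

lemma mul_sum_mul_psi (hD : IsLevelSystem p φ ψ ω) (g : ℕ → ℂ) (k : ℤ) (M : ℕ) :
    p * ∑ t ∈ range M, g t * ψ k t =
      (p * ∑ t ∈ range M, g t) * ψ k M +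
        p * ∑ t ∈ range M, runningSum p g t * ψ (k + 1) t := by
  induction M with
  | zero => simp
  | succ M ih =>
    simp only [runningSum] at ih ⊢
    rw [sum_range_succ, mul_add, ih, sum_range_succ _ M, sum_range_succ _ M, sum_range_succ _ M]
    linear_combination (p * (∑ t ∈ range M, g t + g M)) * hD.psi_sub_succ k M

section Limits

variable (hD : IsLevelSystem p φ ψ ω) (hκ : 1 < κ) (hlam : 0 < lam) (hlt : κ * lam < 1)
  (hψ : ∀ k, ψ k =O[⊤] fun t => lam ^ t)

include hD hκ hlam hlt hψ

lemma tendsto_sum_mul_psi_sub {g : ℕ → ℂ} (hg : g =O[⊤] fun t => κ ^ t) (k : ℤ) :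
    Tendsto (fun M =>
        ∑ t ∈ range M, g t * ψ k t - ∑ t ∈ range M, runningSum p g t * ψ (k + 1) t)
      atTop (𝓝 0) := by
  have hκ0 : 0 < κ := by linarith
  obtain ⟨C, hC⟩ := (isBigO_top_pow_iff hκ0).1 hg
  have hsum : (fun M => ∑ t ∈ range M, g t) =O[⊤] fun t => κ ^ t :=
    (isBigO_top_pow_iff hκ0).2 ⟨_, norm_sum_range_le hκ hC⟩
  refine (tendsto_mul_zero_of_isBigO_top hκ0 hlam hlt hsum (hψ k)).congr fun M => ?_
  refine mul_left_cancel₀ hD.ne_zero ?_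
  linear_combination -hD.mul_sum_mul_psi g k M

variable (hχ : ∀ l t, ‖χ l t‖ ≤ 1)

include hχ

lemma tendsto_sum_cut_sub_sum_cutPart (j i l : ℕ) :
    Tendsto (fun M => ∑ k ∈ range l, ∑ t ∈ range M,
        χ k t * restPart p φ χ j k t * ψ (k - i) t -
      ∑ t ∈ range M, cutPart p φ χ j l t * ψ (l - i) t) atTop (𝓝 0) := by
  induction l with
  | zero => simp [cutPart]
  | succ l ih =>
    have hg : (fun t => cutPart p φ χ j l t + χ l t * restPart p φ χ j l t) =O[⊤]
        fun t => κ ^ t :=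
      (hD.isBigO_cutPart hκ hχ j l).add (isBigO_top_cut_mul (hχ l) (hD.isBigO_restPart hκ hχ j l))
    have hlim := ih.add (hD.tendsto_sum_mul_psi_sub hκ hlam hlt hψ hg (l - i))
    rw [add_zero] at hlim
    refine hlim.congr fun M => ?_
    rw [sum_range_succ, show ((l + 1 : ℕ) : ℤ) - i = l - i + 1 by push_cast; ring]
    simp only [add_mul, sum_add_distrib, cutPart_succ]
    ring

lemma tendsto_one_sub_sum_cut {h j i B : ℕ} (hB : ∀ t, 1 - χ h t = if t < B then 1 else 0)
    (hpair : Tendsto (fun M => ∑ t ∈ range M, φ (h - j) t * ψ (h - i) t) atTop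
      (𝓝 (if j = i then 1 else 0))) :
    Tendsto (fun M => (if j = i then 1 else 0) - ∑ l ∈ range (h + 1), ∑ t ∈ range M,
        χ l t * restPart p φ χ j l t * ψ (l - i) t) atTop
      (𝓝 (∑ t ∈ range B, restPart p φ χ j h t * ψ (h - i) t)) := by
  have hlim := ((hpair.const_sub (if j = i then (1 : ℂ) else 0)).sub
    (hD.tendsto_sum_cut_sub_sum_cutPart hκ hlam hlt hψ hχ j i h)).add_const
    (∑ t ∈ range B, restPart p φ χ j h t * ψ (h - i) t)
  rw [sub_self, sub_zero, zero_add] at hlim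
  refine hlim.congr' ?_
  filter_upwards [eventually_ge_atTop B] with M hM
  have hbelow : ∑ t ∈ range B, restPart p φ χ j h t * ψ (h - i) t =
      ∑ t ∈ range M, (1 - χ h t) * (restPart p φ χ j h t * ψ (h - i) t) := by
    simp_rw [hB, ite_mul, one_mul, zero_mul]
    rw [← sum_filter]
    refine sum_congr ?_ fun _ _ => rfl
    ext t
    simp only [mem_filter, mem_range]
    lia
  have htop : ∑ t ∈ range M, χ h t * restPart p φ χ j h t * ψ (h - i) t =
      ∑ t ∈ range M, φ (h - j) t * ψ (h - i) t -
        ∑ t ∈ range M, cutPart p φ χ j h t * ψ (h - i) t -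
        ∑ t ∈ range B, restPart p φ χ j h t * ψ (h - i) t := by
    rw [hbelow, ← sum_sub_distrib, ← sum_sub_distrib]
    refine sum_congr rfl fun t _ => ?_
    rw [restPart]
    ring
  rw [sum_range_succ, htop]
  ring

end Limits

end IsLevelSystem

lemma sum_range_eq_sum_of_injective {M : Type*} [AddCommMonoid M] {m : ℕ} {n : Fin m → ℕ}
    (hn : Function.Injective n) {G : ℕ → M} (hG : ∀ l, (∀ i, n i ≠ l) → G l = 0) (b : ℕ) :
    ∑ l ∈ range b, G l = ∑ i : Fin m, if n i < b then G (n i) else 0 := by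
  rw [← sum_filter, ← sum_image (f := G) hn.injOn]
  refine (sum_subset (fun l hl => ?_) fun l hl hl' => hG l fun i hi => hl' ?_).symm
  · obtain ⟨i, hi, rfl⟩ := mem_image.1 hl
    exact mem_range.2 (mem_filter_univ i |>.1 hi)
  · exact mem_image.2 ⟨i, by simpa [hi] using hl, hi⟩

section Sections

variable {m : ℕ} {n : Fin m → ℕ} {h : ℕ} {M : ℕ}

/-- The finite section, up to time `M`, of the cut-off transition functions between the levels `n`;
it is strictly upper triangular in the levels. -/
def cutTransition (ω : ℕ → ℕ → ℕ → ℂ) (χ : ℕ → ℕ → ℂ) (n : Fin m → ℕ) (M : ℕ) :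
    Matrix (Fin m × Fin M) (Fin m × Fin M) ℂ :=
  Matrix.of fun s s' => χ (n s.1) s.2 *
    (if n s.1 < n s'.1 then ω (n s'.1 - n s.1) s.2 s'.2 else 0) * χ (n s'.1) s'.2

/-- The finite section, up to time `M`, of the cut-off functions `ψ` at the levels `n`. -/
def cutPsi (ψ : ℤ → ℕ → ℂ) (χ : ℕ → ℕ → ℂ) (n : Fin m → ℕ) (h M : ℕ) :
    Matrix (Fin m × Fin M) (Fin (h + 1)) ℂ :=
  Matrix.of fun s j => χ (n s.1) s.2 * ψ (n s.1 - (j : ℕ)) s.2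

/-- The finite section, up to time `M`, of the cut-off functions `restPart` at the levels `n`. -/
def cutRest (p : ℂ) (φ : ℤ → ℕ → ℂ) (χ : ℕ → ℕ → ℂ) (n : Fin m → ℕ) (h M : ℕ) :
    Matrix (Fin (h + 1)) (Fin m × Fin M) ℂ :=
  Matrix.of fun j s => χ (n s.1) s.2 * restPart p φ χ j (n s.1) s.2

lemma det_one_add_cutTransition (hn : StrictMono n) :
    (1 + cutTransition ω χ n M).det = 1 := by
  have htriangular : (1 + cutTransition ω χ n M).BlockTriangular (fun s => s.1) := by
    intro s s' hs
    have hlevel : ¬ n s.1 < n s'.1 := (hn hs).not_gt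
    have hne : s ≠ s' := fun h => hs.ne' (congrArg Prod.fst h)
    simp [cutTransition, hlevel, hne]
  rw [htriangular.det_fintype]
  refine prod_eq_one fun i _ => ?_
  have hdiag : (1 + cutTransition ω χ n M).toSquareBlock (fun s => s.1) i = 1 := by
    ext ⟨s, hs⟩ ⟨s', hs'⟩
    have hlevel : s.1 = s'.1 := hs.trans hs'.symm
    simp [Matrix.toSquareBlock, Matrix.toSquareBlockProp, cutTransition, hlevel, Matrix.one_apply]
  rw [hdiag, Matrix.det_one]

variable (hχ : ∀ l t, χ l t * χ l t = χ l t) (hχ0 : ∀ l, (∀ i, n i ≠ l) → ∀ t, χ l t = 0)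

include hχ hχ0

lemma IsLevelSystem.cutRest_mul_one_add_cutTransition (hD : IsLevelSystem p φ ψ ω)
    (hn : StrictMono n) :
    cutRest p φ χ n h M * (1 + cutTransition ω χ n M) =
      Matrix.of fun j s => φ (n s.1 - ((j : Fin (h + 1)) : ℕ)) s.2 * χ (n s.1) s.2 := by
  ext j s'
  have hcut := hD.cutPart_eq_sum (χ := χ) j M (n s'.1) s'.2 s'.2.2
  rw [sum_range_eq_sum_of_injective hn.injective fun l hl => sum_eq_zero fun σ _ => by
    rw [hχ0 l hl, zero_mul, zero_mul]] at hcut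
  have hproduct : ∑ s, cutRest p φ χ n h M j s * cutTransition ω χ n M s s' =
      cutPart p φ χ j (n s'.1) s'.2 * χ (n s'.1) s'.2 := by
    rw [hcut, Fintype.sum_prod_type, sum_mul]
    refine sum_congr rfl fun i _ => ?_
    split_ifs with hi
    · rw [← Fin.sum_univ_eq_sum_range
        (fun t => χ (n i) t * restPart p φ χ j (n i) t * ω (n s'.1 - n i) t s'.2), sum_mul]
      refine sum_congr rfl fun t _ => ?_
      simp only [cutRest, cutTransition, Matrix.of_apply, if_pos hi]
      linear_combination (restPart p φ χ j (n i) t * ω (n s'.1 - n i) t s'.2 * χ (n s'.1) s'.2) *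
        hχ (n i) t
    · simp [cutTransition, if_neg hi]
  rw [Matrix.mul_add, Matrix.mul_one, Matrix.add_apply, Matrix.mul_apply, hproduct]
  simp only [cutRest, Matrix.of_apply, restPart]
  ring

lemma cutRest_mul_cutPsi_apply (hn : StrictMono n) (hh : ∀ i, n i ≤ h) (j i : Fin (h + 1)) :
    (cutRest p φ χ n h M * cutPsi ψ χ n h M) j i =
      ∑ l ∈ range (h + 1), ∑ t ∈ range M,
        χ l t * restPart p φ χ j l t * ψ (l - (i : ℕ)) t := by
  rw [sum_range_eq_sum_of_injective hn.injective fun l hl => sum_eq_zero fun t _ => by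
    rw [hχ0 l hl, zero_mul, zero_mul], Matrix.mul_apply, Fintype.sum_prod_type]
  refine sum_congr rfl fun k _ => ?_
  rw [if_pos (Nat.lt_succ_of_le (hh k)), ← Fin.sum_univ_eq_sum_range
    (fun t => χ (n k) t * restPart p φ χ j (n k) t * ψ (n k - (i : ℕ)) t)]
  refine sum_congr rfl fun t _ => ?_
  simp only [cutRest, cutPsi, Matrix.of_apply]
  linear_combination (restPart p φ χ j (n k) t * ψ (n k - (i : ℕ)) t) * hχ (n k) t

lemma IsLevelSystem.one_sub_eq_mul (hD : IsLevelSystem p φ ψ ω) (hn : StrictMono n)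
    (hh : ∀ i, n i ≤ h) {A : Matrix (Fin m × Fin M) (Fin m × Fin M) ℂ}
    (hA : ∀ s s', A s s' = χ (n s.1) s.2 * ((∑ j ∈ range (n s'.1 + 1),
      ψ (n s.1 - j) s.2 * φ (n s'.1 - j) s'.2) -
        if n s.1 < n s'.1 then ω (n s'.1 - n s.1) s.2 s'.2 else 0) * χ (n s'.1) s'.2) :
    1 - A = (1 - cutPsi ψ χ n h M * cutRest p φ χ n h M) * (1 + cutTransition ω χ n M) := by
  rw [sub_mul, one_mul, Matrix.mul_assoc, hD.cutRest_mul_one_add_cutTransition hχ hχ0 hn]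
  ext s s'
  have hrange : ∑ j ∈ range (n s'.1 + 1), ψ (n s.1 - j) s.2 * φ (n s'.1 - j) s'.2 =
      ∑ j : Fin (h + 1), ψ (n s.1 - (j : ℕ)) s.2 * φ (n s'.1 - (j : ℕ)) s'.2 := by
    rw [Fin.sum_univ_eq_sum_range (fun j : ℕ => ψ (n s.1 - j) s.2 * φ (n s'.1 - j) s'.2)]
    refine sum_subset (range_mono (Nat.succ_le_succ (hh s'.1))) fun j _ hj => ?_
    rw [mem_range] at hj
    rw [hD.phi_of_neg _ _ (by lia), mul_zero]
  rw [Matrix.sub_apply, Matrix.sub_apply, Matrix.add_apply, hA, Matrix.mul_apply, hrange]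
  have hproduct : ∑ j, cutPsi ψ χ n h M s j *
      (Matrix.of fun j s => φ (n s.1 - ((j : Fin (h + 1)) : ℕ)) s.2 * χ (n s.1) s.2) j s' =
      χ (n s.1) s.2 * (∑ j : Fin (h + 1), ψ (n s.1 - (j : ℕ)) s.2 *
        φ (n s'.1 - (j : ℕ)) s'.2) * χ (n s'.1) s'.2 := by
    rw [mul_sum, sum_mul]
    refine sum_congr rfl fun j _ => ?_
    simp only [cutPsi, Matrix.of_apply]
    ring
  rw [hproduct]
  simp only [cutTransition, Matrix.of_apply]
  ring

lemma IsLevelSystem.det_one_sub_eq (hD : IsLevelSystem p φ ψ ω) (hn : StrictMono n)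
    (hh : ∀ i, n i ≤ h) {A : Matrix (Fin m × Fin M) (Fin m × Fin M) ℂ}
    (hA : ∀ s s', A s s' = χ (n s.1) s.2 * ((∑ j ∈ range (n s'.1 + 1),
      ψ (n s.1 - j) s.2 * φ (n s'.1 - j) s'.2) -
        if n s.1 < n s'.1 then ω (n s'.1 - n s.1) s.2 s'.2 else 0) * χ (n s'.1) s'.2) :
    (1 - A).det = (Matrix.of fun j i : Fin (h + 1) => (if (j : ℕ) = i then (1 : ℂ) else 0) -
      ∑ l ∈ range (h + 1), ∑ t ∈ range M,
        χ l t * restPart p φ χ j l t * ψ (l - (i : ℕ)) t).det := by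
  rw [hD.one_sub_eq_mul hχ hχ0 hn hh hA, Matrix.det_mul, det_one_add_cutTransition hn, mul_one,
    Matrix.det_one_sub_mul_comm]
  congr 1
  ext j i
  rw [Matrix.sub_apply, cutRest_mul_cutPsi_apply hχ hχ0 hn hh, Matrix.of_apply, Matrix.one_apply]
  simp only [Fin.ext_iff]

end Sections

lemma IsLevelSystem.det_sum_restPart_mul_psi (hD : IsLevelSystem p φ ψ ω) {s : ℤ → ℕ → ℂ}
    (hs : ∀ k t, s k t - s k (t + 1) = p * s (k + 1) t) {h : ℕ}
    (hs0 : ∀ k : ℤ, k < h → s k 0 = 0) (hψ : ∀ (k : ℤ) t, 0 ≤ k → ψ k t = s k t) {B : ℕ → ℕ}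
    (hB : ∀ l < h, B l ≤ B (l + 1))
    (hχ : ∀ l < h, ∀ t < B (l + 1), 1 - χ l t = if t < B l then 1 else 0) :
    (Matrix.of fun j i : Fin (h + 1) =>
      ∑ t ∈ range (B h), restPart p φ χ j h t * ψ (h - (i : ℕ)) t).det =
    (Matrix.of fun i l : Fin (h + 1) => -s ((l : ℕ) - 1 - (i : ℕ)) (B l)).det := by
  let Q : Matrix (Fin (h + 1)) (Fin (h + 1)) ℂ :=
    Matrix.of fun j l => p⁻¹ * restPart p φ χ j l (B l - 1)
  let G : Matrix (Fin (h + 1)) (Fin (h + 1)) ℂ :=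
    Matrix.of fun i l : Fin (h + 1) => -s ((l : ℕ) - 1 - (i : ℕ)) (B l)
  have hfactor : (Matrix.of fun j i : Fin (h + 1) =>
      ∑ t ∈ range (B h), restPart p φ χ j h t * ψ (h - (i : ℕ)) t) = Q * G.transpose := by
    ext j i
    have hψs : ∑ t ∈ range (B h), restPart p φ χ j h t * ψ (h - (i : ℕ)) t =
        ∑ t ∈ range (B h), restPart p φ χ j h t * s (h - (i : ℕ)) t :=
      sum_congr rfl fun t _ => by rw [hψ _ _ (sub_nonneg.2 (by exact_mod_cast i.is_le))]
    refine mul_left_cancel₀ hD.ne_zero ?_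
    rw [Matrix.of_apply, Matrix.mul_apply, hψs, hD.mul_sum_restPart_mul hs hs0 hB hχ j i h le_rfl,
      ← Fin.sum_univ_eq_sum_range
        (fun k : ℕ => restPart p φ χ j k (B k - 1) * s (k - 1 - (i : ℕ)) (B k)), mul_sum,
      ← sum_neg_distrib]
    refine sum_congr rfl fun k _ => ?_
    simp only [Q, G, Matrix.of_apply, Matrix.transpose_apply]
    field_simp [hD.ne_zero]
  have hQ : Q.det = 1 := by
    rw [Matrix.det_of_isUpperTriangular (M := Q) fun j l (hjl : l < j) => ?_]
    · refine prod_eq_one fun l _ => ?_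
      simp only [Q, Matrix.of_apply, hD.restPart_self, inv_mul_cancel₀ hD.ne_zero]
    · simp only [Q, Matrix.of_apply, hD.restPart_eq_zero hjl, mul_zero]
  rw [hfactor, Matrix.det_mul, hQ, one_mul, Matrix.det_transpose]

end LevelSystems

section CutKernel

open Asymptotics Filter Finset Topology

section LevelFunctions

variable {p r R : ℝ} (hp0 : 0 < p) (hp1 : p < 1) (hR1 : 1 < R) (hR : R < 1 / (1 - p))

lemma exists_pow_mul_lt_one {lam : ℝ} (hlam : lam < 1) (k : ℕ) :
    ∃ ζ : ℝ, 1 < ζ ∧ ζ ^ k * lam < 1 := by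
  have hlim : Tendsto (fun z : ℝ => z ^ k * lam) (𝓝[>] 1) (𝓝 (1 ^ k * lam)) :=
    ((continuous_pow k).mul continuous_const).continuousAt.tendsto.mono_left nhdsWithin_le_nhds
  rw [one_pow, one_mul] at hlim
  obtain ⟨ζ, hζlam, hζ⟩ := ((hlim.eventually_lt_const hlam).and self_mem_nhdsWithin).exists
  exact ⟨ζ, hζ, hζlam⟩

include hp0 hp1 hR1

lemma isBigO_top_tasepIntegral_outer (L x k : ℤ) :
    (fun t : ℕ => tasepIntegral p 1 R L k (x + t)) =O[⊤] fun t => (1 - p / 2) ^ t := by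
  obtain ⟨C, hC⟩ := exists_norm_tasepIntegral_outer_le hp0 hp1 hR1 L k
  have hlam : 0 < 1 - p / 2 := by linarith
  refine isBigO_top.2 ((isBigO_nat_atTop_iff fun t ht =>
    absurd ht (pow_ne_zero t hlam.ne')).1 (IsBigO.of_bound (C * (1 - p / 2) ^ x) ?_))
  filter_upwards [eventually_ge_atTop (-x).toNat] with t ht
  have hxt : (((x + t).toNat : ℕ) : ℤ) = x + t := by lia
  have hCt := hC (x + t).toNat
  rw [← zpow_natCast, hxt, zpow_add₀ hlam.ne', zpow_natCast, ← mul_assoc] at hCt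
  rwa [Real.norm_of_nonneg (by positivity)]

include hR

lemma levelTransition_succ_eq_sum (x : ℤ) (d s t : ℕ) :
    levelTransition p R ((d + 1 : ℕ) : ℤ) (x + s) (x + t) =
      p * ∑ σ ∈ range (t + 1), levelTransition p R d (x + s) (x + σ) := by
  have hstep := levelTransition_succ_sub hp1 hR1 hR ((d + 1 : ℕ) : ℤ) (x + s)
  rw [show ((d + 1 : ℕ) : ℤ) - 1 = d by push_cast; ring] at hstep
  induction t with
  | zero =>
    have hzero := hstep (x - 1)
    rw [sub_add_cancel, levelTransition_of_lt hp0 hp1 hR1 hR (d + 1)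
      (show x - 1 < x + s by lia), sub_zero] at hzero
    simpa using hzero
  | succ t ih =>
    rw [sum_range_succ, Nat.cast_succ t, ← add_assoc]
    linear_combination hstep (x + t) + ih

variable (hr0 : 0 < r) (hr1 : r < 1)

include hr0 hr1

lemma isLevelSystem_tasep (L x : ℤ) :
    IsLevelSystem (p : ℂ) (fun k t => dualFunction p r L k (x + t))
      (fun k t => tasepIntegral p 1 R L k (x + t))
      (fun d s t => levelTransition p R d (x + s) (x + t)) where
  ne_zero := mod_cast hp0.ne'
  phi_succ_sub k t := by
    simpa only [Nat.cast_succ, add_assoc] using dualFunction_succ_sub hp0 hp1 hr0 hr1 L k (x + t)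
  phi_of_neg k t hk := dualFunction_of_neg hp0 hp1 hr0 hr1 hk L _
  phi_zero t := dualFunction_zero hp0 hp1 hr0 hr1 L _
  psi_sub_succ k t := by
    simpa only [Nat.cast_succ, add_assoc] using
      (isRegularCircle_outer hp1 hR1 hR).tasepIntegral_sub_succ L k (x + t)
  omega_zero s t := by
    split_ifs with h
    · exact h ▸ levelTransition_zero_self hp0 hp1 hR1 hR _
    · exact levelTransition_zero_of_ne hp0 hp1 hR1 hR (by lia)
  omega_succ d s t := levelTransition_succ_eq_sum hp0 hp1 hR1 hR x d s t

lemma tendsto_pairingBoundary (L x : ℤ) (k l : ℕ) :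
    Tendsto (fun M : ℕ => pairingBoundary p r R L k l (x + M)) atTop (𝓝 0) := by
  have hp : (p : ℂ) ≠ 0 := mod_cast hp0.ne'
  obtain ⟨κ, hκ, hκlam⟩ := exists_pow_mul_lt_one (show 1 - p / 2 < 1 by linarith) 1
  rw [pow_one] at hκlam
  rw [← sum_const_zero (s := range (k + 1))]
  refine tendsto_finsetSum _ fun j _ => ?_
  have hdual : (fun t : ℕ => tasepIntegral p 1 r (-L) (j - k - 1) (-(x + t))) =O[⊤]
      fun t => κ ^ t := by
    refine (((isLevelSystem_tasep hp0 hp1 hR1 hR hr0 hr1 L (x - 1)).isBigO_phi hκ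
      (k - j)).const_mul_left (p : ℂ)⁻¹).congr_left fun t => ?_
    rw [dualFunction, inv_mul_cancel_left₀ hp]
    congr 1 <;> ring
  exact tendsto_mul_zero_of_isBigO_top (by linarith) (by linarith) hκlam hdual
    (isBigO_top_tasepIntegral_outer hp0 hp1 hR1 L x _)

lemma tendsto_sum_dualFunction_mul_tasepIntegral {L x : ℤ} (k l : ℕ) (hl : x + l + 1 ≤ L) :
    Tendsto (fun M : ℕ =>
        ∑ t ∈ range M, dualFunction p r L k (x + t) * tasepIntegral p 1 R L l (x + t)) atTop
      (𝓝 (if k = l then 1 else 0)) := by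
  have htelescope : ∀ M : ℕ,
      ∑ t ∈ range M, dualFunction p r L k (x + t) * tasepIntegral p 1 R L l (x + t) =
        pairingBoundary p r R L k l x - pairingBoundary p r R L k l (x + M) := by
    intro M
    have hsum := sum_range_sub' (fun t : ℕ => pairingBoundary p r R L k l (x + t)) M
    rw [Nat.cast_zero, add_zero] at hsum
    rw [← hsum]
    refine sum_congr rfl fun t _ => ?_
    rw [← pairingBoundary_sub_succ hp0 hp1 hr0 hr1 hR1 hR, Nat.cast_succ, add_assoc]
  simp only [htelescope, ← pairingBoundary_start hp0 hp1 hr0 hr1 hR1 hR k l hl]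
  simpa only [sub_zero] using
    tendsto_const_nhds.sub (tendsto_pairingBoundary hp0 hp1 hR1 hR hr0 hr1 L x k l)

lemma isBigO_top_corrKernel (N : ℕ) (x : ℤ) (n₁ n₂ : ℕ) {κ η : ℝ} (hκ : 1 < κ) (hη : 1 < η) :
    (fun q : ℕ × ℕ => corrKernel p N x r R (n₁ + 1) (x + q.1) (n₂ + 1) (x + q.2)) =O[⊤]
      fun q => (1 - p / 2) ^ q.1 * κ ^ q.2 + if n₁ < n₂ then η⁻¹ ^ q.1 * η ^ q.2 else 0 := by
  have hD := isLevelSystem_tasep hp0 hp1 hR1 hR hr0 hr1 (x + N) x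
  have hlam : 0 < 1 - p / 2 := by linarith
  have hdecay : ∀ q : ℕ × ℕ, 0 ≤ (1 - p / 2) ^ q.1 * κ ^ q.2 := fun q => by positivity
  have hgrow : ∀ q : ℕ × ℕ, 0 ≤ if n₁ < n₂ then η⁻¹ ^ q.1 * η ^ q.2 else 0 := fun q => by
    split_ifs <;> positivity
  simp only [corrKernel_succ_succ hp0 hp1 hr0 hr1 hR1 hR]
  refine IsBigO.sub (E' := ℂ) (IsBigO.fun_sum fun j _ => ?_) ?_
  · refine (((isBigO_top_tasepIntegral_outer hp0 hp1 hR1 (x + N) x _).comp_tendsto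
      (k := Prod.fst) tendsto_top).mul ((hD.isBigO_phi hκ _).comp_tendsto
      (k := Prod.snd) tendsto_top)).trans (isBigO_top.2 ⟨1, fun q => ?_⟩)
    rw [one_mul, Function.comp_apply, Function.comp_apply, Real.norm_of_nonneg (hdecay q),
      Real.norm_of_nonneg (add_nonneg (hdecay q) (hgrow q))]
    exact le_add_of_nonneg_right (hgrow q)
  · obtain ⟨C, hC⟩ := hD.exists_norm_omega_le hη (n₂ - n₁)
    have hC0 : 0 ≤ C := by simpa using (norm_nonneg _).trans (hC 0 0)
    refine isBigO_top.2 ⟨C, fun q => ?_⟩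
    rw [Real.norm_of_nonneg (add_nonneg (hdecay q) (hgrow q))]
    refine le_trans ?_ (mul_le_mul_of_nonneg_left (le_add_of_nonneg_left (hdecay q)) hC0)
    split_ifs with h
    · simpa only [Nat.cast_sub h.le] using hC q.1 q.2
    · simp only [norm_zero, mul_zero, le_refl]

end LevelFunctions

section Summability

/-- The diagonal conjugation of the kernel, at level `i` and time `t`: the growth rates of
consecutive levels leave room for the rate `ζ ^ (2 * i + 3)` in between. -/
def conjWeight (ζ : ℝ) (i t : ℕ) : ℝ := (ζ ^ (2 * i + 2)) ^ t

variable {ζ lam : ℝ} {i i' : ℕ}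

lemma conjWeight_pos (hζ : 0 < ζ) (i t : ℕ) : 0 < conjWeight ζ i t := by
  unfold conjWeight
  positivity

lemma pow_mul_pow_le_pow {a b c : ℝ} (ha : 0 ≤ a) (hb : 0 ≤ b) (h : a * b ≤ c) (t : ℕ) :
    a ^ t * b ^ t ≤ c ^ t :=
  (mul_pow a b t).symm.trans_le (pow_le_pow_left₀ (mul_nonneg ha hb) h t)

lemma conjWeight_mul_pow_le (hζ : 0 < ζ) (hlam : 0 ≤ lam) (h : ζ ^ (2 * i + 3) * lam ≤ 1)
    (t : ℕ) : conjWeight ζ i t * lam ^ t ≤ ζ⁻¹ ^ t := by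
  refine pow_mul_pow_le_pow (by positivity) hlam ?_ t
  rw [inv_eq_one_div, le_div_iff₀ hζ]
  exact le_of_eq_of_le (by ring) h

lemma pow_mul_inv_conjWeight_le (hζ : 1 < ζ) {k : ℕ} (hk : k < 2 * i + 2) (t : ℕ) :
    (ζ ^ k) ^ t * (conjWeight ζ i t)⁻¹ ≤ ζ⁻¹ ^ t := by
  have hζ0 : 0 < ζ := by linarith
  rw [conjWeight, ← inv_pow (ζ ^ (2 * i + 2))]
  refine pow_mul_pow_le_pow (by positivity) (by positivity) ?_ t
  rw [← div_eq_mul_inv, inv_eq_one_div, div_le_div_iff₀ (by positivity) hζ0, one_mul, ← pow_succ]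
  exact pow_le_pow_right₀ hζ.le hk

lemma conjWeight_mul_envelope_mul_inv_le (hζ : 1 < ζ) (hlam : 0 ≤ lam)
    (h : ζ ^ (2 * i + 3) * lam ≤ 1) {P : Prop} [Decidable P] (hP : P → i < i') (t t' : ℕ) :
    conjWeight ζ i t * (lam ^ t * ζ ^ t' +
        if P then (ζ ^ (2 * i + 3))⁻¹ ^ t * (ζ ^ (2 * i + 3)) ^ t' else 0) *
      (conjWeight ζ i' t')⁻¹ ≤ 2 * (ζ⁻¹ ^ t * ζ⁻¹ ^ t') := by
  have hζ0 : 0 < ζ := by linarith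
  have := conjWeight_pos hζ0 i t
  have := conjWeight_pos hζ0 i' t'
  have hdecay : conjWeight ζ i t * (lam ^ t * ζ ^ t') * (conjWeight ζ i' t')⁻¹ ≤
      ζ⁻¹ ^ t * ζ⁻¹ ^ t' := by
    have hζt' : ζ ^ t' * (conjWeight ζ i' t')⁻¹ ≤ ζ⁻¹ ^ t' := by
      simpa only [pow_one] using
        pow_mul_inv_conjWeight_le hζ (show 1 < 2 * i' + 2 by lia) t'
    rw [← mul_assoc, mul_assoc]
    exact mul_le_mul (conjWeight_mul_pow_le hζ0 hlam h t) hζt' (by positivity) (by positivity)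
  have hgrow : P → conjWeight ζ i t * ((ζ ^ (2 * i + 3))⁻¹ ^ t * (ζ ^ (2 * i + 3)) ^ t') *
      (conjWeight ζ i' t')⁻¹ ≤ ζ⁻¹ ^ t * ζ⁻¹ ^ t' := fun hp => by
    have := hP hp
    rw [← mul_assoc, mul_assoc]
    exact mul_le_mul (conjWeight_mul_pow_le hζ0 (by positivity)
        (mul_inv_cancel₀ (by positivity)).le t)
      (pow_mul_inv_conjWeight_le hζ (by lia) t') (by positivity) (by positivity)
  rw [mul_add, add_mul, two_mul (ζ⁻¹ ^ t * _)]
  refine add_le_add hdecay ?_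
  split_ifs with hp
  · exact hgrow hp
  · rw [mul_zero, zero_mul]
    positivity

lemma summable_geometric_mul_geometric (m : ℕ) {z : ℝ} (hz0 : 0 ≤ z) (hz1 : z < 1) :
    Summable fun q : (Fin m × ℕ) × (Fin m × ℕ) => z ^ q.1.2 * z ^ q.2.2 := by
  have hgeom : Summable fun s : Fin m × ℕ => z ^ s.2 := by
    rw [summable_prod_of_nonneg fun s => pow_nonneg hz0 s.2]
    exact ⟨fun _ => summable_geometric_of_lt_one hz0 hz1, (hasSum_fintype _).summable⟩
  exact hgeom.mul_of_nonneg hgeom (fun s => pow_nonneg hz0 s.2) fun s => pow_nonneg hz0 s.2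

end Summability

section LevelTime

variable {m N : ℕ} {x : ℤ}

/-- `LevelTime` with time counted from `x`. -/
def levelTimeEquiv (m : ℕ) (x : ℤ) : Fin m × ℕ ≃ LevelTime m x where
  toFun s := (s.1, ⟨x + s.2, by lia⟩)
  invFun s := (s.1, (s.2.1 - x).toNat)
  left_inv s := by ext <;> simp
  right_inv s := by
    obtain ⟨i, t, ht⟩ := s
    simp only [Prod.mk.injEq, Subtype.mk.injEq, true_and]
    lia

/-- The part of the index set with the first `M` times. -/
def levelTimeSection (m : ℕ) (x : ℤ) (M : ℕ) : Finset (LevelTime m x) :=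
  (univ ×ˢ range M).map (levelTimeEquiv m x).toEmbedding

lemma mem_levelTimeSection {M : ℕ} {s : LevelTime m x} :
    s ∈ levelTimeSection m x M ↔ ((levelTimeEquiv m x).symm s).2 < M := by
  simp only [levelTimeSection, mem_map_equiv, mem_product, mem_univ, mem_range, true_and]

/-- Enumeration of `levelTimeSection`. -/
def levelTimeSectionEquiv (m : ℕ) (x : ℤ) (M : ℕ) : Fin m × Fin M ≃ levelTimeSection m x M where
  toFun s := ⟨levelTimeEquiv m x (s.1, s.2), mem_levelTimeSection.2 (by simp)⟩
  invFun s := (((levelTimeEquiv m x).symm s.1).1, ⟨((levelTimeEquiv m x).symm s.1).2,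
    mem_levelTimeSection.1 s.2⟩)
  left_inv s := by simp
  right_inv s := Subtype.ext ((levelTimeEquiv m x).apply_symm_apply s.1)

/-- The cut-off `χ_a`, extended by `0` to the levels outside `n`, with time counted from `x`. -/
def levelCut (x : ℤ) (n : Fin m → Fin N) (a : Fin m → ℝ) (l t : ℕ) : ℂ :=
  open Classical in if ∃ i, (n i : ℕ) = l ∧ a i < ((x + t : ℤ) : ℝ) then 1 else 0

lemma levelCut_apply {n : Fin m → Fin N} (hn : StrictMono n) (a : Fin m → ℝ) (s : Fin m × ℕ) :
    levelCut x n a (n s.1) s.2 = cutoff a (levelTimeEquiv m x s) := by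
  refine if_congr ⟨?_, fun h => ⟨s.1, rfl, h⟩⟩ rfl rfl
  rintro ⟨i, hi, h⟩
  rwa [hn.injective (Fin.ext hi)] at h

lemma levelCut_mul_self (x : ℤ) (n : Fin m → Fin N) (a : Fin m → ℝ) (l t : ℕ) :
    levelCut x n a l t * levelCut x n a l t = levelCut x n a l t := by
  unfold levelCut
  split_ifs <;> simp

lemma norm_levelCut_le (x : ℤ) (n : Fin m → Fin N) (a : Fin m → ℝ) (l t : ℕ) :
    ‖levelCut x n a l t‖ ≤ 1 := by
  unfold levelCut
  split_ifs <;> simp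

lemma norm_cutoff_le (a : Fin m → ℝ) (s : LevelTime m x) : ‖cutoff a s‖ ≤ 1 := by
  unfold cutoff
  split_ifs <;> simp

lemma norm_cutKernel_le (p r R : ℝ) (n : Fin m → Fin N) (a : Fin m → ℝ) (s s' : LevelTime m x) :
    ‖cutKernel p N x r R n a s s'‖ ≤
      ‖corrKernel p N x r R ((n s.1 : ℕ) + 1) s.2.1 ((n s'.1 : ℕ) + 1) s'.2.1‖ := by
  rw [cutKernel, norm_mul, norm_mul]
  exact (mul_le_of_le_one_right (by positivity) (norm_cutoff_le a s')).trans
    (mul_le_of_le_one_left (norm_nonneg _) (norm_cutoff_le a s))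

end LevelTime

section CutKernel

variable {p r R : ℝ} (hp0 : 0 < p) (hp1 : p < 1) (hr0 : 0 < r) (hr1 : r < 1) (hR1 : 1 < R)
  (hR : R < 1 / (1 - p)) (N : ℕ) (x : ℤ) {m : ℕ} {n : Fin m → Fin N} (hn : StrictMono n)
  (a : Fin m → ℝ)

include hp0 hp1 hr0 hr1 hR1 hR hn

lemma exists_summable_conj_cutKernel :
    ∃ ρ : LevelTime m x → ℝ, (∀ s, 0 < ρ s) ∧ Summable fun q : LevelTime m x × LevelTime m x =>
      ‖(ρ q.1 : ℂ) * cutKernel p N x r R n a q.1 q.2 * (ρ q.2 : ℂ)⁻¹‖ := by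
  have hlam : 0 < 1 - p / 2 := by linarith
  obtain ⟨ζ, hζ, hζlam⟩ := exists_pow_mul_lt_one (show 1 - p / 2 < 1 by linarith) (2 * m + 1)
  have hζ0 : 0 < ζ := by linarith
  have hζi : ∀ i : Fin m, ζ ^ (2 * (i : ℕ) + 3) * (1 - p / 2) ≤ 1 := fun i =>
    (mul_le_mul_of_nonneg_right (pow_le_pow_right₀ hζ.le (by have := i.2; lia)) hlam.le).trans
      hζlam.le
  let e := levelTimeEquiv m x
  have hρ : ∀ s, 0 < conjWeight ζ (e.symm s).1 (e.symm s).2 := fun s => conjWeight_pos hζ0 _ _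
  refine ⟨fun s => conjWeight ζ (e.symm s).1 (e.symm s).2, hρ, ?_⟩
  choose C hC0 hC using fun q : Fin m × Fin m =>
    (isBigO_top_corrKernel hp0 hp1 hR1 hR hr0 hr1 N x (n q.1) (n q.2) hζ
      (one_lt_pow₀ hζ (show 2 * (q.1 : ℕ) + 3 ≠ 0 by lia))).exists_nonneg
  have hCle : ∀ q, C q ≤ ∑ q, C q := fun q => single_le_sum (fun q _ => hC0 q) (mem_univ q)
  have hbound := (summable_geometric_mul_geometric m (inv_nonneg.2 hζ0.le)
    (inv_lt_one_of_one_lt₀ hζ)).mul_left ((∑ q, C q) * 2)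
  rw [← (e.prodCongr e).summable_iff]
  refine hbound.of_nonneg_of_le (fun q => norm_nonneg _) fun ⟨⟨i, t⟩, ⟨i', t'⟩⟩ => ?_
  have hkernel := (norm_cutKernel_le p r R n a (e (i, t)) (e (i', t'))).trans
    (isBigOWith_top.1 (hC (i, i')) (t, t'))
  rw [Real.norm_of_nonneg (by positivity)] at hkernel
  have henvelope := conjWeight_mul_envelope_mul_inv_le hζ hlam.le (hζi i)
    (P := (n i : ℕ) < n i') (i' := i') (fun h => hn.lt_iff_lt.1 h) t t'
  simp only [Function.comp_apply, Equiv.prodCongr_apply, Prod.map, Equiv.symm_apply_apply,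
    norm_mul, norm_inv, Complex.norm_real, Real.norm_of_nonneg (conjWeight_pos hζ0 _ _).le]
  calc conjWeight ζ i t * ‖cutKernel p N x r R n a (e (i, t)) (e (i', t'))‖ *
        (conjWeight ζ i' t')⁻¹
    _ ≤ conjWeight ζ i t * (C (i, i') * _) * (conjWeight ζ i' t')⁻¹ :=
      mul_le_mul_of_nonneg_right (mul_le_mul_of_nonneg_left hkernel (conjWeight_pos hζ0 _ _).le)
        (inv_nonneg.2 (conjWeight_pos hζ0 _ _).le)
    _ = C (i, i') * _ := by rw [mul_left_comm, mul_assoc]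
    _ ≤ C (i, i') * (2 * (ζ⁻¹ ^ t * ζ⁻¹ ^ t')) := mul_le_mul_of_nonneg_left henvelope (hC0 _)
    _ ≤ (∑ q, C q) * (2 * (ζ⁻¹ ^ t * ζ⁻¹ ^ t')) :=
      mul_le_mul_of_nonneg_right (hCle _) (by positivity)
    _ = (∑ q, C q) * 2 * (ζ⁻¹ ^ t * ζ⁻¹ ^ t') := (mul_assoc _ _ _).symm

lemma cutKernel_traceClassUpToConjugation :
    TraceClassUpToConjugation (cutKernel p N x r R n a) := by
  obtain ⟨ρ, hρ, hsum⟩ := exists_summable_conj_cutKernel hp0 hp1 hr0 hr1 hR1 hR N x hn a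
  exact ⟨ρ, hρ, exists_isTraceClass_of_summable hsum⟩

lemma cutKernel_fredholmSummable : FredholmSummable (cutKernel p N x r R n a) := by
  obtain ⟨ρ, hρ, hsum⟩ := exists_summable_conj_cutKernel hp0 hp1 hr0 hr1 hR1 hR N x hn a
  exact fredholmSummable_of_conj (ρ := fun s => (ρ s : ℂ)) (fun s => mod_cast (hρ s).ne')
    (fredholmSummable_of_summable hsum)

lemma det_one_sub_section_cutKernel {h : ℕ} (hh : ∀ i, (n i : ℕ) ≤ h) (M : ℕ) :
    (1 - Matrix.of fun s s' : levelTimeSection m x M => cutKernel p N x r R n a s s').det =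
      (Matrix.of fun j i : Fin (h + 1) => (if (j : ℕ) = i then (1 : ℂ) else 0) -
        ∑ l ∈ range (h + 1), ∑ t ∈ range M, levelCut x n a l t *
          restPart p (fun k t => dualFunction p r (x + N) k (x + t)) (levelCut x n a) j l t *
          tasepIntegral p 1 R (x + N) (l - (i : ℕ)) (x + t)).det := by
  rw [← Matrix.det_submatrix_equiv_self (levelTimeSectionEquiv m x M), Matrix.submatrix_sub,
    Pi.sub_apply, Pi.sub_apply, Matrix.submatrix_one_equiv]
  refine (isLevelSystem_tasep hp0 hp1 hR1 hR hr0 hr1 (x + N) x).det_one_sub_eq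
    (n := fun i => (n i : ℕ)) (levelCut_mul_self x n a)
    (fun l hl t => if_neg fun ⟨i, hi, _⟩ => hl i hi) (fun _ _ hij => hn hij) hh fun s s' => ?_
  have hentry : ((Matrix.of fun s s' : levelTimeSection m x M =>
      cutKernel p N x r R n a s s').submatrix
        (levelTimeSectionEquiv m x M) (levelTimeSectionEquiv m x M)) s s' =
      cutoff a (levelTimeEquiv m x (s.1, s.2)) *
        corrKernel p N x r R ((n s.1 : ℕ) + 1) (x + s.2) ((n s'.1 : ℕ) + 1) (x + s'.2) *
        cutoff a (levelTimeEquiv m x (s'.1, s'.2)) := rfl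
  rw [hentry, ← levelCut_apply hn a (s.1, s.2), ← levelCut_apply hn a (s'.1, s'.2),
    corrKernel_succ_succ hp0 hp1 hr0 hr1 hR1 hR N x]
  congr 3
  refine ite_congr rfl (fun hlt => ?_) fun _ => rfl
  rw [Nat.cast_sub hlt.le]

lemma fredholmDet_cutKernel_eq_det_tasepIntegral {h : ℕ} (hhN : h < N) (hh : ∀ i, (n i : ℕ) ≤ h)
    {B : ℕ → ℕ} (hB : ∀ l < h, B l ≤ B (l + 1))
    (hχ : ∀ l < h, ∀ t < B (l + 1), 1 - levelCut x n a l t = if t < B l then 1 else 0)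
    (hχh : ∀ t, 1 - levelCut x n a h t = if t < B h then 1 else 0) :
    fredholmDet (cutKernel p N x r R n a) = (Matrix.of fun i l : Fin (h + 1) =>
      -tasepIntegral p 0 (p / 2) (x + N) ((l : ℕ) - 1 - (i : ℕ)) (x + B l)).det := by
  have hD := isLevelSystem_tasep hp0 hp1 hR1 hR hr0 hr1 (x + N) x
  obtain ⟨κ, hκ, hκlam⟩ := exists_pow_mul_lt_one (show 1 - p / 2 < 1 by linarith) 1
  rw [pow_one] at hκlam
  have hsections := tendsto_det_one_sub
    (cutKernel_fredholmSummable hp0 hp1 hr0 hr1 hR1 hR N x hn a) (F := levelTimeSection m x)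
    (fun M M' hM s hs => mem_levelTimeSection.2 ((mem_levelTimeSection.1 hs).trans_le hM))
    fun s => ⟨_, mem_levelTimeSection.2 (Nat.lt_succ_self _)⟩
  simp only [det_one_sub_section_cutKernel hp0 hp1 hr0 hr1 hR1 hR N x hn a hh] at hsections
  rw [← hD.det_sum_restPart_mul_psi (χ := levelCut x n a)
    (s := fun k t => tasepIntegral p 0 (p / 2) (x + N) k (x + t))
    (fun k t => by
      simpa only [Nat.cast_succ, add_assoc] using
        (isRegularCircle_origin hp0 hp1).tasepIntegral_sub_succ (x + N) k (x + t))
    (fun k hk => tasepIntegral_origin_eq_zero hp0 hp1 (by lia))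
    (fun k t hk => tasepIntegral_outer_eq_origin hp0 hp1 hR1 hR _ hk _) hB hχ]
  refine tendsto_nhds_unique hsections (((Continuous.matrix_det continuous_id).tendsto _).comp
    (tendsto_pi_nhds.2 fun j => tendsto_pi_nhds.2 fun i =>
      hD.tendsto_one_sub_sum_cut hκ (by linarith) hκlam
        (isBigO_top_tasepIntegral_outer hp0 hp1 hR1 (x + N) x) (norm_levelCut_le x n a) hχh ?_))
  have hpair := tendsto_sum_dualFunction_mul_tasepIntegral hp0 hp1 hR1 hR hr0 hr1 (L := x + N)
    (x := x) (h - j) (h - i) (by lia)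
  have hji : (h - (j : ℕ) = h - i) = ((j : ℕ) = i) := by
    have := j.is_le
    have := i.is_le
    apply propext
    lia
  simpa only [hji, Nat.cast_sub j.is_le, Nat.cast_sub i.is_le] using hpair

end CutKernel

end CutKernel

section ExitDeterminant

open Finset

section UnitRows

variable {ι R : Type*} [CommRing R]

/-- The matrix `A` with the rows in `S` replaced by those of the identity matrix. -/
def unitRows [DecidableEq ι] (S : Finset ι) (A : Matrix ι ι R) : Matrix ι ι R :=
  Matrix.of fun i j => if i ∈ S then (1 : Matrix ι ι R) i j else A i j

lemma unitRows_apply_of_notMem [DecidableEq ι] {S : Finset ι} (A : Matrix ι ι R) {i : ι}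
    (hi : i ∉ S) (j : ι) : unitRows S A i j = A i j :=
  if_neg hi

lemma unitRows_apply_of_mem [DecidableEq ι] {S : Finset ι} (A : Matrix ι ι R) {i : ι}
    (hi : i ∈ S) (j : ι) : unitRows S A i j = (1 : Matrix ι ι R) i j :=
  if_pos hi

variable [Fintype ι] [LinearOrder ι]

lemma eq_unitRows_compl_mul_unitRows {S : Finset ι} (hS : IsLowerSet (S : Set ι))
    {A : Matrix ι ι R} (hA : ∀ i ∈ S, ∀ j, i < j → A i j = 0) :
    A = unitRows Sᶜ A * unitRows S A := by
  ext i j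
  rw [Matrix.mul_apply]
  by_cases hi : i ∈ S
  · have hterm : ∀ k, unitRows Sᶜ A i k * unitRows S A k j = A i k * (1 : Matrix ι ι R) k j := by
      intro k
      rw [unitRows_apply_of_notMem _ (by simpa using hi)]
      by_cases hk : k ∈ S
      · rw [unitRows_apply_of_mem _ hk]
      · rw [hA i hi k (lt_of_not_ge fun hki => hk (hS hki hi)), zero_mul, zero_mul]
    simp only [hterm, ← Matrix.mul_apply, mul_one]
  · simp only [unitRows_apply_of_mem A (mem_compl.2 hi), ← Matrix.mul_apply, one_mul,
      unitRows_apply_of_notMem A hi]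

lemma det_unitRows_of_isLowerSet {S : Finset ι} (hS : IsLowerSet (S : Set ι)) {A : Matrix ι ι R}
    (hdiag : ∀ i ∈ S, A i i = 1) (hA : ∀ i ∈ S, ∀ j, i < j → A i j = 0) :
    (unitRows S A).det = A.det := by
  have htri : (unitRows Sᶜ A).det = 1 := by
    rw [Matrix.det_of_isLowerTriangular]
    · refine prod_eq_one fun i _ => ?_
      by_cases hi : i ∈ S
      · rw [unitRows_apply_of_notMem _ (by simpa using hi), hdiag i hi]
      · rw [unitRows_apply_of_mem _ (mem_compl.2 hi), Matrix.one_apply_eq]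
    · intro i j (hij : i < j)
      by_cases hi : i ∈ S
      · rw [unitRows_apply_of_notMem _ (by simpa using hi), hA i hi j hij]
      · rw [unitRows_apply_of_mem _ (mem_compl.2 hi), Matrix.one_apply_ne hij.ne]
  rw [eq_unitRows_compl_mul_unitRows hS hA, Matrix.det_mul, htri, one_mul,
    ← eq_unitRows_compl_mul_unitRows hS hA]

end UnitRows

lemma det_sum_mul_row {ι β R : Type*} [Fintype ι] [DecidableEq ι] [Fintype β] [CommRing R]
    (w : β → R) (A : ι → β → ι → R) :
    (Matrix.of fun i j => ∑ b, w b * A i b j).det =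
      ∑ ε : ι → β, (∏ i, w (ε i)) * (Matrix.of fun i j => A i (ε i) j).det := by
  have hrows : (Matrix.of fun i j => ∑ b, w b * A i b j) =
      fun i => ∑ b, w b • A i b := by
    ext i j
    simp only [Matrix.of_apply, Finset.sum_apply, Pi.smul_apply, smul_eq_mul]
  rw [hrows]
  refine (Matrix.detRowAlternating.toMultilinearMap.map_sum fun i b => w b • A i b).trans
    (sum_congr rfl fun ε _ => ?_)
  rw [MultilinearMap.map_smul_univ, smul_eq_mul]
  rfl

lemma sum_prod_mul_restrict {ι β R : Type*} [Fintype ι] [DecidableEq ι] [Fintype β]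
    [CommSemiring R] {w : β → R} (hw : ∑ b, w b = 1) (P : ι → Prop) [DecidablePred P]
    (G : ({i // P i} → β) → R) :
    ∑ ε : ι → β, (∏ i, w (ε i)) * G (fun i => ε i) =
      ∑ ε : {i // P i} → β, (∏ i, w (ε i)) * G ε := by
  have hmarginal : ∑ ε : {i // ¬P i} → β, ∏ i, w (ε i) = 1 := by
    simp only [← Fintype.prod_sum, hw, prod_const_one]
  calc ∑ ε : ι → β, (∏ i, w (ε i)) * G (fun i => ε i)
      = ∑ ε : ({i // P i} → β) × ({i // ¬P i} → β),
          (∏ i, w (ε.1 i)) * G ε.1 * ∏ i, w (ε.2 i) := by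
        refine Fintype.sum_equiv (Equiv.piEquivPiSubtypeProd P fun _ => β) _ _ fun ε => ?_
        rw [← Fintype.prod_subtype_mul_prod_subtype P]
        exact mul_right_comm _ _ _
    _ = ∑ ε : {i // P i} → β, (∏ i, w (ε i)) * G ε := by
        rw [Fintype.sum_prod_type]
        simp only [← mul_sum, hmarginal, mul_one]

variable {N h : ℕ} {p : ℝ}

section ExitMatrix

/-- The particles with index at most `h`. -/
abbrev LeadingParticle (N h : ℕ) : Type := {i : Fin N // (i : ℕ) ≤ h}

/-- The matrix of the determinantal formula for the probability that every leading particle `i`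
makes at least `L i` more jumps within its next `τ i` steps. -/
def exitMatrix (p : ℝ) (L τ : LeadingParticle N h → ℕ) :
    Matrix (LeadingParticle N h) (LeadingParticle N h) ℂ :=
  Matrix.of fun i j => -tasepIntegral p 0 (p / 2) (L i) ((j.1 : ℕ) - 1 - (i.1 : ℕ)) (τ j)

/-- The particles without remaining jumps. -/
def finished (L : LeadingParticle N h → ℕ) : Finset (LeadingParticle N h) :=
  univ.filter fun i => L i = 0

lemma mem_finished {L : LeadingParticle N h → ℕ} {i : LeadingParticle N h} :
    i ∈ finished L ↔ L i = 0 := by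
  simp only [finished, mem_filter, mem_univ, true_and]

lemma isLowerSet_finished {L : LeadingParticle N h → ℕ} (hL : Monotone L) :
    IsLowerSet (finished L : Set (LeadingParticle N h)) := fun i j hji hi => by
  have hLi := mem_finished.1 (mem_coe.1 hi)
  exact mem_coe.2 (mem_finished.2 (Nat.le_zero.1 (hLi ▸ hL hji)))

/-- The probability that a free particle jumps, or does not jump, in one step. -/
def freeWeight (p : ℝ) (b : Bool) : ℂ := if b then p else 1 - p

lemma sum_freeWeight (p : ℝ) : ∑ b, freeWeight p b = 1 := by
  simp only [freeWeight, Fintype.sum_bool, if_true, Bool.false_eq_true, if_false, add_sub_cancel]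

variable {L τ : LeadingParticle N h → ℕ} {i j k : LeadingParticle N h} (hp0 : 0 < p) (hp1 : p < 1)

include hp0 hp1

lemma exitMatrix_apply_of_eq_zero_of_lt (hi : L i = 0) (hij : i < j) :
    exitMatrix p L τ i j = 0 := by
  have hlt : (i.1 : ℕ) < j.1 := hij
  obtain ⟨d, hd⟩ := Nat.exists_eq_add_of_lt hlt
  have hzero := tasepIntegral_origin_zero_natCast hp0 hp1 d (τ j)
  rw [exitMatrix, Matrix.of_apply, hi, hd, Nat.cast_zero,
    show ((((i.1 : ℕ) + d + 1 : ℕ) : ℤ) - 1 - (i.1 : ℕ)) = d by push_cast; ring, hzero, neg_zero]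

lemma exitMatrix_apply_self_of_eq_zero (hi : L i = 0) : exitMatrix p L τ i i = 1 := by
  rw [exitMatrix, Matrix.of_apply, hi, sub_right_comm, sub_self, zero_sub, Nat.cast_zero,
    tasepIntegral_origin_zero_neg_one hp0 hp1, neg_neg]

lemma exitMatrix_apply_eq_zero_of_time_eq_zero (hj : τ j = 0) (hij : (j.1 : ℕ) < i.1 + L i) :
    exitMatrix p L τ i j = 0 := by
  rw [exitMatrix, Matrix.of_apply, hj, tasepIntegral_origin_eq_zero hp0 hp1 (by lia), neg_zero]

lemma det_unitRows_exitMatrix {S : Finset (LeadingParticle N h)}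
    (hS : IsLowerSet (S : Set (LeadingParticle N h))) (hL : ∀ i ∈ S, L i = 0) :
    (unitRows S (exitMatrix p L τ)).det = (exitMatrix p L τ).det :=
  det_unitRows_of_isLowerSet hS
    (fun i hi => exitMatrix_apply_self_of_eq_zero hp0 hp1 (hL i hi))
    fun i hi _ hij => exitMatrix_apply_of_eq_zero_of_lt hp0 hp1 (hL i hi) hij

lemma det_exitMatrix_eq_one (hL : ∀ i, L i = 0) : (exitMatrix p L τ).det = 1 := by
  have hone : unitRows univ (exitMatrix p L τ) = 1 :=
    Matrix.ext fun i j => unitRows_apply_of_mem _ (mem_univ i) j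
  have huniv : IsLowerSet ((univ : Finset (LeadingParticle N h)) : Set (LeadingParticle N h)) := by
    simp only [coe_univ, isLowerSet_univ]
  rw [← det_unitRows_exitMatrix hp0 hp1 huniv fun i _ => hL i, hone, Matrix.det_one]

lemma det_exitMatrix_eq_zero (hL : Monotone L) (hτ : Monotone τ) (hτk : τ k = 0) (hLk : L k ≠ 0) :
    (exitMatrix p L τ).det = 0 := by
  obtain ⟨k₀, hk₀, hmin⟩ := wellFounded_lt.has_min {i | L i ≠ 0} ⟨k, hLk⟩
  have hτk₀ : τ k₀ = 0 := Nat.le_zero.1 (hτk ▸ hτ (not_lt.1 (hmin k hLk)))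
  rw [← det_unitRows_exitMatrix hp0 hp1 (isLowerSet_finished hL) fun i hi => mem_finished.1 hi]
  refine Matrix.det_eq_zero_of_column_eq_zero k₀ fun i => ?_
  by_cases hi : i ∈ finished L
  · rw [unitRows_apply_of_mem _ hi, Matrix.one_apply_ne]
    rintro rfl
    exact hk₀ (mem_finished.1 hi)
  · have hLi : L i ≠ 0 := fun h0 => hi (mem_finished.2 h0)
    have hk₀i : (k₀.1 : ℕ) ≤ i.1 := not_lt.1 (hmin i hLi)
    rw [unitRows_apply_of_notMem _ hi,
      exitMatrix_apply_eq_zero_of_time_eq_zero hp0 hp1 hτk₀ (by lia)]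

lemma exitMatrix_apply_eq_sum_freeWeight (hL : Monotone L) (hτ : ∀ i, τ i = 0 → L i = 0)
    (hi : L i ≠ 0) (j : LeadingParticle N h) :
    exitMatrix p L τ i j = ∑ b : Bool, freeWeight p b *
      -tasepIntegral p 0 (p / 2) (L i - if b then 1 else 0 : ℕ) ((j.1 : ℕ) - 1 - (i.1 : ℕ))
        (τ j - 1 : ℕ) := by
  obtain ⟨l, hl⟩ := Nat.exists_eq_succ_of_ne_zero hi
  simp only [Fintype.sum_bool, freeWeight, if_true, Bool.false_eq_true, if_false, Nat.sub_zero,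
    hl, Nat.succ_eq_add_one, Nat.add_sub_cancel]
  rcases hτj : τ j with _ | t
  · have hji : (j.1 : ℕ) < i.1 := lt_of_not_ge fun hle => by
      have := hL (show i ≤ j from hle)
      have := hτ j hτj
      lia
    rw [exitMatrix_apply_eq_zero_of_time_eq_zero hp0 hp1 hτj (by lia),
      tasepIntegral_origin_eq_zero hp0 hp1 (by lia), tasepIntegral_origin_eq_zero hp0 hp1 (by lia)]
    ring
  · have hstep := (isRegularCircle_origin hp0 hp1).tasepIntegral_succ (l + 1)
      ((j.1 : ℕ) - 1 - (i.1 : ℕ)) t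
    rw [add_sub_cancel_right] at hstep
    rw [exitMatrix, Matrix.of_apply, hl, hτj, Nat.succ_eq_add_one, Nat.add_sub_cancel]
    push_cast
    rw [hstep]
    ring

lemma det_exitMatrix_eq_sum_freeWeight (hL : Monotone L) (hτ : ∀ i, τ i = 0 → L i = 0) :
    (exitMatrix p L τ).det = ∑ ε : LeadingParticle N h → Bool, (∏ i, freeWeight p (ε i)) *
      (unitRows (finished L)
        (exitMatrix p (fun i => L i - if ε i then 1 else 0) fun i => τ i - 1)).det := by
  rw [← det_unitRows_exitMatrix hp0 hp1 (isLowerSet_finished hL) fun i hi => mem_finished.1 hi]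
  have hrow : unitRows (finished L) (exitMatrix p L τ) = Matrix.of fun i j => ∑ b : Bool,
      freeWeight p b * if i ∈ finished L then
          (1 : Matrix (LeadingParticle N h) (LeadingParticle N h) ℂ) i j else
        -tasepIntegral p 0 (p / 2) (L i - if b then 1 else 0 : ℕ) ((j.1 : ℕ) - 1 - (i.1 : ℕ))
          (τ j - 1 : ℕ) := by
    ext i j
    by_cases hi : i ∈ finished L
    · simp only [unitRows_apply_of_mem _ hi, Matrix.of_apply, hi, if_true, ← sum_mul,
        sum_freeWeight, one_mul]
    · simp only [unitRows_apply_of_notMem _ hi, Matrix.of_apply, hi, if_false]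
      exact exitMatrix_apply_eq_sum_freeWeight hp0 hp1 hL hτ (fun h0 => hi (mem_finished.2 h0)) j
  rw [hrow, det_sum_mul_row (freeWeight p)]
  rfl

lemma det_unitRows_exitMatrix_update_sub_one {S : Finset (LeadingParticle N h)}
    (hjk : (j.1 : ℕ) + 1 = k.1) (hj : j ∉ S) (hk : k ∉ S) (hL : L j = L k) (hLk : L k ≠ 0) :
    (unitRows S (exitMatrix p (Function.update L k (L k - 1)) τ)).det =
      (unitRows S (exitMatrix p L τ)).det := by
  have hne : k ≠ j := by
    rintro rfl
    lia
  rw [← Matrix.det_updateRow_add_smul_self (unitRows S (exitMatrix p L τ)) hne (-1)]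
  congr 1
  ext i l
  by_cases hi : i = k
  · obtain ⟨M, hM⟩ := Nat.exists_eq_succ_of_ne_zero hLk
    have hpred := (isRegularCircle_origin hp0 hp1).tasepIntegral_pred (M + 1)
      ((l.1 : ℕ) - 1 - (k.1 : ℕ)) (τ l)
    rw [add_sub_cancel_right] at hpred
    rw [hi, Matrix.updateRow_self, unitRows_apply_of_notMem _ hk, Pi.add_apply, Pi.smul_apply,
      unitRows_apply_of_notMem _ hk, unitRows_apply_of_notMem _ hj]
    simp only [exitMatrix, Matrix.of_apply, Function.update_self, hL, hM, Nat.succ_eq_add_one,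
      Nat.add_sub_cancel, smul_eq_mul]
    push_cast
    rw [hpred, show ((l.1 : ℕ) : ℤ) - 1 - (j.1 : ℕ) = (l.1 : ℕ) - 1 - (k.1 : ℕ) + 1 by lia]
    ring
  · rw [Matrix.updateRow_ne hi]
    simp only [unitRows, exitMatrix, Matrix.of_apply, Function.update_of_ne hi]

end ExitMatrix

section Moves

/-- The configuration after the particles `i` with `ε i` have jumped. -/
def jumpTo (c : Fin N → ℤ) (ε : Fin N → Bool) : Fin N → ℤ := fun i => c i + if ε i then 1 else 0

/-- Particle `i` is blocked, given the jumps `ε` of the particles ahead of it. -/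
def IsBlocked (c : Fin N → ℤ) (ε : Fin N → Bool) (i : Fin N) : Prop :=
  ∃ j : Fin N, (j : ℕ) + 1 = i ∧ jumpTo c ε j - c i = 1

open Classical in
/-- The probability of the move of particle `i`, given the moves of the particles ahead of it. -/
def moveWeight (p : ℝ) (c : Fin N → ℤ) (ε : Fin N → Bool) (i : Fin N) : ℂ :=
  if IsBlocked c ε i then (if ε i then 0 else 1) else freeWeight p (ε i)

variable {c : Fin N → ℤ} {ε : Fin N → Bool} {i k : Fin N}

lemma isBlocked_update_iff (hik : i ≤ k) (b : Bool) :
    IsBlocked c (Function.update ε k b) i ↔ IsBlocked c ε i := by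
  refine exists_congr fun j => and_congr_right fun hj => ?_
  have hjk : j ≠ k := by
    rintro rfl
    exact absurd (Fin.le_def.1 hik) (by lia)
  rw [jumpTo, jumpTo, Function.update_of_ne hjk]

lemma moveWeight_of_isBlocked (hb : IsBlocked c ε i) :
    moveWeight p c ε i = if ε i then 0 else 1 :=
  if_pos hb

lemma moveWeight_of_not_isBlocked (hb : ¬IsBlocked c ε i) :
    moveWeight p c ε i = freeWeight p (ε i) :=
  if_neg hb

lemma moveWeight_update_of_lt (hik : i < k) (b : Bool) :
    moveWeight p c (Function.update ε k b) i = moveWeight p c ε i := by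
  have hiff : IsBlocked c (Function.update ε k b) i ↔ IsBlocked c ε i :=
    isBlocked_update_iff hik.le b
  by_cases hb : IsBlocked c ε i
  · rw [moveWeight_of_isBlocked hb, moveWeight_of_isBlocked (hiff.2 hb),
      Function.update_of_ne hik.ne]
  · rw [moveWeight_of_not_isBlocked hb, moveWeight_of_not_isBlocked (mt hiff.1 hb),
      Function.update_of_ne hik.ne]

/-- The weight of the moves `ε` when the first `k` particles follow the exclusion rule and the
others are free. -/
def hybridWeight (p : ℝ) (c : Fin N → ℤ) (k : ℕ) (ε : Fin N → Bool) (i : Fin N) : ℂ :=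
  if (i : ℕ) < k then moveWeight p c ε i else freeWeight p (ε i)

lemma hybridWeight_update_of_ne (hik : i ≠ k) (b : Bool) :
    hybridWeight p c k (Function.update ε k b) i = hybridWeight p c k ε i := by
  unfold hybridWeight
  split_ifs with hlt
  · exact moveWeight_update_of_lt hlt b
  · rw [Function.update_of_ne hik]

lemma sum_eq_zero_of_add_update_not {ι M : Type*} [Fintype ι] [DecidableEq ι] [AddCommMonoid M]
    (k : ι) {F : (ι → Bool) → M} (hF : ∀ ε, F ε + F (Function.update ε k (!ε k)) = 0) :
    ∑ ε, F ε = 0 := by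
  refine sum_involution (fun ε _ => Function.update ε k (!ε k)) (fun ε _ => hF ε)
    (fun ε _ _ heq => ?_) (fun _ _ => mem_univ _) fun ε _ => ?_
  · have hk := congrFun heq k
    rw [Function.update_self] at hk
    exact Bool.not_ne_self _ hk
  · rw [Function.update_idem, Function.update_self, Bool.not_not, Function.update_eq_self]

lemma prod_hybridWeight_succ_sub (ε : Fin N → Bool) (k : Fin N) :
    ∏ i, hybridWeight p c (k + 1) ε i - ∏ i, hybridWeight p c k ε i =
      (moveWeight p c ε k - freeWeight p (ε k)) * ∏ i ∈ univ.erase k, hybridWeight p c k ε i := by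
  have hrest : ∏ i ∈ univ.erase k, hybridWeight p c (k + 1) ε i =
      ∏ i ∈ univ.erase k, hybridWeight p c k ε i := by
    refine prod_congr rfl fun i hi => if_congr ?_ rfl rfl
    have hik : (i : ℕ) ≠ k := fun heq => ne_of_mem_erase hi (Fin.ext heq)
    lia
  rw [← mul_prod_erase univ _ (mem_univ k),
    ← mul_prod_erase univ (hybridWeight p c k ε) (mem_univ k), hrest, ← sub_mul]
  simp only [hybridWeight, Nat.lt_succ_self, if_true, lt_irrefl, if_false]

/-- The rule for a blocked particle and that for a free one give each move of the particle a
different weight but the same total, so they agree on functions which do not see this move. -/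
lemma sum_prod_hybridWeight_succ {G : (Fin N → Bool) → ℂ}
    (hG : ∀ ε, IsBlocked c ε k → ∀ b, G (Function.update ε k b) = G ε) :
    ∑ ε, (∏ i, hybridWeight p c (k + 1) ε i) * G ε = ∑ ε, (∏ i, hybridWeight p c k ε i) * G ε := by
  rw [← sub_eq_zero, ← sum_sub_distrib]
  simp only [← sub_mul, prod_hybridWeight_succ_sub]
  refine sum_eq_zero_of_add_update_not k fun ε => ?_
  have hrest : ∏ i ∈ univ.erase k, hybridWeight p c k (Function.update ε k (!ε k)) i =
      ∏ i ∈ univ.erase k, hybridWeight p c k ε i :=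
    prod_congr rfl fun i hi => hybridWeight_update_of_ne (ne_of_mem_erase hi) _
  rw [hrest]
  have hiff : IsBlocked c (Function.update ε k (!ε k)) k ↔ IsBlocked c ε k :=
    isBlocked_update_iff le_rfl _
  by_cases hb : IsBlocked c ε k
  · rw [hG ε hb, moveWeight_of_isBlocked hb, moveWeight_of_isBlocked (hiff.2 hb),
      Function.update_self]
    cases ε k <;>
      simp only [freeWeight, Bool.not_true, Bool.not_false, Bool.false_eq_true, if_true,
        if_false] <;> ring
  · rw [moveWeight_of_not_isBlocked hb, moveWeight_of_not_isBlocked (mt hiff.1 hb)]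
    ring

lemma sum_prod_moveWeight_eq_sum_prod_freeWeight (p : ℝ) {G : (Fin N → Bool) → ℂ}
    (hG : ∀ ε k, IsBlocked c ε k → ∀ b, G (Function.update ε k b) = G ε) :
    ∑ ε, (∏ i, moveWeight p c ε i) * G ε = ∑ ε, (∏ i, freeWeight p (ε i)) * G ε := by
  have hhybrid : ∀ k ≤ N, ∑ ε, (∏ i, hybridWeight p c k ε i) * G ε =
      ∑ ε, (∏ i, freeWeight p (ε i)) * G ε := by
    intro k hk
    induction k with
    | zero => simp only [hybridWeight, Nat.not_lt_zero, if_false]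
    | succ k ih =>
      exact (sum_prod_hybridWeight_succ (k := ⟨k, hk⟩) fun ε => hG ε _).trans (ih (by lia))
  simpa only [hybridWeight, Fin.is_lt, if_true] using hhybrid N le_rfl

end Moves

section BackwardEquation

lemma natCast_sub_natCast_le_config_sub (c : Config N) {i j : Fin N} (hij : i ≤ j) :
    ((j : ℕ) : ℤ) - (i : ℕ) ≤ c.1 i - c.1 j := by
  obtain ⟨d, hd⟩ := Nat.exists_eq_add_of_le (Fin.le_def.1 hij)
  induction d generalizing j with
  | zero => rw [Fin.ext hd, sub_self, sub_self]
  | succ d ih =>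
    have hlt : (i : ℕ) + d < N := by
      have := j.2
      lia
    have hgap := ih (j := ⟨i + d, hlt⟩) (Nat.le_add_right _ _) rfl
    have hanti : c.1 j < c.1 ⟨i + d, hlt⟩ := c.2 (Fin.lt_def.2 (by lia))
    rw [hd]
    push_cast at hgap ⊢
    linarith

/-- The number of jumps after which particle `i` has reached the site `D - i`. -/
def remainingJumps (D : ℤ) (c : Fin N → ℤ) (i : LeadingParticle N h) : ℕ :=
  (D - (i.1 : ℕ) - c i.1).toNat

lemma remainingJumps_eq_zero_iff {D : ℤ} {c : Fin N → ℤ} {i : LeadingParticle N h} :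
    remainingJumps D c i = 0 ↔ D - (i.1 : ℕ) ≤ c i.1 := by
  rw [remainingJumps, Int.toNat_eq_zero, sub_nonpos]

lemma monotone_remainingJumps (D : ℤ) (c : Config N) :
    Monotone (remainingJumps D c.1 : LeadingParticle N h → ℕ) := fun i j hij => by
  have hgap := natCast_sub_natCast_le_config_sub c (show i.1 ≤ j.1 from hij)
  exact Int.toNat_le_toNat (by lia)

lemma remainingJumps_jumpTo (D : ℤ) (c : Fin N → ℤ) (ε : Fin N → Bool) :
    (remainingJumps D (jumpTo c ε) : LeadingParticle N h → ℕ) =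
      fun i => remainingJumps D c i - if ε i.1 then 1 else 0 := by
  ext i
  simp only [remainingJumps, jumpTo]
  split_ifs <;> lia

lemma eq_add_one_and_not_of_isBlocked {c : Config N} {ε : Fin N → Bool} {j k : Fin N}
    (hjk : (j : ℕ) + 1 = k) (hb : jumpTo c.1 ε j - c.1 k = 1) :
    c.1 j = c.1 k + 1 ∧ ε j = false := by
  have hlt : c.1 k < c.1 j := c.2 (Fin.lt_def.2 (by lia))
  cases hε : ε j <;>
    simp only [jumpTo, hε, if_true, Bool.false_eq_true, if_false] at hb
  · exact ⟨by lia, rfl⟩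
  · lia

lemma sub_ite_update_true (L : LeadingParticle N h → ℕ) (ε : Fin N → Bool)
    (k : LeadingParticle N h) :
    (fun i => L i - if Function.update ε k.1 true i.1 then 1 else 0) =
      Function.update (fun i => L i - if Function.update ε k.1 false i.1 then 1 else 0) k
        ((L k - if Function.update ε k.1 false k.1 then 1 else 0) - 1) := by
  ext i
  by_cases hi : i = k
  · simp only [hi, Function.update_self, if_true, Bool.false_eq_true, if_false, Nat.sub_zero]
  · have hik : i.1 ≠ k.1 := fun heq => hi (Subtype.ext heq)
    simp only [Function.update_of_ne hi, Function.update_of_ne hik]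

variable (hp0 : 0 < p) (hp1 : p < 1)

include hp0 hp1

lemma det_unitRows_exitMatrix_update_of_isBlocked (D : ℤ) (c : Config N) {ε : Fin N → Bool}
    {k : Fin N} (hb : IsBlocked c.1 ε k) (τ : LeadingParticle N h → ℕ) :
    (unitRows (finished (remainingJumps D c.1))
        (exitMatrix p (remainingJumps D (jumpTo c.1 (Function.update ε k true))) τ)).det =
      (unitRows (finished (remainingJumps D c.1))
        (exitMatrix p (remainingJumps D (jumpTo c.1 (Function.update ε k false))) τ)).det := by
  simp only [remainingJumps_jumpTo]
  set L : LeadingParticle N h → ℕ := remainingJumps D c.1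
  by_cases hk : ∃ hkh : (k : ℕ) ≤ h, L ⟨k, hkh⟩ ≠ 0
  · obtain ⟨hkh, hLk⟩ := hk
    obtain ⟨j, hjk, hcj⟩ := hb
    obtain ⟨hadj, hεj⟩ := eq_add_one_and_not_of_isBlocked hjk hcj
    have hL : L ⟨j, by lia⟩ = L ⟨k, hkh⟩ := by
      simp only [L, remainingJumps]
      lia
    have hjk' : j ≠ k := by
      rintro rfl
      lia
    set M : LeadingParticle N h → ℕ := fun i => L i - if Function.update ε k false i.1 then 1 else 0
      with hM
    have hMk : M ⟨k, hkh⟩ = L ⟨k, hkh⟩ := by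
      simp only [hM, Function.update_self, Bool.false_eq_true, if_false, Nat.sub_zero]
    have hMj : M ⟨j, by lia⟩ = L ⟨k, hkh⟩ := by
      simp only [hM, Function.update_of_ne hjk', hεj, hL, Bool.false_eq_true, if_false,
        Nat.sub_zero]
    rw [sub_ite_update_true L ε ⟨k, hkh⟩]
    exact det_unitRows_exitMatrix_update_sub_one hp0 hp1 hjk
      (fun hj => hLk (hL ▸ mem_finished.1 hj)) (fun hk => hLk (mem_finished.1 hk))
      (hMj.trans hMk.symm) fun hM0 => hLk (hMk.symm.trans hM0)
  · congr 3
    ext i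
    by_cases hik : i.1 = k
    · have hLi : L i = 0 := by_contra fun hne => hk ⟨hik ▸ i.2, by simpa only [← hik] using hne⟩
      simp only [hLi, Nat.zero_sub]
    · simp only [Function.update_of_ne hik]

lemma sum_prod_moveWeight_mul_det_exitMatrix (D : ℤ) (c : Config N) {τ : LeadingParticle N h → ℕ}
    (hτ : ∀ i, τ i = 0 → remainingJumps D c.1 i = 0) :
    ∑ ε : Fin N → Bool, (∏ i, moveWeight p c.1 ε i) *
        (exitMatrix p (remainingJumps D (jumpTo c.1 ε)) fun i => τ i - 1).det =
      (exitMatrix p (remainingJumps D c.1) τ).det := by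
  have hmono := monotone_remainingJumps (h := h) D c
  have hunit : ∀ ε : Fin N → Bool,
      (exitMatrix p (remainingJumps D (jumpTo c.1 ε)) fun i => τ i - 1).det =
        (unitRows (finished (remainingJumps D c.1))
          (exitMatrix p (remainingJumps D (jumpTo c.1 ε)) fun i => τ i - 1)).det := by
    refine fun ε =>
      (det_unitRows_exitMatrix hp0 hp1 (isLowerSet_finished hmono) fun i hi => ?_).symm
    simp only [remainingJumps_jumpTo, mem_finished.1 hi, Nat.zero_sub]
  simp only [hunit]
  rw [sum_prod_moveWeight_eq_sum_prod_freeWeight p]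
  · simp only [remainingJumps_jumpTo]
    rw [det_exitMatrix_eq_sum_freeWeight hp0 hp1 hmono hτ]
    exact sum_prod_mul_restrict (sum_freeWeight p) (fun i : Fin N => (i : ℕ) ≤ h) fun ε =>
      (unitRows (finished (remainingJumps D c.1)) (exitMatrix p
        (fun i => remainingJumps D c.1 i - if ε i then 1 else 0) fun i => τ i - 1)).det
  · intro ε k hb
    set G : (Fin N → Bool) → ℂ := fun ε => (unitRows (finished (remainingJumps D c.1))
      (exitMatrix p (remainingJumps D (jumpTo c.1 ε)) fun i => τ i - 1)).det
    have hswap : ∀ b, G (Function.update ε k b) = G (Function.update ε k false) :=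
      Bool.forall_bool.2 ⟨rfl, det_unitRows_exitMatrix_update_of_isBlocked hp0 hp1 D c hb _⟩
    exact fun b => by
      simpa only [Function.update_eq_self] using (hswap b).trans (hswap (ε k)).symm

end BackwardEquation

end ExitDeterminant

section Markov

open Finset

variable {p : ℝ} {N h : ℕ}

lemma exists_jumpTo_of_stepProb_ne_zero {y d : Config N} (hne : stepProb p d y ≠ 0) :
    ∃ ε : Fin N → Bool, d.1 = jumpTo y.1 ε := by
  refine ⟨fun i => decide (d.1 i - y.1 i = 1), funext fun i => ?_⟩
  have hfactor := prod_ne_zero_iff.1 hne i (mem_univ i)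
  by_cases hjump : d.1 i - y.1 i = 1
  · simp only [jumpTo, hjump, decide_true, if_true]
    lia
  by_cases hstay : d.1 i - y.1 i = 0
  · simp only [jumpTo, hstay, zero_ne_one, decide_false, Bool.false_eq_true, if_false]
    lia
  · simp only [hjump, hstay, if_false, mul_zero, add_zero, ne_eq, not_true_eq_false] at hfactor

lemma jumpTo_injective (c : Fin N → ℤ) : Function.Injective (jumpTo c) := fun ε ε' heq => by
  ext i
  have hi := congrFun heq i
  cases hε : ε i <;> cases hε' : ε' i <;> simp [jumpTo, hε, hε'] at hi ⊢

lemma strictAnti_jumpTo {y : Config N} {ε : Fin N → Bool}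
    (hne : ∏ i, moveWeight p y.1 ε i ≠ 0) : StrictAnti (jumpTo y.1 ε) := by
  intro i j hij
  have := Fin.lt_def.1 hij
  have hgap := natCast_sub_natCast_le_config_sub y hij.le
  by_contra hle
  have hcollide : (i : ℕ) + 1 = j ∧ ε j = true ∧ jumpTo y.1 ε i - y.1 j = 1 := by
    cases hεi : ε i <;> cases hεj : ε j <;>
      simp only [jumpTo, hεi, hεj, if_true, Bool.false_eq_true, if_false] at hle ⊢ <;> lia
  obtain ⟨hadj, hεj, hij1⟩ := hcollide
  refine prod_ne_zero_iff.1 hne j (mem_univ j) ?_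
  rw [moveWeight_of_isBlocked ⟨i, hadj, hij1⟩, hεj, if_pos rfl]

lemma stepProb_of_eq_jumpTo {y d : Config N} {ε : Fin N → Bool} (hd : d.1 = jumpTo y.1 ε) :
    (stepProb p d y : ℂ) = ∏ i, moveWeight p y.1 ε i := by
  rw [stepProb, Complex.ofReal_prod]
  refine prod_congr rfl fun i _ => ?_
  have hblocked : (∃ j : Fin N, (j : ℕ) + 1 = i ∧ d.1 j - y.1 i = 1) ↔ IsBlocked y.1 ε i := by
    rw [hd, IsBlocked]
  have hdi : d.1 i - y.1 i = if ε i then 1 else 0 := by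
    rw [hd, jumpTo, add_sub_cancel_left]
  by_cases hb : IsBlocked y.1 ε i
  · rw [moveWeight_of_isBlocked hb, if_pos (hblocked.2 hb), hdi]
    cases hε : ε i
    · simp
    · obtain ⟨j, hj, hdj⟩ := hblocked.2 hb
      have := d.2 (show j < i from Fin.lt_def.2 (by lia))
      simp only [hε, if_true] at hdi
      lia
  · rw [moveWeight_of_not_isBlocked hb, if_neg (mt hblocked.1 hb), hdi, freeWeight]
    cases ε i <;> simp

variable {Ω : Type*} {X : ℕ → Ω → Config N} {D : ℤ} {s : LeadingParticle N h → ℕ} {t : ℕ}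
  {c : ℕ → Config N}

/-- The event that the process follows the trajectory `c` up to time `t`. -/
def trajectoryEvent (X : ℕ → Ω → Config N) (t : ℕ) (c : ℕ → Config N) : Set Ω :=
  {ω | ∀ s ≤ t, X s ω = c s}

/-- The event that every leading particle `k` with `t ≤ s k` has reached the site `D - k` by the
time `s k`. -/
def arrivalEvent (X : ℕ → Ω → Config N) (D : ℤ) (s : LeadingParticle N h → ℕ) (t : ℕ) : Set Ω :=
  {ω | ∀ k, t ≤ s k → remainingJumps D (X (s k) ω).1 k = 0}

lemma trajectoryEvent_succ_update (d : Config N) :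
    trajectoryEvent X (t + 1) (Function.update c (t + 1) d) =
      trajectoryEvent X t c ∩ {ω | X (t + 1) ω = d} := by
  ext ω
  constructor
  · intro hω
    refine ⟨fun u hu => ?_, ?_⟩
    · rw [hω u (by lia), Function.update_of_ne (by lia)]
    · exact (hω (t + 1) le_rfl).trans (Function.update_self _ _ _)
  · rintro ⟨hω, hd⟩ u hu
    rcases hu.lt_or_eq with hlt | rfl
    · rw [Function.update_of_ne hlt.ne, hω u (by lia)]
    · rw [Function.update_self, hd]

lemma trajectoryEvent_inter_arrivalEvent_eq_empty {k : LeadingParticle N h} (hk : s k = t)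
    (hck : remainingJumps D (c t).1 k ≠ 0) :
    trajectoryEvent X t c ∩ arrivalEvent X D s t = ∅ := by
  refine Set.eq_empty_of_forall_notMem fun ω hω => hck ?_
  rw [← hω.1 t le_rfl, ← hk]
  exact hω.2 k hk.ge

lemma trajectoryEvent_inter_arrivalEvent_succ
    (hdone : ∀ k, s k ≤ t → remainingJumps D (c t).1 k = 0) :
    trajectoryEvent X t c ∩ arrivalEvent X D s t =
      trajectoryEvent X t c ∩ arrivalEvent X D s (t + 1) := by
  ext ω
  refine and_congr_right fun htraj => ⟨fun harr k hk => harr k (by lia), fun harr k hk => ?_⟩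
  rcases hk.lt_or_eq with hlt | heq
  · exact harr k hlt
  · rw [← heq, htraj t le_rfl]
    exact hdone k heq.ge

variable [MeasurableSpace Ω] {μ : Measure Ω}

namespace IsStepTASEP

lemma measurableSet_trajectoryEvent (hX : IsStepTASEP μ N p X) (t : ℕ) (c : ℕ → Config N) :
    MeasurableSet (trajectoryEvent X t c) := by
  have heq : trajectoryEvent X t c = ⋂ s, ⋂ _ : s ≤ t, X s ⁻¹' {c s} := by
    ext ω
    simp only [trajectoryEvent, Set.mem_ofPred_eq, Set.mem_iInter, Set.mem_preimage,
      Set.mem_singleton_iff]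
  rw [heq]
  exact .iInter fun s => .iInter fun _ => hX.measurable s (measurableSet_singleton _)

lemma measurableSet_arrivalEvent (hX : IsStepTASEP μ N p X) (D : ℤ)
    (s : LeadingParticle N h → ℕ) (t : ℕ) : MeasurableSet (arrivalEvent X D s t) := by
  have heq : arrivalEvent X D s t =
      ⋂ k, ⋂ _ : t ≤ s k, X (s k) ⁻¹' {d | remainingJumps D d.1 k = 0} := by
    ext ω
    simp only [arrivalEvent, Set.mem_ofPred_eq, Set.mem_iInter, Set.mem_preimage]
  rw [heq]
  exact .iInter fun k => .iInter fun _ => hX.measurable _ (Set.to_countable _).measurableSet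

lemma real_trajectoryEvent_succ_update (hX : IsStepTASEP μ N p X) (t : ℕ) (c : ℕ → Config N)
    (d : Config N) :
    μ.real (trajectoryEvent X (t + 1) (Function.update c (t + 1) d)) =
      μ.real (trajectoryEvent X t c) * stepProb p d (c t) := by
  have hprod : ∏ s ∈ range t, stepProb p (Function.update c (t + 1) d (s + 1))
      (Function.update c (t + 1) d s) = ∏ s ∈ range t, stepProb p (c (s + 1)) (c s) := by
    refine prod_congr rfl fun s hs => ?_
    have hst := mem_range.1 hs
    rw [Function.update_of_ne (by lia), Function.update_of_ne (by lia)]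
  rw [trajectoryEvent, trajectoryEvent, hX.trajectory, hX.trajectory, prod_range_succ, hprod,
    Function.update_self, Function.update_of_ne (by lia), Function.update_of_ne (by lia), mul_assoc]

lemma real_trajectoryEvent_zero (hX : IsStepTASEP μ N p X) :
    μ.real (trajectoryEvent X 0 fun _ => stepConfig N) = 1 := by
  rw [trajectoryEvent, hX.trajectory, if_pos rfl, range_zero, prod_empty, one_mul]

lemma real_trajectoryEvent_inter_jumpTo (hX : IsStepTASEP μ N p X) {E : Set Ω}
    {ε : Fin N → Bool} {g : ℂ}
    (hg : ∀ d : Config N, d.1 = jumpTo (c t).1 ε →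
      (μ.real (trajectoryEvent X (t + 1) (Function.update c (t + 1) d) ∩ E) : ℂ) =
        μ.real (trajectoryEvent X (t + 1) (Function.update c (t + 1) d)) * g) :
    (μ.real (trajectoryEvent X t c ∩ E ∩ {ω | (X (t + 1) ω).1 = jumpTo (c t).1 ε}) : ℂ) =
      μ.real (trajectoryEvent X t c) * ((∏ i, moveWeight p (c t).1 ε i) * g) := by
  by_cases hε : StrictAnti (jumpTo (c t).1 ε)
  · have hevent : {ω | (X (t + 1) ω).1 = jumpTo (c t).1 ε} =
        {ω | X (t + 1) ω = ⟨jumpTo (c t).1 ε, hε⟩} :=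
      Set.ext fun ω => (Subtype.ext_iff (a2 := ⟨jumpTo (c t).1 ε, hε⟩)).symm
    rw [hevent, Set.inter_right_comm, ← trajectoryEvent_succ_update, hg _ rfl,
      hX.real_trajectoryEvent_succ_update, Complex.ofReal_mul, stepProb_of_eq_jumpTo rfl, mul_assoc]
  · have hempty : {ω | (X (t + 1) ω).1 = jumpTo (c t).1 ε} = ∅ :=
      Set.eq_empty_of_forall_notMem fun ω hω => hε (hω ▸ (X (t + 1) ω).2)
    rw [hempty, Set.inter_empty, measureReal_empty,
      by_contra fun hne => hε (strictAnti_jumpTo (p := p) hne)]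
    simp only [Complex.ofReal_zero, zero_mul, mul_zero]

variable [IsProbabilityMeasure μ]

lemma ae_eq_stepConfig (hX : IsStepTASEP μ N p X) : ∀ᵐ ω ∂μ, X 0 ω = stepConfig N := by
  have hone : μ (trajectoryEvent X 0 fun _ => stepConfig N) = 1 :=
    (ENNReal.toReal_eq_one_iff _).1 hX.real_trajectoryEvent_zero
  have hmeas := hX.measurableSet_trajectoryEvent 0 fun _ => stepConfig N
  filter_upwards [(mem_ae_iff_prob_eq_one hmeas).2 hone] with ω hω using hω 0 le_rfl

lemma ae_stepProb_ne_zero (hX : IsStepTASEP μ N p X) :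
    ∀ᵐ ω ∂μ, ∀ t, stepProb p (X (t + 1) ω) (X t ω) ≠ 0 := by
  refine ae_all_iff.2 fun t => ?_
  have htraj : ∀ᵐ ω ∂μ, ∀ c : Fin (t + 2) → Config N,
      stepProb p (c ⟨t + 1, by lia⟩) (c ⟨t, by lia⟩) = 0 → ¬∀ s : Fin (t + 2), X s ω = c s := by
    refine ae_all_iff.2 fun c => ?_
    by_cases hc : stepProb p (c ⟨t + 1, by lia⟩) (c ⟨t, by lia⟩) = 0
    · set c' : ℕ → Config N := fun s => if hs : s < t + 2 then c ⟨s, hs⟩ else stepConfig N with hc'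
      have hzero := hX.trajectory (t + 1) c'
      have hlast : stepProb p (c' (t + 1)) (c' t) = 0 := by
        simpa only [hc', dif_pos (Nat.lt_succ_self (t + 1)),
          dif_pos (Nat.lt_succ_of_lt (Nat.lt_succ_self t))] using hc
      rw [prod_range_succ, hlast, mul_zero, mul_zero, measureReal_eq_zero_iff] at hzero
      refine measure_mono_null (fun ω hω => ?_) hzero
      have hωc : ∀ s : Fin (t + 2), X s ω = c s := by simpa [hc] using hω
      intro s hs
      have hs' : s < t + 2 := by lia
      simpa only [hc', dif_pos hs'] using hωc ⟨s, hs'⟩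
    · exact .of_forall fun _ h0 => absurd h0 hc
  filter_upwards [htraj] with ω hω h0
  exact hω (fun s => X s ω) h0 fun s => rfl

lemma real_trajectoryEvent_inter_eq_sum (hX : IsStepTASEP μ N p X) {E : Set Ω}
    (hE : MeasurableSet E) (t : ℕ) (c : ℕ → Config N) :
    μ.real (trajectoryEvent X t c ∩ E) =
      ∑ ε, μ.real (trajectoryEvent X t c ∩ E ∩ {ω | (X (t + 1) ω).1 = jumpTo (c t).1 ε}) := by
  have hmeas : ∀ ε, MeasurableSet
      (trajectoryEvent X t c ∩ E ∩ {ω | (X (t + 1) ω).1 = jumpTo (c t).1 ε}) := fun ε =>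
    ((hX.measurableSet_trajectoryEvent t c).inter hE).inter <| hX.measurable (t + 1)
      (Set.to_countable {d : Config N | d.1 = jumpTo (c t).1 ε}).measurableSet
  have hdisj : Pairwise (Function.onFun Disjoint fun ε =>
      trajectoryEvent X t c ∩ E ∩ {ω | (X (t + 1) ω).1 = jumpTo (c t).1 ε}) := fun ε ε' hne =>
    Set.disjoint_left.2 fun ω h1 h2 => hne (jumpTo_injective _ (h1.2.symm.trans h2.2))
  rw [← measureReal_iUnion_fintype hdisj hmeas]
  refine measureReal_congr ?_
  filter_upwards [hX.ae_stepProb_ne_zero] with ω hω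
  refine propext ⟨fun hωE => ?_, fun hωE => ?_⟩
  · obtain ⟨ε, hε⟩ := exists_jumpTo_of_stepProb_ne_zero (hω t)
    have hωE' : ω ∈ trajectoryEvent X t c ∩ E := hωE
    rw [hωE'.1 t le_rfl] at hε
    exact Set.mem_iUnion.2 ⟨ε, hωE', hε⟩
  · obtain ⟨ε, hε⟩ := Set.mem_iUnion.1 hωE
    exact hε.1

lemma real_trajectoryEvent_inter_arrivalEvent (hX : IsStepTASEP μ N p X) (hp0 : 0 < p)
    (hp1 : p < 1) (D : ℤ) (hs : Monotone s) (n : ℕ) : ∀ (t : ℕ) (c : ℕ → Config N),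
    (∀ k, s k < t + n) → (∀ k, s k < t → remainingJumps D (c t).1 k = 0) →
    (μ.real (trajectoryEvent X t c ∩ arrivalEvent X D s t) : ℂ) =
      μ.real (trajectoryEvent X t c) *
        (exitMatrix p (remainingJumps D (c t).1) fun k => s k - t).det := by
  induction n with
  | zero =>
    intro t c hst hc
    have harrival : arrivalEvent X D s t = Set.univ :=
      Set.eq_univ_of_forall fun ω k hk => absurd (hst k) hk.not_gt
    rw [harrival, Set.inter_univ, det_exitMatrix_eq_one hp0 hp1 fun k => hc k (hst k), mul_one]
  | succ n ih =>
    intro t c hst hc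
    by_cases hlate : ∃ k, s k = t ∧ remainingJumps D (c t).1 k ≠ 0
    · obtain ⟨k, hk, hck⟩ := hlate
      rw [trajectoryEvent_inter_arrivalEvent_eq_empty hk hck, measureReal_empty,
        det_exitMatrix_eq_zero hp0 hp1 (monotone_remainingJumps D (c t))
          (fun i j hij => Nat.sub_le_sub_right (hs hij) t) (Nat.sub_eq_zero_of_le hk.le) hck,
        mul_zero, Complex.ofReal_zero]
    · push Not at hlate
      have hdone : ∀ k, s k ≤ t → remainingJumps D (c t).1 k = 0 := fun k hk =>
        hk.lt_or_eq.elim (hc k) (hlate k)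
      rw [trajectoryEvent_inter_arrivalEvent_succ hdone,
        hX.real_trajectoryEvent_inter_eq_sum (hX.measurableSet_arrivalEvent D s (t + 1)),
        Complex.ofReal_sum, ← sum_prod_moveWeight_mul_det_exitMatrix hp0 hp1 D (c t)
          fun k hk => hdone k (Nat.sub_eq_zero_iff_le.1 hk), mul_sum]
      refine sum_congr rfl fun ε _ => hX.real_trajectoryEvent_inter_jumpTo fun d hd => ?_
      rw [ih (t + 1) _ (fun k => by have := hst k; lia), Function.update_self, hd]
      · simp only [Nat.sub_sub]
      · intro k hk
        simp only [Function.update_self, hd, remainingJumps_jumpTo, hdone k (Nat.lt_succ_iff.1 hk),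
          Nat.zero_sub]

lemma real_forall_le_eq_det_exitMatrix (hX : IsStepTASEP μ N p X) (hp0 : 0 < p) (hp1 : p < 1)
    (D : ℤ) (hs : Monotone s) :
    (μ.real {ω | ∀ k, D - (k.1 : ℕ) ≤ (X (s k) ω).1 k.1} : ℂ) =
      (exitMatrix p (fun _ => D.toNat) s).det := by
  have hmain := hX.real_trajectoryEvent_inter_arrivalEvent hp0 hp1 D hs (univ.sup s + 1) 0
    (fun _ => stepConfig N) (fun k => by have := le_sup (f := s) (mem_univ k); lia)
    fun k hk => absurd hk (Nat.not_lt_zero _)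
  have hstart : remainingJumps D (stepConfig N).1 = fun _ : LeadingParticle N h => D.toNat := by
    ext k
    rw [remainingJumps, stepConfig, sub_neg_eq_add, sub_add_cancel]
  simp only [hstart, hX.real_trajectoryEvent_zero, Complex.ofReal_one, one_mul, Nat.sub_zero]
    at hmain
  rw [← hmain]
  congr 1
  refine measureReal_congr ?_
  filter_upwards [hX.ae_eq_stepConfig] with ω hω
  refine propext ⟨fun harr => ⟨fun u hu => ?_, fun k _ => ?_⟩, fun harr k => ?_⟩
  · rw [Nat.le_zero.1 hu, hω]
  · exact remainingJumps_eq_zero_iff.2 (harr k)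
  · exact remainingJumps_eq_zero_iff.1 (harr.2 k (Nat.zero_le _))

end IsStepTASEP

end Markov

section ExitTimes

variable {p : ℝ} {N : ℕ} {Ω : Type*} {X : ℕ → Ω → Config N} {ω : Ω} {x : ℤ}

lemma le_and_le_add_one_of_stepProb_ne_zero {y d : Config N} (hne : stepProb p d y ≠ 0)
    (i : Fin N) : y.1 i ≤ d.1 i ∧ d.1 i ≤ y.1 i + 1 := by
  obtain ⟨ε, hε⟩ := exists_jumpTo_of_stepProb_ne_zero hne
  rw [hε, jumpTo]
  split_ifs <;> lia

lemma jumpOffTime_le_iff_exists {i : Fin N} {y : ℤ} {b : ℕ} :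
    jumpOffTime X i y ω ≤ b ↔ ∃ t ≤ b, (X t ω).1 i = y ∧ (X (t + 1) ω).1 i = y + 1 := by
  constructor
  · intro hle
    obtain ⟨_, ⟨t, rfl, ht⟩, hlt⟩ := sInf_lt_iff.1 (hle.trans_lt (Nat.cast_lt.2 b.lt_succ_self))
    exact ⟨t, Nat.lt_succ_iff.1 (Nat.cast_lt.1 hlt), ht⟩
  · rintro ⟨t, htb, ht⟩
    have hle : jumpOffTime X i y ω ≤ t := csInf_le' ⟨t, rfl, ht⟩
    exact hle.trans (Nat.cast_le.2 htb)

section Path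

variable (hstart : X 0 ω = stepConfig N)
  (hstep : ∀ t, stepProb p (X (t + 1) ω) (X t ω) ≠ 0) (hx : 1 - (N : ℤ) ≤ x)

include hstart hstep hx

lemma jumpOffTime_le_iff (i : Fin N) (b : ℕ) :
    jumpOffTime X i (exitSite N x i) ω ≤ b ↔ x + N - (i : ℕ) ≤ (X (b + 1) ω).1 i := by
  have hmove := fun t => le_and_le_add_one_of_stepProb_ne_zero (hstep t) i
  rw [jumpOffTime_le_iff_exists]
  constructor
  · rintro ⟨t, htb, -, ht⟩
    have hmono : Monotone fun t => (X t ω).1 i := monotone_nat_of_le_succ fun t => (hmove t).1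
    have hle := hmono (Nat.succ_le_succ htb)
    simp only [exitSite, Nat.succ_eq_add_one] at ht hle
    lia
  · intro hb
    have hex : ∃ t, x + N - (i : ℕ) ≤ (X (t + 1) ω).1 i := ⟨b, hb⟩
    classical
    obtain ⟨t, ht, hmin⟩ := Nat.findX hex
    have hbefore : (X t ω).1 i < x + N - (i : ℕ) := by
      cases t with
      | zero =>
        rw [hstart, stepConfig]
        lia
      | succ t => exact not_le.1 (hmin t t.lt_succ_self)
    have hle := (hmove t).2
    exact ⟨t, not_lt.1 fun hbt => hmin b hbt hb, by unfold exitSite; lia, by unfold exitSite; lia⟩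

lemma monotone_jumpOffTime : Monotone fun i => jumpOffTime X i (exitSite N x i) ω := by
  intro i j hij
  dsimp only
  rcases eq_or_ne (jumpOffTime X j (exitSite N x j) ω) ⊤ with htop | htop
  · exact htop ▸ le_top
  · obtain ⟨b, hb⟩ := ENat.ne_top_iff_exists.1 htop
    have hj := (jumpOffTime_le_iff hstart hstep hx j b).1 hb.ge
    have hgap := natCast_sub_natCast_le_config_sub (X (b + 1) ω) hij
    rw [← hb]
    exact (jumpOffTime_le_iff hstart hstep hx i b).2 (by lia)

end Path

end ExitTimes

section JointDistribution

variable {p : ℝ} {N m h : ℕ} {n : Fin m → Fin N} {a : Fin m → ℝ} {b : ℕ → ℤ} {x : ℤ} {l t : ℕ}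

/-- Up to the level `h`, `b l` is the smallest of the integer parts of the time bounds at the levels
`n i ≥ l`. As the exit times increase with the label, these are the bounds on the exit times of all
leading particles which the bounds `a` amount to. -/
def IsRunningMin (n : Fin m → Fin N) (a : Fin m → ℝ) (h : ℕ) (b : ℕ → ℤ) : Prop :=
  ∀ l ≤ h, IsLeast ((fun i => ⌊a i⌋) '' {i | l ≤ (n i : ℕ)}) (b l)

lemma exists_isRunningMin (a : Fin m → ℝ) (hh : ∃ i, (n i : ℕ) = h) :
    ∃ b, IsRunningMin n a h b := by
  have hexists : ∀ l, ∃ k, l ≤ h → IsLeast ((fun i => ⌊a i⌋) '' {i | l ≤ (n i : ℕ)}) k := by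
    intro l
    by_cases hl : l ≤ h
    · obtain ⟨i, hi⟩ := hh
      obtain ⟨j, hj, hmin⟩ := Set.exists_min_image {i | l ≤ (n i : ℕ)} (fun i => ⌊a i⌋)
        (Set.toFinite _) ⟨i, hl.trans hi.ge⟩
      exact ⟨⌊a j⌋, fun _ => ⟨⟨j, hj, rfl⟩, Set.forall_mem_image.2 hmin⟩⟩
    · exact ⟨0, fun hlh => absurd hlh hl⟩
  choose b hb using hexists
  exact ⟨b, hb⟩

namespace IsRunningMin

lemma le_floor (hb : IsRunningMin n a h b) (hl : l ≤ h) {i : Fin m} (hi : l ≤ (n i : ℕ)) :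
    b l ≤ ⌊a i⌋ :=
  (hb l hl).2 ⟨i, hi, rfl⟩

lemma exists_eq_floor (hb : IsRunningMin n a h b) (hl : l ≤ h) :
    ∃ i, l ≤ (n i : ℕ) ∧ ⌊a i⌋ = b l :=
  (hb l hl).1

lemma le_of_le (hb : IsRunningMin n a h b) {l' : ℕ} (hll' : l ≤ l') (hl' : l' ≤ h) : b l ≤ b l' :=
  (hb l' hl').mono (hb l (hll'.trans hl')) (Set.image_mono fun _ hi => hll'.trans hi)

lemma nonneg (hb : IsRunningMin n a h b) (ha : ∀ i, 0 ≤ a i) (hl : l ≤ h) : 0 ≤ b l := by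
  obtain ⟨i, -, hbi⟩ := hb.exists_eq_floor hl
  exact hbi ▸ Int.floor_nonneg.2 (ha i)

lemma levelCut_eq_zero (hb : IsRunningMin n a h b) (hl : l ≤ h) (ht : t < (b l - x + 1).toNat) :
    levelCut x n a l t = 0 := by
  refine if_neg ?_
  rintro ⟨i, hi, hai⟩
  have hle := hb.le_floor hl hi.ge
  exact absurd (Int.le_floor.1 (show x + t ≤ ⌊a i⌋ by lia)) hai.not_ge

lemma one_sub_levelCut (hb : IsRunningMin n a h b) (hl : l ≤ h) {i : Fin m} (hi : (n i : ℕ) = l)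
    (hbi : ⌊a i⌋ = b l) (t : ℕ) :
    1 - levelCut x n a l t = if t < (b l - x + 1).toNat then 1 else 0 := by
  split_ifs with ht
  · rw [hb.levelCut_eq_zero hl ht, sub_zero]
  · have hone : levelCut x n a l t = 1 := if_pos ⟨i, hi, Int.floor_lt.1 (by lia)⟩
    rw [hone, sub_self]

lemma one_sub_levelCut_of_lt (hb : IsRunningMin n a h b) (hl : l < h)
    (ht : t < (b (l + 1) - x + 1).toNat) :
    1 - levelCut x n a l t = if t < (b l - x + 1).toNat then 1 else 0 := by
  obtain ⟨i, hi, hbi⟩ := hb.exists_eq_floor hl.le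
  rcases hi.eq_or_lt with heq | hlt
  · exact hb.one_sub_levelCut hl.le heq.symm hbi t
  · have hle := hb.le_floor hl hlt
    rw [if_pos (by lia), hb.levelCut_eq_zero hl.le (by lia), sub_zero]

lemma forall_le_floor_iff (hb : IsRunningMin n a h b) (hh : ∀ i, (n i : ℕ) ≤ h)
    {T : Fin N → ℕ∞} (hT : Monotone T) :
    (∀ i, T (n i) ≤ (⌊a i⌋₊ : ℕ)) ↔ ∀ k : LeadingParticle N h, T k.1 ≤ ((b k.1).toNat : ℕ) := by
  constructor
  · intro hTa k
    obtain ⟨i, hi, hbi⟩ := hb.exists_eq_floor k.2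
    rw [← hbi, Int.floor_toNat]
    exact (hT (Fin.le_def.2 hi)).trans (hTa i)
  · intro hTb i
    refine (hTb ⟨n i, hh i⟩).trans (Nat.cast_le.2 ?_)
    rw [← Int.floor_toNat]
    exact Int.toNat_le_toNat (hb.le_floor (hh i) le_rfl)

variable {r R : ℝ} (hp0 : 0 < p) (hp1 : p < 1) (hr0 : 0 < r) (hr1 : r < 1) (hR1 : 1 < R)
  (hR : R < 1 / (1 - p))

include hp0 hp1 hr0 hr1 hR1 hR

lemma fredholmDet_cutKernel_eq_det (hb : IsRunningMin n a h b) (x : ℤ) (hn : StrictMono n)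
    (hhN : h < N) (hh : ∀ i, (n i : ℕ) ≤ h) :
    fredholmDet (cutKernel p N x r R n a) = (Matrix.of fun i l : LeadingParticle N h =>
      -tasepIntegral p 0 (p / 2) (x + N) ((l.1 : ℕ) - 1 - (i.1 : ℕ)) (b l.1 + 1)).det := by
  have htop : ∀ t, 1 - levelCut x n a h t = if t < (b h - x + 1).toNat then 1 else 0 := by
    obtain ⟨i, hi, hbi⟩ := hb.exists_eq_floor le_rfl
    exact hb.one_sub_levelCut le_rfl ((hh i).antisymm hi) hbi
  rw [fredholmDet_cutKernel_eq_det_tasepIntegral hp0 hp1 hr0 hr1 hR1 hR N x hn a hhN hh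
    (B := fun l => (b l - x + 1).toNat)
    (fun l hl => Int.toNat_le_toNat (by have := hb.le_of_le l.le_succ hl; lia))
    (fun l hl t ht => hb.one_sub_levelCut_of_lt hl ht) htop]
  let e : Fin (h + 1) ≃ LeadingParticle N h :=
    { toFun := fun i => ⟨⟨i, i.2.trans_le hhN⟩, Nat.lt_succ_iff.1 i.2⟩
      invFun := fun i => ⟨i.1, Nat.lt_succ_iff.2 i.2⟩
      left_inv := fun i => rfl
      right_inv := fun i => rfl }
  rw [← Matrix.det_submatrix_equiv_self e]
  congr 1
  ext i l
  simp only [Matrix.of_apply, Matrix.submatrix_apply, e, Equiv.coe_fn_mk]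
  rcases le_total x (b l + 1) with hle | hle
  · rw [show x + ((b l - x + 1).toNat : ℤ) = b l + 1 by lia]
  · rw [tasepIntegral_origin_eq_zero hp0 hp1 (by lia),
      tasepIntegral_origin_eq_zero hp0 hp1 (by lia)]

lemma fredholmDet_cutKernel_eq_zero (hb : IsRunningMin n a h b) (hx : 1 - (N : ℤ) ≤ x)
    (hn : StrictMono n) (hhN : h < N) (hh : ∀ i, (n i : ℕ) ≤ h) {i : Fin m} (hi : a i < 0) :
    fredholmDet (cutKernel p N x r R n a) = 0 := by
  have hfloor : ⌊a i⌋ < 0 := Int.floor_lt.2 (by exact_mod_cast hi)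
  have hneg := hb.le_floor (Nat.zero_le h) (Nat.zero_le (n i))
  rw [hb.fredholmDet_cutKernel_eq_det hp0 hp1 hr0 hr1 hR1 hR x hn hhN hh]
  refine Matrix.det_eq_zero_of_column_eq_zero ⟨⟨0, h.zero_le.trans_lt hhN⟩, h.zero_le⟩ fun j => ?_
  rw [Matrix.of_apply, tasepIntegral_origin_eq_zero hp0 hp1, neg_zero]
  push_cast
  lia

lemma fredholmDet_cutKernel_eq_det_exitMatrix (hb : IsRunningMin n a h b) (ha : ∀ i, 0 ≤ a i)
    (hx : 1 - (N : ℤ) ≤ x) (hn : StrictMono n) (hhN : h < N) (hh : ∀ i, (n i : ℕ) ≤ h) :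
    fredholmDet (cutKernel p N x r R n a) = (exitMatrix p (fun _ => (x + N).toNat)
      fun k : LeadingParticle N h => (b k.1).toNat + 1).det := by
  rw [hb.fredholmDet_cutKernel_eq_det hp0 hp1 hr0 hr1 hR1 hR x hn hhN hh]
  congr 1
  ext i l
  have hbl := hb.nonneg ha l.2
  rw [exitMatrix, Matrix.of_apply, Matrix.of_apply, Nat.cast_add, Int.toNat_of_nonneg hbl,
    Int.toNat_of_nonneg (by lia), Nat.cast_one]

end IsRunningMin

lemma fredholmDet_eq_one_of_isEmpty {S : Type*} [IsEmpty S] (A : S → S → ℂ) :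
    fredholmDet A = 1 := by
  rw [fredholmDet, tsum_eq_single 0]
  · simp
  · intro k hk
    have : NeZero k := ⟨hk⟩
    simp

lemma exists_eq_natCast_and_le_iff {τ : ℕ∞} {y : ℝ} (hy : 0 ≤ y) :
    (∃ t : ℕ, τ = t ∧ (t : ℝ) ≤ y) ↔ τ ≤ (⌊y⌋₊ : ℕ) := by
  constructor
  · rintro ⟨t, rfl, ht⟩
    exact Nat.cast_le.2 (Nat.le_floor ht)
  · intro hτ
    obtain ⟨t, rfl⟩ := ENat.ne_top_iff_exists.1 (ne_top_of_le_ne_top (ENat.natCast_ne_top _) hτ)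
    exact ⟨t, rfl, (Nat.le_floor_iff hy).1 (Nat.cast_le.1 hτ)⟩

namespace IsStepTASEP

variable {Ω : Type*} [MeasurableSpace Ω] {μ : Measure Ω} [IsProbabilityMeasure μ]
  {X : ℕ → Ω → Config N} {r R : ℝ}

lemma real_jumpOffTime_le_eq_det_exitMatrix (hX : IsStepTASEP μ N p X) (hp0 : 0 < p) (hp1 : p < 1)
    (hx : 1 - (N : ℤ) ≤ x) (hb : IsRunningMin n a h b) (ha : ∀ i, 0 ≤ a i)
    (hh : ∀ i, (n i : ℕ) ≤ h) :
    (μ.real {ω | ∀ i, ∃ t : ℕ,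
        jumpOffTime X (n i) (exitSite N x (n i)) ω = t ∧ (t : ℝ) ≤ a i} : ℂ) =
      (exitMatrix p (fun _ => (x + N).toNat)
        fun k : LeadingParticle N h => (b k.1).toNat + 1).det := by
  have hmono : Monotone fun k : LeadingParticle N h => (b k.1).toNat + 1 := fun k k' hkk' =>
    Nat.succ_le_succ (Int.toNat_le_toNat (hb.le_of_le hkk' k'.2))
  rw [← hX.real_forall_le_eq_det_exitMatrix hp0 hp1 (x + N) hmono]
  congr 1
  refine measureReal_congr ?_
  filter_upwards [hX.ae_eq_stepConfig, hX.ae_stepProb_ne_zero] with ω hstart hstep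
  refine propext (Iff.trans ?_
    (forall_congr' fun k => jumpOffTime_le_iff hstart hstep hx k.1 (b k.1).toNat))
  exact (forall_congr' fun i => exists_eq_natCast_and_le_iff (ha i)).trans
    (hb.forall_le_floor_iff hh (monotone_jumpOffTime hstart hstep hx))

theorem real_jumpOffTime_le_eq_fredholmDet (hX : IsStepTASEP μ N p X) (hp0 : 0 < p) (hp1 : p < 1)
    (hx : 1 - (N : ℤ) ≤ x) (hn : StrictMono n) (a : Fin m → ℝ) (hr0 : 0 < r) (hr1 : r < 1)
    (hR1 : 1 < R) (hR : R < 1 / (1 - p)) :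
    (μ.real {ω | ∀ i, ∃ t : ℕ,
        jumpOffTime X (n i) (exitSite N x (n i)) ω = t ∧ (t : ℝ) ≤ a i} : ℂ) =
      fredholmDet (cutKernel p N x r R n a) := by
  rcases isEmpty_or_nonempty (Fin m) with hm | hm
  · simp only [IsEmpty.forall_iff, Set.ofPred_true, probReal_univ, Complex.ofReal_one,
      fredholmDet_eq_one_of_isEmpty]
  obtain ⟨last, hlast⟩ := Finite.exists_max n
  have hh : ∀ i, (n i : ℕ) ≤ n last := hlast
  obtain ⟨b, hb⟩ := exists_isRunningMin (n := n) a ⟨last, rfl⟩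
  by_cases ha : ∀ i, 0 ≤ a i
  · rw [hX.real_jumpOffTime_le_eq_det_exitMatrix hp0 hp1 hx hb ha hh,
      hb.fredholmDet_cutKernel_eq_det_exitMatrix hp0 hp1 hr0 hr1 hR1 hR ha hx hn (n last).2 hh]
  · obtain ⟨i, hi⟩ := not_forall.1 ha
    have hempty : {ω | ∀ i, ∃ t : ℕ,
        jumpOffTime X (n i) (exitSite N x (n i)) ω = t ∧ (t : ℝ) ≤ a i} = ∅ := by
      refine Set.eq_empty_of_forall_notMem fun ω hω => hi ?_
      obtain ⟨t, -, ht⟩ := hω i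
      exact t.cast_nonneg.trans ht
    rw [hempty, measureReal_empty, Complex.ofReal_zero, hb.fredholmDet_cutKernel_eq_zero hp0 hp1
      hr0 hr1 hR1 hR hx hn (n last).2 hh (not_le.1 hi)]

end IsStepTASEP

end JointDistribution

section Finiteness

open Filter Topology

variable {p : ℝ} {N m : ℕ} {n : Fin m → Fin N} {r R : ℝ} {x : ℤ}

lemma fredholmTerm_cutKernel_of_forall_lt {a a' : Fin m → ℝ} (ha : a ≤ a')
    {q : Σ k : ℕ, (Fin k → LevelTime m x)} (hq : ∀ i, a' (q.2 i).1 < ((q.2 i).2.1 : ℝ)) :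
    fredholmTerm (cutKernel p N x r R n a') q = fredholmTerm (cutKernel p N x r R n a) q := by
  have hcut' : ∀ i, cutoff a' (q.2 i) = 1 := fun i => if_pos (hq i)
  have hcut : ∀ i, cutoff a (q.2 i) = 1 := fun i => if_pos ((ha _).trans_lt (hq i))
  simp only [fredholmTerm, cutKernel, hcut', hcut]

lemma fredholmTerm_cutKernel_eq_zero {a : Fin m → ℝ} {q : Σ k : ℕ, (Fin k → LevelTime m x)}
    {i : Fin q.1} (hi : ((q.2 i).2.1 : ℝ) ≤ a (q.2 i).1) :
    fredholmTerm (cutKernel p N x r R n a) q = 0 := by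
  have hcut : cutoff a (q.2 i) = 0 := if_neg hi.not_gt
  rw [fredholmTerm, Matrix.det_eq_zero_of_row_eq_zero i, mul_zero]
  intro j
  simp only [Matrix.of_apply, cutKernel, hcut, zero_mul]

lemma norm_fredholmTerm_cutKernel_anti {a a' : Fin m → ℝ} (ha : a ≤ a')
    (q : Σ k : ℕ, (Fin k → LevelTime m x)) :
    ‖fredholmTerm (cutKernel p N x r R n a') q‖ ≤ ‖fredholmTerm (cutKernel p N x r R n a) q‖ := by
  by_cases! hq : ∀ i, a' (q.2 i).1 < ((q.2 i).2.1 : ℝ)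
  · rw [fredholmTerm_cutKernel_of_forall_lt ha hq]
  · obtain ⟨i, hi⟩ := hq
    rw [fredholmTerm_cutKernel_eq_zero hi, norm_zero]
    exact norm_nonneg _

lemma tendsto_fredholmTerm_cutKernel_natCast (q : Σ k : ℕ, (Fin k → LevelTime m x)) :
    Tendsto (fun A : ℕ => fredholmTerm (cutKernel p N x r R n fun _ => (A : ℝ)) q) atTop
      (𝓝 (if q.1 = 0 then 1 else 0)) := by
  obtain ⟨k, s⟩ := q
  rcases Nat.eq_zero_or_pos k with rfl | hk
  · refine tendsto_const_nhds.congr fun A => ?_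
    simp [fredholmTerm]
  · rw [if_neg hk.ne']
    refine tendsto_const_nhds.congr' ?_
    filter_upwards [eventually_ge_atTop (s ⟨0, hk⟩).2.1.toNat] with A hA
    have hle : (s ⟨0, hk⟩).2.1 ≤ (A : ℤ) := Int.toNat_le.1 hA
    exact (fredholmTerm_cutKernel_eq_zero (i := ⟨0, hk⟩) (by exact_mod_cast hle)).symm

lemma tsum_sigma_fin_pi_ite_eq_zero (S : Type*) :
    (∑' q : Σ k : ℕ, (Fin k → S), if q.1 = 0 then (1 : ℂ) else 0) = 1 := by
  rw [tsum_eq_single ⟨0, Fin.elim0⟩, if_pos rfl]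
  rintro ⟨k, s⟩ hq
  refine if_neg ?_
  rintro (rfl : k = 0)
  exact hq (congrArg _ (Subsingleton.elim _ _))

lemma tendsto_fredholmDet_cutKernel_natCast (hp0 : 0 < p) (hp1 : p < 1) (hr0 : 0 < r)
    (hr1 : r < 1) (hR1 : 1 < R) (hR : R < 1 / (1 - p)) (hn : StrictMono n) :
    Tendsto (fun A : ℕ => fredholmDet (cutKernel p N x r R n fun _ => (A : ℝ))) atTop (𝓝 1) := by
  have hsum : ∀ a, FredholmSummable (cutKernel p N x r R n a) :=
    cutKernel_fredholmSummable hp0 hp1 hr0 hr1 hR1 hR N x hn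
  rw [← tsum_sigma_fin_pi_ite_eq_zero (LevelTime m x)]
  simp_rw [fun A : ℕ => fredholmDet_eq_tsum (hsum fun _ => (A : ℝ))]
  exact tendsto_tsum_of_dominated_convergence (hsum fun _ => 0)
    tendsto_fredholmTerm_cutKernel_natCast
    (.of_forall fun A => norm_fredholmTerm_cutKernel_anti fun _ => Nat.cast_nonneg A)

variable {Ω : Type*} [MeasurableSpace Ω] {μ : Measure Ω} [IsProbabilityMeasure μ]
  {X : ℕ → Ω → Config N}

lemma ae_mem_iUnion_of_tendsto_measureReal {M : ℕ → Set Ω} (hM : ∀ A, MeasurableSet (M A))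
    (hlim : Tendsto (fun A => μ.real (M A)) atTop (𝓝 1)) : ∀ᵐ ω ∂μ, ∃ A, ω ∈ M A := by
  have hge : 1 ≤ μ.real (⋃ A, M A) :=
    le_of_tendsto hlim (.of_forall fun A => measureReal_mono (Set.subset_iUnion M A))
  have hone : μ (⋃ A, M A) = 1 := by
    have hreal : μ.real (⋃ A, M A) = 1 := le_antisymm measureReal_le_one hge
    rwa [Measure.real, ENNReal.toReal_eq_one_iff] at hreal
  filter_upwards [(prob_compl_eq_zero_iff (.iUnion hM)).2 hone] with ω hω
  exact Set.mem_iUnion.1 hω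

lemma IsStepTASEP.ae_jumpOffTime_ne_top (hX : IsStepTASEP μ N p X) (hp0 : 0 < p) (hp1 : p < 1)
    (hx : 1 - (N : ℤ) ≤ x) (hn : StrictMono n) (hr0 : 0 < r) (hr1 : r < 1) (hR1 : 1 < R)
    (hR : R < 1 / (1 - p)) :
    ∀ᵐ ω ∂μ, ∀ i, jumpOffTime X (n i) (exitSite N x (n i)) ω ≠ ⊤ := by
  let passed : Set (Config N) := {d | ∀ i, x + N - ((n i : ℕ) : ℤ) ≤ d.1 (n i)}
  have hmeas : ∀ A, MeasurableSet (X (A + 1) ⁻¹' passed) := fun A =>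
    hX.measurable (A + 1) passed.to_countable.measurableSet
  have hprob : ∀ A : ℕ, (μ.real (X (A + 1) ⁻¹' passed) : ℂ) =
      fredholmDet (cutKernel p N x r R n fun _ => (A : ℝ)) := by
    intro A
    rw [← hX.real_jumpOffTime_le_eq_fredholmDet hp0 hp1 hx hn _ hr0 hr1 hR1 hR]
    congr 1
    refine measureReal_congr ?_
    filter_upwards [hX.ae_eq_stepConfig, hX.ae_stepProb_ne_zero] with ω hstart hstep
    refine propext (forall_congr' fun i => ?_)
    rw [exists_eq_natCast_and_le_iff (Nat.cast_nonneg A), Nat.floor_natCast,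
      jumpOffTime_le_iff hstart hstep hx]
  have hlim : Tendsto (fun A => μ.real (X (A + 1) ⁻¹' passed)) atTop (𝓝 1) := by
    have hdet := tendsto_fredholmDet_cutKernel_natCast (x := x) hp0 hp1 hr0 hr1 hR1 hR hn
    simp_rw [← hprob] at hdet
    exact (Complex.continuous_re.tendsto 1).comp hdet
  filter_upwards [hX.ae_eq_stepConfig, hX.ae_stepProb_ne_zero,
    ae_mem_iUnion_of_tendsto_measureReal hmeas hlim] with ω hstart hstep ⟨A, hA⟩ i
  exact ne_top_of_le_ne_top (ENat.natCast_ne_top A)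
    ((jumpOffTime_le_iff hstart hstep hx (n i) A).2 (hA i))

end Finiteness

end

theorem mainTheorem1 {Ω : Type*} [MeasurableSpace Ω] (μ : Measure Ω) [IsProbabilityMeasure μ]
    (N : ℕ) (p : ℝ) (hp0 : 0 < p) (hp1 : p < 1)
    (X : ℕ → Ω → Config N) (hX : IsStepTASEP μ N p X)
    (x : ℤ) (hx : 1 - (N : ℤ) ≤ x)
    (m : ℕ) (n : Fin m → Fin N) (hn : StrictMono n) (a : Fin m → ℝ)
    (r R : ℝ) (hr0 : 0 < r) (hr1 : r < 1) (hR1 : 1 < R) (hR : R < 1 / (1 - p)) :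
    (∀ᵐ ω ∂μ, (∀ i, jumpOffTime X (n i) (exitSite N x (n i)) ω ≠ ⊤) ∧
      Monotone fun i => jumpOffTime X (n i) (exitSite N x (n i)) ω) ∧
    TraceClassUpToConjugation (cutKernel p N x r R n a) ∧
    FredholmSummable (cutKernel p N x r R n a) ∧
    (μ.real {ω | ∀ i, ∃ t : ℕ,
        jumpOffTime X (n i) (exitSite N x (n i)) ω = t ∧ (t : ℝ) ≤ a i} : ℂ) =
      fredholmDet (cutKernel p N x r R n a) := by
  refine ⟨?_, cutKernel_traceClassUpToConjugation hp0 hp1 hr0 hr1 hR1 hR N x hn a,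
    cutKernel_fredholmSummable hp0 hp1 hr0 hr1 hR1 hR N x hn a,
    hX.real_jumpOffTime_le_eq_fredholmDet hp0 hp1 hx hn a hr0 hr1 hR1 hR⟩
  filter_upwards [hX.ae_eq_stepConfig, hX.ae_stepProb_ne_zero,
    hX.ae_jumpOffTime_ne_top hp0 hp1 hx hn hr0 hr1 hR1 hR] with ω hstart hstep hfinite
  exact ⟨hfinite, (monotone_jumpOffTime hstart hstep hx).comp hn.monotone⟩
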